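/- Let $N\ge 2$ be an integer and let $q\in\mathbb R$ satisfy $\frac43\le q\le\frac32$ if $N=2$, and $\frac N2\le q\le\frac{N+1}2$ if $N\ge3$. Put $\alpha:=\frac{(N-1)q}{N-q}$. Then there is a constant $C>0$, depending only on $N$ and $q$, such that for all $z\in\mathbb C\setminus[0,\infty)$ and all $W_1,W_2\in L^{2q}(\mathbb R^N,\mathbb C)$, the operator $W_1(-\Delta-z)^{-1}W_2$ belongs to the Schatten class $\mathfrak S^{\alpha}(L^2(\mathbb R^N))$ and $$\bigl\|W_1(-\Delta-z)^{-1}W_2\bigr\|_{\mathfrak S^{\alpha}(L^2(\mathbb R^N))}\le C\,|z|^{-1+\frac N{2q}}\,\|W_1\|_{L^{2q}(\mathbb R^N)}\,\|W_2\|_{L^{2q}(\mathbb R^N)}.$$ Here $(-\Delta-z)^{-1}$ is the resolvent of the Laplacian on $L^2(\mathbb R^N)$, and $W_1,W_2$ act by multiplication. The operator $W_1(-\Delta-z)^{-1}W_2$ is the unique bounded operator on $L^2(\mathbb R^N)$ that sends $f$ to $W_1\cdot(-\Delta-z)^{-1}(W_2f)$ for every $f$ in the dense subspace $\{f\in L^2(\mathbb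 R^N): W_2f\in L^2(\mathbb R^N)\}$; its existence is part of the claim. For $\alpha>0$, $\mathfrak S^\alpha(\mathfrak H)$ is the set of compact operators $T$ on the Hilbert space $\mathfrak H$ with $\sum_n\mu_n(T)^\alpha<\infty$, where $(\mu_n(T))_n$ are the non-zero eigenvalues of $\sqrt{T^*T}$ repeated according to multiplicity, and $\|T\|_{\mathfrak S^\alpha}=\bigl(\sum_n\mu_n(T)^\alpha\bigr)^{1/\alpha}$. -/

import Mathlib

open MeasureTheory FourierTransform Laplacian
open scoped ENNReal SchwartzMap

noncomputable section

namespace UniformResolvent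

/-! ### Schatten classes -/

section Schatten

variable {H : Type*} [NormedAddCommGroup H] [InnerProductSpace ℂ H] [CompleteSpace H]

/-- The operator `√(T* T)`. -/
def absOp (T : H →L[ℂ] H) : H →L[ℂ] H :=
  CFC.sqrt (ContinuousLinearMap.adjoint T ∘L T)

/-- The dimension of the eigenspace of `√(T* T)` for `μ`: for `μ > 0` and compact `T`, the number of
times that `μ` occurs in the sequence of singular values of `T`. -/
def singularMultiplicity (T : H →L[ℂ] H) (μ : ℝ) : ℕ :=
  Module.finrank ℂ (Module.End.eigenspace (absOp T : H →ₗ[ℂ] H) (μ : ℂ))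

/-- The sum of the `α`-th powers of the singular values of `T`, that is, of the non-zero eigenvalues
of `√(T* T)`, each repeated according to its multiplicity. -/
def schattenSum (α : ℝ) (T : H →L[ℂ] H) : ℝ≥0∞ :=
  ∑' μ : Set.Ioi (0 : ℝ), (singularMultiplicity T μ : ℝ≥0∞) * ENNReal.ofReal ((μ : ℝ) ^ α)

/-- Membership in the Schatten class of exponent `α`. -/
def MemSchatten (α : ℝ) (T : H →L[ℂ] H) : Prop :=
  IsCompactOperator T ∧ schattenSum α T < ∞

/-- The Schatten norm of exponent `α`, meaningful for members of the Schatten class. -/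
def schattenNorm (α : ℝ) (T : H →L[ℂ] H) : ℝ :=
  (schattenSum α T).toReal ^ (1 / α)

end Schatten

/-! ### The resolvent of the Laplacian -/

/-- The Hilbert space `L²(ℝᴺ; ℂ)`. -/
abbrev L2 (N : ℕ) : Type := Lp (α := EuclideanSpace ℝ (Fin N)) ℂ 2

/-- The complement `ℂ ∖ [0, ∞)` of the closed half-axis. -/
def offHalfAxis : Set ℂ := (Complex.ofReal '' Set.Ici (0 : ℝ))ᶜ

/-- The Fourier symbol `(|2πξ|² - z)⁻¹` of `(-Δ - z)⁻¹`, for the Fourier transform with kernel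
`exp (-2πi ⟨x, ξ⟩)`. -/
def resolventSymbol (N : ℕ) (z : ℂ) (ξ : EuclideanSpace ℝ (Fin N)) : ℂ :=
  ((((2 * Real.pi) ^ 2 * ‖ξ‖ ^ 2 : ℝ) : ℂ) - z)⁻¹

lemma exists_dist_bound {z : ℂ} (hz : z ∈ offHalfAxis) :
    ∃ δ : ℝ, 0 < δ ∧ ∀ t : ℝ, 0 ≤ t → δ ≤ ‖(t : ℂ) - z‖ := by
  have hc : IsClosed (Complex.ofReal '' Set.Ici (0 : ℝ)) :=
    Complex.isometry_ofReal.isClosedEmbedding.isClosedMap _ isClosed_Ici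
  obtain ⟨δ, hδ, h⟩ := Metric.isOpen_iff.1 hc.isOpen_compl z hz
  refine ⟨δ, hδ, fun t ht => ?_⟩
  by_contra! hlt
  exact h (show (t : ℂ) ∈ Metric.ball z δ by simpa [dist_eq_norm] using hlt) ⟨t, ht, rfl⟩

lemma symbol_denom_ne_zero {N : ℕ} {z : ℂ} (hz : z ∈ offHalfAxis)
    (ξ : EuclideanSpace ℝ (Fin N)) :
    (((2 * Real.pi) ^ 2 * ‖ξ‖ ^ 2 : ℝ) : ℂ) - z ≠ 0 := by
  intro h
  exact hz ⟨_, by simp only [Set.mem_Ici]; positivity, sub_eq_zero.1 h⟩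

lemma memLp_resolventSymbol {N : ℕ} {z : ℂ} (hz : z ∈ offHalfAxis) :
    MemLp (resolventSymbol N z) ∞ := by
  obtain ⟨δ, hδ, h⟩ := exists_dist_bound hz
  have hcont : Continuous (resolventSymbol N z) := by
    unfold resolventSymbol
    exact Continuous.inv₀ (by fun_prop) (symbol_denom_ne_zero hz)
  refine memLp_top_of_bound hcont.aestronglyMeasurable δ⁻¹ (.of_forall fun ξ => ?_)
  rw [resolventSymbol, norm_inv]
  exact inv_anti₀ hδ (h _ (by positivity))

/-- The bounded operator `(-Δ - z)⁻¹` on `L²(ℝᴺ)`, for `z ∈ ℂ ∖ [0, ∞)`. -/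
def freeResolvent (N : ℕ) (z : ℂ) (hz : z ∈ offHalfAxis) : L2 N →L[ℂ] L2 N :=
  fourierInvCLM ℂ (L2 N) ∘L
    ((ContinuousLinearMap.lsmul ℂ ℂ).holderL volume ∞ 2 2
      ((memLp_resolventSymbol hz).toLp (resolventSymbol N z)) : L2 N →L[ℂ] L2 N) ∘L
    fourierCLM ℂ (L2 N)

lemma coeFn_fourier_freeResolvent {N : ℕ} {z : ℂ} (hz : z ∈ offHalfAxis) (f : L2 N) :
    (𝓕 (freeResolvent N z hz f) : L2 N) =ᵐ[volume]
      fun ξ => resolventSymbol N z ξ * (𝓕 f : L2 N) ξ := by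
  have h : (𝓕 (freeResolvent N z hz f) : L2 N) = (ContinuousLinearMap.lsmul ℂ ℂ).holder 2
      ((memLp_resolventSymbol hz).toLp (resolventSymbol N z)) (𝓕 f : L2 N) :=
    fourier_fourierInv_eq _
  rw [h]
  filter_upwards [(ContinuousLinearMap.lsmul ℂ ℂ).coeFn_holder (r := 2)
      ((memLp_resolventSymbol hz).toLp (resolventSymbol N z)) (𝓕 f : L2 N),
    (memLp_resolventSymbol (N := N) hz).coeFn_toLp] with ξ h1 h2
  rw [h1, h2]
  rfl

lemma smulLeft_eq_iff {N : ℕ} {d : EuclideanSpace ℝ (Fin N) → ℂ} (hd : d.HasTemperateGrowth)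
    (g h : L2 N) :
    TemperedDistribution.smulLeftCLM ℂ d (g : 𝓢'(EuclideanSpace ℝ (Fin N), ℂ)) =
        (h : 𝓢'(EuclideanSpace ℝ (Fin N), ℂ)) ↔
      (fun ξ => d ξ * g ξ) =ᵐ[volume] h := by
  have key : ∀ φ : 𝓢(EuclideanSpace ℝ (Fin N), ℂ),
      TemperedDistribution.smulLeftCLM ℂ d (g : 𝓢'(EuclideanSpace ℝ (Fin N), ℂ)) φ =
        ∫ ξ, φ ξ • (d ξ * g ξ) := by
    intro φ
    rw [TemperedDistribution.smulLeftCLM_apply_apply, Lp.toTemperedDistribution_apply]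
    refine integral_congr_ae (.of_forall fun ξ => ?_)
    simp only [SchwartzMap.smulLeftCLM_apply_apply hd, smul_eq_mul]
    ring
  constructor
  · intro heq
    have hd' : Continuous d := hd.1.continuous
    have hg : LocallyIntegrable (g : EuclideanSpace ℝ (Fin N) → ℂ) volume :=
      (Lp.memLp g).locallyIntegrable (by norm_num)
    refine ae_eq_of_integral_contDiff_smul_eq ?_
      ((Lp.memLp h).locallyIntegrable (by norm_num)) ?_
    · rw [← locallyIntegrableOn_univ] at hg ⊢
      exact hg.continuousOn_mul hd'.continuousOn isOpen_univ.isLocallyClosed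
    · intro φ hφ hφc
      have hc : HasCompactSupport (fun x => (φ x : ℂ)) := hφc.comp_left Complex.ofReal_zero
      have hs : ContDiff ℝ (⊤ : ℕ∞) (fun x => (φ x : ℂ)) :=
        Complex.ofRealCLM.contDiff.comp hφ
      have := congrArg (fun L : 𝓢'(EuclideanSpace ℝ (Fin N), ℂ) => L (hc.toSchwartzMap hs)) heq
      simp only [key, Lp.toTemperedDistribution_apply] at this
      simpa using this
  · intro hae
    ext φ
    rw [key, Lp.toTemperedDistribution_apply]
    refine integral_congr_ae ?_
    filter_upwards [hae] with ξ hξ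
    rw [hξ]

/-- `u = (-Δ - z)⁻¹ f` exactly when `u` is the `L²` function with `-Δ u - z u = f` in the sense of
tempered distributions. -/
theorem freeResolvent_eq_iff {N : ℕ} {z : ℂ} (hz : z ∈ offHalfAxis) (f u : L2 N) :
    freeResolvent N z hz f = u ↔
      -Δ (u : 𝓢'(EuclideanSpace ℝ (Fin N), ℂ)) - z • (u : 𝓢'(EuclideanSpace ℝ (Fin N), ℂ)) =
        (f : 𝓢'(EuclideanSpace ℝ (Fin N), ℂ)) := by
  let d : EuclideanSpace ℝ (Fin N) → ℂ :=
    fun ξ => (((2 * Real.pi) ^ 2 * ‖ξ‖ ^ 2 : ℝ) : ℂ) - z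
  have hd : d.HasTemperateGrowth := by fun_prop
  have hlap : -Δ (u : 𝓢'(EuclideanSpace ℝ (Fin N), ℂ)) -
      z • (u : 𝓢'(EuclideanSpace ℝ (Fin N), ℂ)) =
      TemperedDistribution.fourierMultiplierCLM ℂ d
        (u : 𝓢'(EuclideanSpace ℝ (Fin N), ℂ)) := by
    have hsum : d = fun ξ => ∑ i ∈ (Finset.univ : Finset (Fin 2)),
        (![((2 * Real.pi : ℂ) ^ 2) • (fun ξ : EuclideanSpace ℝ (Fin N) => ((‖ξ‖ ^ 2 : ℝ) : ℂ)),
          fun _ => -z] i) ξ := by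
      ext ξ
      simp [d, sub_eq_add_neg]
    rw [hsum, TemperedDistribution.fourierMultiplierCLM_sum ℂ]
    · rw [TemperedDistribution.laplacian_eq_fourierMultiplierCLM]
      simp only [Fin.sum_univ_two, Matrix.cons_val_zero, Matrix.cons_val_one]
      rw [TemperedDistribution.fourierMultiplierCLM_smul (by fun_prop),
        TemperedDistribution.fourierMultiplierCLM_const, ← Complex.coe_smul]
      simp [sub_eq_add_neg]
    · intro i _
      fin_cases i
      · simp only [Fin.zero_eta, Matrix.cons_val_zero]
        change Function.HasTemperateGrowth (fun ξ : EuclideanSpace ℝ (Fin N) =>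
          ((2 * Real.pi : ℂ) ^ 2) * ((‖ξ‖ ^ 2 : ℝ) : ℂ))
        fun_prop
      · change Function.HasTemperateGrowth (fun _ : EuclideanSpace ℝ (Fin N) => -z)
        fun_prop
  have hfou : TemperedDistribution.fourierMultiplierCLM ℂ d
        (u : 𝓢'(EuclideanSpace ℝ (Fin N), ℂ)) = (f : 𝓢'(EuclideanSpace ℝ (Fin N), ℂ)) ↔
      (fun ξ => d ξ * (𝓕 u : L2 N) ξ) =ᵐ[volume] (𝓕 f : L2 N) := by
    rw [← smulLeft_eq_iff hd, TemperedDistribution.fourierMultiplierCLM_apply,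
      ← Lp.fourier_toTemperedDistribution_eq, ← Lp.fourier_toTemperedDistribution_eq]
    constructor
    · intro h
      rw [← h, fourier_fourierInv_eq]
    · intro h
      rw [h, fourierInv_fourier_eq]
  rw [hlap, hfou]
  constructor
  · rintro rfl
    filter_upwards [coeFn_fourier_freeResolvent hz f] with ξ hξ
    rw [hξ, resolventSymbol, ← mul_assoc, mul_inv_cancel₀ (symbol_denom_ne_zero hz ξ), one_mul]
  · intro h
    apply (Lp.fourierTransformₗᵢ (EuclideanSpace ℝ (Fin N)) ℂ).injective
    refine Lp.ext ?_
    filter_upwards [coeFn_fourier_freeResolvent hz f, h] with ξ hξ h2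
    refine hξ.trans ?_
    rw [← h2, resolventSymbol, ← mul_assoc, inv_mul_cancel₀ (symbol_denom_ne_zero hz ξ), one_mul]
    rfl

/-! ### The sandwiched operator -/

/-- `T` is the bounded operator `W₁ R W₂` on `L²(ℝᴺ)`, where `W₁`, `W₂` act by multiplication: it
extends the product of `W₁`, `R` and `W₂` from the dense subspace of all `f ∈ L²` with
`W₂ f ∈ L²`. -/
def IsSandwich {N : ℕ} (W₁ : EuclideanSpace ℝ (Fin N) → ℂ) (R : L2 N →L[ℂ] L2 N)
    (W₂ : EuclideanSpace ℝ (Fin N) → ℂ) (T : L2 N →L[ℂ] L2 N) : Prop :=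
  ∀ f : L2 N, ∀ h : MemLp (fun x => W₂ x * f x) 2,
    T f =ᵐ[volume] fun x => W₁ x * R (h.toLp _) x

/-- There is at most one such operator. -/
theorem IsSandwich.unique {N : ℕ} {W₁ W₂ : EuclideanSpace ℝ (Fin N) → ℂ}
    (hW₂ : AEStronglyMeasurable W₂) {R T T' : L2 N →L[ℂ] L2 N}
    (h : IsSandwich W₁ R W₂ T) (h' : IsSandwich W₁ R W₂ T') : T = T' := by
  let D : Submodule ℂ (L2 N) := LinearMap.ker ((T - T' : L2 N →L[ℂ] L2 N) : L2 N →ₗ[ℂ] L2 N)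
  have hDc : IsClosed (D : Set (L2 N)) := (T - T').isClosed_ker
  have hD : ∀ f : L2 N, MemLp (fun x => W₂ x * f x) 2 → f ∈ D := by
    intro f hf
    have : T f = T' f := Lp.ext ((h f hf).trans (h' f hf).symm)
    simp [D, this]
  have hperp : Dᗮ = ⊥ := by
    rw [Submodule.eq_bot_iff]
    intro g hg
    let φ : EuclideanSpace ℝ (Fin N) → ℝ := fun x => (1 + ‖W₂ x‖)⁻¹
    have hφ0 : ∀ x, 0 < φ x := fun x => by positivity
    have hφ1 : ∀ x, φ x ≤ 1 := fun x => inv_le_one_of_one_le₀ (by simp)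
    have hφW : ∀ x, ‖W₂ x‖ * φ x ≤ 1 := fun x => by
      change ‖W₂ x‖ * (1 + ‖W₂ x‖)⁻¹ ≤ 1
      rw [← div_eq_mul_inv, div_le_one (by positivity)]
      linarith
    have hφm : AEStronglyMeasurable φ :=
      ((aemeasurable_const.add hW₂.norm.aemeasurable).inv).aestronglyMeasurable
    have hφm' : AEStronglyMeasurable (fun x => (φ x : ℂ)) :=
      Complex.continuous_ofReal.comp_aestronglyMeasurable hφm
    have hgm := Lp.memLp g
    have hf : MemLp (fun x => (φ x : ℂ) * g x) 2 := by
      refine hgm.mono (hφm'.mul hgm.1) (.of_forall fun x => ?_)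
      rw [norm_mul, Complex.norm_real, Real.norm_of_nonneg (hφ0 x).le]
      exact mul_le_of_le_one_left (norm_nonneg _) (hφ1 x)
    have hWf : MemLp (fun x => W₂ x * (hf.toLp _) x) 2 := by
      refine hgm.mono (hW₂.mul (Lp.memLp _).1) ?_
      filter_upwards [hf.coeFn_toLp] with x hx
      rw [hx, norm_mul, norm_mul, Complex.norm_real, Real.norm_of_nonneg (hφ0 x).le, ← mul_assoc]
      exact mul_le_of_le_one_left (norm_nonneg _) (hφW x)
    have h0 : inner ℂ g (hf.toLp _) = 0 := Submodule.inner_left_of_mem_orthogonal (hD _ hWf) hg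
    rw [L2.inner_def] at h0
    have h1 : ∫ x, φ x * ‖g x‖ ^ 2 = 0 := by
      have : ∫ x, inner ℂ (g x) ((hf.toLp _) x) = ∫ x, ((φ x * ‖g x‖ ^ 2 : ℝ) : ℂ) := by
        refine integral_congr_ae ?_
        filter_upwards [hf.coeFn_toLp] with x hx
        rw [hx, RCLike.inner_apply, mul_assoc, Complex.mul_conj, Complex.normSq_eq_norm_sq]
        push_cast
        ring
      rw [this, integral_complex_ofReal] at h0
      exact_mod_cast h0
    have hint : Integrable (fun x => φ x * ‖g x‖ ^ 2) := by
      have hg2 : Integrable (fun x => ‖g x‖ ^ 2) := (memLp_two_iff_integrable_sq_norm hgm.1).1 hgm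
      refine hg2.mono (hφm.mul hg2.1) (.of_forall fun x => ?_)
      rw [norm_mul, Real.norm_of_nonneg (hφ0 x).le]
      exact mul_le_of_le_one_left (norm_nonneg _) (hφ1 x)
    rw [integral_eq_zero_iff_of_nonneg (fun x => by have := hφ0 x; positivity) hint] at h1
    refine (Lp.eq_zero_iff_ae_eq_zero).2 ?_
    filter_upwards [h1] with x hx
    simpa [(hφ0 x).ne'] using hx
  have htop : D = ⊤ := by
    have : D.HasOrthogonalProjection := by
      have : CompleteSpace D := hDc.completeSpace_coe
      infer_instance
    exact (Submodule.orthogonal_eq_bot_iff).1 hperp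
  ext1 f
  have : f ∈ D := htop ▸ Submodule.mem_top
  simpa [D, sub_eq_zero] using this

end UniformResolvent

end

open UniformResolvent

noncomputable section

namespace UniformResolvent

open Filter Topology Set Metric
open scoped NNReal ComplexConjugate

/-! Write `z = -w²` with `Re w > 0` and `α = 2a`. The operator is the value at `ζ = 1` of the
analytic family `W₁^ζ (-Δ + w²)^(-ζ) W₂^ζ`, where `W^ζ` means `W |W|^(ζ-1)`, on the strip `0 ≤ Re ζ
≤ a`. The bound is a Stein interpolation between the operator norm on `Re ζ = 0` and the
Hilbert–Schmidt norm on `Re ζ = a`.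

On the left edge the powers of `W₁`, `W₂` have modulus at most `1`, and the Fourier symbol is
bounded by `exp (π |Im ζ|)` whatever `w` is. On the right edge, the kernel of `Γ(ζ) (-Δ + w²)^(-ζ)`
is the Laplace transform of the heat kernel, that is, a Bessel type integral. A stationary phase
estimate that is uniform up to `Re w = 0` (`norm_besselIntegral_le`) bounds it by `|w|^((N-1)/2 - a)
|x - y|^(a - (N+1)/2)`, up to a constant growing exponentially in `|Im ζ|`, provided `(N-1)/2 ≤ a ≤
(N+1)/2`. With the weights `|W₁|^a`, `|W₂|^a` this kernel is square integrable by the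
Hardy–Littlewood–Sobolev inequality (`exists_hls`), and the Lebesgue exponent that it asks of the
potentials, `4Na / (N - 1 + 2a)`, is exactly `2q`. The factor `exp (ζ² - 1)` absorbs the growth in
`Im ζ`.

Schatten norms are not interpolated as such. They are replaced by the sums `∑ |⟨f j, T (e j)⟩|^α`
over pairs of finite orthonormal systems (`SchattenBound`). On the left edge each coefficient is
bounded; on the right edge the sum of squares is bounded by Bessel's inequality for the tensors `f j
⊗ conj (e j)`; the scalar three lines theorem does the rest (`sum_rpow_le_of_interpolation`).
`SchattenBound.memSchatten` returns to compactness and singular values.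

All this is done for simple `W₁`, `W₂`, for which the family is a finite sum of explicit holomorphic
functions (`exists_schattenBound_simple`). The bound is bilinear in the potentials, so density and
completeness give the general case (`exists_isSandwich_of_simple`). -/

/-! ### Holomorphic dependence of integrals on a parameter -/

/-- An integral depends holomorphically on a parameter if the integrand does and is locally
dominated by an integrable function. -/
theorem differentiableAt_integral_of_dominated {X : Type*} [MeasurableSpace X] {μ : Measure X}
    {F : ℂ → X → ℂ} {c : ℂ} {ε : ℝ} (hε : 0 < ε) {bound : X → ℝ} (hb : Integrable bound μ)
    (hm : ∀ ζ ∈ ball c ε, AEStronglyMeasurable (F ζ) μ)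
    (hd : ∀ᵐ x ∂μ, DifferentiableOn ℂ (fun ζ => F ζ x) (ball c ε))
    (hle : ∀ᵐ x ∂μ, ∀ ζ ∈ ball c ε, ‖F ζ x‖ ≤ bound x) :
    DifferentiableAt ℂ (fun ζ => ∫ x, F ζ x ∂μ) c := by
  have hc : c ∈ ball c ε := mem_ball_self hε
  have hderiv : ∀ᵐ x ∂μ, ∀ ζ ∈ ball c (ε / 2),
      HasDerivAt (fun ζ => F ζ x) (deriv (fun ζ => F ζ x) ζ) ζ := by
    filter_upwards [hd] with x hx ζ hζ
    exact (hx.differentiableAt (isOpen_ball.mem_nhds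
      (ball_subset_ball (by linarith) hζ))).hasDerivAt
  -- The derivative is measurable as a pointwise limit of difference quotients along a sequence of
  -- increments.
  have hmeas : AEStronglyMeasurable (fun x => deriv (fun ζ => F ζ x) c) μ := by
    let u : ℕ → ℂ := fun n => ((ε / 2 / (n + 1 : ℝ) : ℝ) : ℂ)
    have hpos : ∀ n : ℕ, 0 < ε / 2 / (n + 1 : ℝ) := fun n => by positivity
    have hu0 : ∀ n, u n ≠ 0 := fun n => Complex.ofReal_ne_zero.2 (hpos n).ne'
    have hu : Tendsto u atTop (𝓝[≠] 0) := by
      refine tendsto_nhdsWithin_iff.2 ⟨?_, .of_forall hu0⟩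
      have : Tendsto (fun n : ℕ => ε / 2 / (n + 1 : ℝ)) atTop (𝓝 0) :=
        tendsto_const_nhds.div_atTop (tendsto_natCast_atTop_atTop.atTop_add tendsto_const_nhds)
      have h2 := (Complex.continuous_ofReal.tendsto 0).comp this
      rwa [Complex.ofReal_zero] at h2
    have hmem : ∀ n, c + u n ∈ ball c ε := fun n => by
      rw [mem_ball, dist_eq_norm, add_sub_cancel_left, Complex.norm_real,
        Real.norm_of_nonneg (hpos n).le]
      calc ε / 2 / (n + 1 : ℝ) ≤ ε / 2 :=
            div_le_self (by positivity) (by linarith [n.cast_nonneg (α := ℝ)])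
        _ < ε := by linarith
    refine aestronglyMeasurable_of_tendsto_ae (u := atTop)
      (f := fun n x => (u n)⁻¹ • (F (c + u n) x - F c x)) ?_ ?_
    · exact fun n => ((hm _ (hmem n)).sub (hm _ hc)).const_smul (u n)⁻¹
    · filter_upwards [hderiv] with x hx
      exact ((hasDerivAt_iff_tendsto_slope_zero.1 (hx c (mem_ball_self (by positivity)))).comp hu)
  -- Cauchy's estimate on circles of radius `ε / 4` turns the bound on `F` into a bound on its
  -- derivative over the half ball.
  have hbd : ∀ᵐ x ∂μ, ∀ ζ ∈ ball c (ε / 2),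
      ‖deriv (fun ζ => F ζ x) ζ‖ ≤ bound x / (ε / 4) := by
    filter_upwards [hd, hle] with x hx hxb ζ hζ
    have hsub : closedBall ζ (ε / 4) ⊆ ball c ε := fun y hy => by
      rw [mem_ball] at hζ ⊢
      rw [mem_closedBall] at hy
      linarith [dist_triangle y ζ c]
    refine Complex.norm_deriv_le_of_forall_mem_sphere_norm_le (by positivity)
      (hx.diffContOnCl_ball hsub) fun y hy => hxb y (hsub (sphere_subset_closedBall hy))
  refine (hasDerivAt_integral_of_dominated_loc_of_deriv_le (F := F)
    (F' := fun ζ x => deriv (fun ζ => F ζ x) ζ) (ball_mem_nhds c (half_pos hε))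
    ?_ ?_ hmeas hbd (hb.div_const _) hderiv).2.differentiableAt
  · filter_upwards [ball_mem_nhds c hε] with ζ hζ using hm ζ hζ
  · refine hb.mono' (hm c hc) ?_
    filter_upwards [hle] with x hx using hx c hc

/-! ### Schatten bounds through orthonormal systems -/

section Schatten

variable {H : Type*} [NormedAddCommGroup H] [InnerProductSpace ℂ H]

/-- `T` has Schatten norm of exponent `α` at most `B`, expressed through pairs of finite
orthonormal systems. -/
def SchattenBound (α B : ℝ) (T : H →L[ℂ] H) : Prop :=
  ∀ (n : ℕ) (e f : Fin n → H), Orthonormal ℂ e → Orthonormal ℂ f →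
    ∑ j, ‖inner ℂ (f j) (T (e j))‖ ^ α ≤ B ^ α

lemma SchattenBound.sum_le {α B : ℝ} {T : H →L[ℂ] H} (h : SchattenBound α B T) {ι : Type*}
    [Fintype ι] {e f : ι → H} (he : Orthonormal ℂ e) (hf : Orthonormal ℂ f) :
    ∑ j, ‖inner ℂ (f j) (T (e j))‖ ^ α ≤ B ^ α := by
  let σ := (Fintype.equivFin ι).symm
  have := h _ (e ∘ σ) (f ∘ σ) (he.comp σ σ.injective) (hf.comp σ σ.injective)
  rwa [← σ.sum_comp (fun j => ‖inner ℂ (f j) (T (e j))‖ ^ α)]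

/-- Test on the one-element systems `x / ‖x‖` and `T x / ‖T x‖`. -/
lemma SchattenBound.opNorm_le {α B : ℝ} (hα : 0 < α) (hB : 0 ≤ B) {T : H →L[ℂ] H}
    (h : SchattenBound α B T) : ‖T‖ ≤ B := by
  refine T.opNorm_le_bound hB fun x => ?_
  rcases eq_or_ne x 0 with rfl | hx
  · simp
  rcases eq_or_ne (T x) 0 with hTx | hTx
  · rw [hTx, norm_zero]; positivity
  have key := h 1 (fun _ => (‖x‖⁻¹ : ℂ) • x) (fun _ => (‖T x‖⁻¹ : ℂ) • T x)
    ?_ ?_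
  · simp only [Finset.univ_unique, Finset.sum_const, Finset.card_singleton, one_smul, map_smul,
      inner_smul_left, inner_smul_right, inner_self_eq_norm_sq_to_K, norm_mul] at key
    have h1 := (Real.rpow_le_rpow_iff (by positivity) hB hα).1 key
    have hx' : 0 < ‖x‖ := norm_pos_iff.2 hx
    have hTx' : 0 < ‖T x‖ := norm_pos_iff.2 hTx
    simp at h1
    have h2 : ‖x‖⁻¹ * (‖T x‖⁻¹ * ‖T x‖ ^ 2) = ‖T x‖ / ‖x‖ := by field_simp
    rw [← div_le_iff₀ hx', ← h2]
    linarith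
  all_goals
    refine ⟨fun _ => ?_, fun i j hij => (hij (Subsingleton.elim _ _)).elim⟩
    rw [norm_smul]
    simp [hx, hTx]

/-- Only finite sums of matrix coefficients are involved, so the bound survives operator limits;
this serves the passage to general potentials. -/
lemma SchattenBound.of_tendsto {α : ℝ} (hα : 0 < α) {T : ℕ → H →L[ℂ] H} {S : H →L[ℂ] H}
    {B : ℕ → ℝ} {B' : ℝ}
    (hT : Tendsto T atTop (𝓝 S)) (hB : Tendsto B atTop (𝓝 B'))
    (h : ∀ n, SchattenBound α (B n) (T n)) : SchattenBound α B' S := by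
  intro n e f he hf
  refine le_of_tendsto_of_tendsto' (tendsto_finsetSum _ fun j _ => ?_)
    (hB.rpow_const (Or.inr hα.le)) fun k => h k n e f he hf
  refine Tendsto.rpow_const (Tendsto.norm (Tendsto.inner tendsto_const_nhds ?_)) (Or.inr hα.le)
  exact ((ContinuousLinearMap.apply ℂ H (e j)).continuous.tendsto S).comp hT

variable [CompleteSpace H]

/-- Otherwise choose unit vectors `e n` with `‖T (e n)‖ > ε` inductively, each orthogonal to the
earlier `e i` and to `T* T (e i)`. Then the `T (e n)` are mutually orthogonal too; normalising them
gives sums of size at least `n ε^α`, which are unbounded. -/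
lemma SchattenBound.exists_finiteDimensional {α B : ℝ} (hα : 0 < α)
    {T : H →L[ℂ] H} (h : SchattenBound α B T) {ε : ℝ} (hε : 0 < ε) :
    ∃ V : Submodule ℂ H, FiniteDimensional ℂ V ∧ ∀ x ∈ Vᗮ, ‖T x‖ ≤ ε * ‖x‖ := by
  by_contra! hcon
  let r : H → H → Prop := fun x y => inner ℂ x y = 0 ∧ inner ℂ (T x) (T y) = 0
  have hr : Std.Symm r := ⟨fun x y hxy =>
    ⟨inner_eq_zero_symm.1 hxy.1, inner_eq_zero_symm.1 hxy.2⟩⟩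
  obtain ⟨e, heP, her⟩ := exists_seq_of_forall_finset_exists'
    (P := fun x => ‖x‖ = 1 ∧ ε < ‖T x‖) (r := r) (by
      intro s _
      let V : Submodule ℂ H := Submodule.span ℂ
        ((s : Set H) ∪ (fun x => ContinuousLinearMap.adjoint T (T x)) '' s)
      have hV : FiniteDimensional ℂ V :=
        FiniteDimensional.span_of_finite ℂ (s.finite_toSet.union (s.finite_toSet.image _))
      obtain ⟨x, hxV, hx⟩ := hcon V hV
      have hx0 : x ≠ 0 := by rintro rfl; simp at hx
      have hxn : 0 < ‖x‖ := norm_pos_iff.2 hx0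
      refine ⟨(‖x‖⁻¹ : ℂ) • x, ⟨?_, ?_⟩, fun y hy => ?_⟩
      · rw [norm_smul]; simp [hx0]
      · rw [map_smul, norm_smul]
        simp only [norm_inv, Complex.norm_real, norm_norm]
        rw [inv_mul_eq_div, lt_div_iff₀ hxn]
        exact hx
      · have h1 : inner ℂ y x = 0 := hxV y (Submodule.subset_span (Or.inl hy))
        have h2 : inner ℂ (ContinuousLinearMap.adjoint T (T y)) x = 0 :=
          hxV _ (Submodule.subset_span (Or.inr ⟨y, hy, rfl⟩))
        rw [ContinuousLinearMap.adjoint_inner_left] at h2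
        simp only [r, map_smul, inner_smul_right, h1, h2, mul_zero, and_self])
  have hTe : ∀ n, 0 < ‖T (e n)‖ := fun n => hε.trans (heP n).2
  have hort : Orthonormal ℂ e := ⟨fun n => (heP n).1, fun i j hij => (her hij).1⟩
  let f : ℕ → H := fun n => (‖T (e n)‖⁻¹ : ℂ) • T (e n)
  have hf : Orthonormal ℂ f := by
    refine ⟨fun n => ?_, fun i j hij => ?_⟩
    · simp only [f]
      rw [norm_smul]; simp [(norm_pos_iff.1 (hTe n))]
    · have := (her hij).2
      simp only [f, inner_smul_left, inner_smul_right]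
      rw [this]; simp
  have hval : ∀ n, ε ≤ ‖inner ℂ (f n) (T (e n))‖ := fun n => by
    have := hTe n
    simp only [f, inner_smul_left, inner_self_eq_norm_sq_to_K, norm_mul]
    simp only [map_inv₀, Complex.conj_ofReal, norm_inv, Complex.norm_real, norm_norm,
      Complex.coe_algebraMap, norm_pow]
    have h2 : ‖T (e n)‖⁻¹ * ‖T (e n)‖ ^ 2 = ‖T (e n)‖ := by field_simp
    rw [h2]; exact (heP n).2.le
  have hbound : ∀ n : ℕ, n * ε ^ α ≤ B ^ α := fun n => by
    refine le_trans ?_ (h n (fun i => e i) (fun i => f i) (hort.comp _ Fin.val_injective)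
      (hf.comp _ Fin.val_injective))
    calc (n : ℝ) * ε ^ α = ∑ _j : Fin n, ε ^ α := by simp
      _ ≤ _ := Finset.sum_le_sum fun j _ => Real.rpow_le_rpow hε.le (hval j) hα.le
  obtain ⟨n, hn⟩ := exists_nat_gt (B ^ α / ε ^ α)
  rw [div_lt_iff₀ (by positivity)] at hn
  exact absurd (hbound n) (not_le.2 hn)

/-- `T` is small off a finite-dimensional subspace `V`, hence is a norm limit of the finite rank
operators obtained by first projecting onto `V`. -/
lemma SchattenBound.isCompactOperator {α B : ℝ} (hα : 0 < α)
    {T : H →L[ℂ] H} (h : SchattenBound α B T) : IsCompactOperator T := by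
  choose V hV hT using fun n : ℕ => h.exists_finiteDimensional hα
    (ε := 1 / ((n : ℝ) + 1)) (by positivity)
  refine isCompactOperator_of_tendsto (l := atTop) (F := fun n => T ∘L (V n).starProjection) ?_
    (.of_forall fun n => ?_)
  · rw [tendsto_iff_norm_sub_tendsto_zero]
    refine squeeze_zero (fun _ => norm_nonneg _) (fun n => ?_)
      tendsto_one_div_add_atTop_nhds_zero_nat
    refine ContinuousLinearMap.opNorm_le_bound _ (by positivity) fun x => ?_
    have h1 : (T ∘L (V n).starProjection - T) x = -T (x - (V n).starProjection x) := by
      simp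
    rw [h1, norm_neg]
    refine (hT n _ ((V n).sub_starProjection_mem_orthogonal x)).trans ?_
    gcongr
    rw [← Submodule.starProjection_orthogonal_val]
    exact Submodule.norm_starProjection_apply_le _ x
  · have : IsCompactOperator (V n).starProjection := by
      have h2 : IsCompactOperator (V n).orthogonalProjectionOnto :=
        isCompactOperator_of_locallyCompactSpace_dom _
      exact h2.clm_comp (V n).subtypeL
    exact this.clm_comp T

lemma absOp_absOp_apply (T : H →L[ℂ] H) (x : H) :
    absOp T (absOp T x) = ContinuousLinearMap.adjoint T (T x) := by
  have h0 : (0 : H →L[ℂ] H) ≤ ContinuousLinearMap.adjoint T ∘L T := star_mul_self_nonneg T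
  have := CFC.sqrt_mul_sqrt_self (ContinuousLinearMap.adjoint T ∘L T) h0
  exact congrArg (fun S : H →L[ℂ] H => S x) this

lemma absOp_isSymmetric (T : H →L[ℂ] H) : (absOp T : H →ₗ[ℂ] H).IsSymmetric :=
  ContinuousLinearMap.isSelfAdjoint_iff_isSymmetric.1
    (IsSelfAdjoint.of_nonneg (CFC.sqrt_nonneg (ContinuousLinearMap.adjoint T ∘L T)))

/-- For an infinite-dimensional eigenspace `Module.finrank` takes the value `0`, and the empty
family is enough. -/
lemma exists_orthonormal_eigenspace (T : H →L[ℂ] H) (μ : ℝ) :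
    ∃ v : Fin (singularMultiplicity T μ) →
      Module.End.eigenspace (absOp T : H →ₗ[ℂ] H) (μ : ℂ), Orthonormal ℂ v := by
  rcases Nat.eq_zero_or_pos (singularMultiplicity T μ) with h0 | hpos
  · have : IsEmpty (Fin (singularMultiplicity T μ)) := by rw [h0]; infer_instance
    exact ⟨fun i => isEmptyElim i, fun i => isEmptyElim i, fun i => isEmptyElim i⟩
  · have : FiniteDimensional ℂ (Module.End.eigenspace (absOp T : H →ₗ[ℂ] H) (μ : ℂ)) :=
      Module.finite_of_finrank_pos hpos
    exact ⟨_, (stdOrthonormalBasis ℂ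
      (Module.End.eigenspace (absOp T : H →ₗ[ℂ] H) (μ : ℂ))).orthonormal⟩

/-- By the polar decomposition, orthonormal eigenvectors `e i` of `√(T* T)` with eigenvalues `m i >
0` give orthonormal vectors `f i = T (e i) / m i`, and `⟨f i, T (e i)⟩ = m i`. Testing on these two
systems bounds every finite partial sum of the series. -/
lemma SchattenBound.schattenSum_le {α B : ℝ} {T : H →L[ℂ] H} (h : SchattenBound α B T) :
    schattenSum α T ≤ ENNReal.ofReal (B ^ α) := by
  rw [schattenSum, ENNReal.tsum_eq_iSup_sum]
  refine iSup_le fun s => ?_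
  choose v hv using exists_orthonormal_eigenspace T
  let ι := Σ μ : s, Fin (singularMultiplicity T (μ : Set.Ioi (0 : ℝ)))
  let e : ι → H := fun i => (v (i.1 : Set.Ioi (0 : ℝ)) i.2 : H)
  let m : ι → ℝ := fun i => ((i.1 : Set.Ioi (0 : ℝ)) : ℝ)
  have hm : ∀ i, 0 < m i := fun i => (i.1 : Set.Ioi (0 : ℝ)).2
  have he : Orthonormal ℂ e := by
    have hfam := ((absOp_isSymmetric T).orthogonalFamily_eigenspaces).comp
      (f := fun μ : s => (((μ : Set.Ioi (0 : ℝ)) : ℝ) : ℂ))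
      (fun x y hxy => Subtype.ext (Subtype.ext (Complex.ofReal_injective hxy)))
    exact hfam.orthonormal_sigma_orthonormal (v_family := fun μ : s => v (μ : Set.Ioi (0 : ℝ)))
      fun μ => hv _
  have hev : ∀ i, absOp T (e i) = (m i : ℂ) • e i := fun i =>
    Module.End.mem_eigenspace_iff.1 (v (i.1 : Set.Ioi (0 : ℝ)) i.2).2
  have hTT : ∀ i j, inner ℂ (T (e i)) (T (e j)) = (m j : ℂ) ^ 2 * inner ℂ (e i) (e j) := by
    intro i j
    rw [← ContinuousLinearMap.adjoint_inner_right, ← absOp_absOp_apply, hev, map_smul, hev,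
      smul_smul, inner_smul_right, sq]
  let f : ι → H := fun i => ((m i)⁻¹ : ℂ) • T (e i)
  have hf : Orthonormal ℂ f := by
    classical
    rw [orthonormal_iff_ite] at he ⊢
    intro i j
    have hi : (m i : ℂ) ≠ 0 := Complex.ofReal_ne_zero.2 (hm i).ne'
    simp only [f, inner_smul_left, inner_smul_right, hTT, he]
    split_ifs with hij
    · subst hij
      simp only [map_inv₀, Complex.conj_ofReal, mul_one]
      field_simp
    · simp
  have hval : ∀ i, ‖inner ℂ (f i) (T (e i))‖ = m i := by
    intro i
    have hi : (m i : ℂ) ≠ 0 := Complex.ofReal_ne_zero.2 (hm i).ne'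
    have hee : inner ℂ (e i) (e i) = 1 := by rw [inner_self_eq_norm_sq_to_K, he.1]; simp
    simp only [f, inner_smul_left, hTT, hee, map_inv₀, Complex.conj_ofReal, mul_one]
    rw [sq, inv_mul_cancel_left₀ hi, Complex.norm_real, Real.norm_of_nonneg (hm i).le]
  have key := h.sum_le he hf
  simp only [hval] at key
  refine le_trans (le_of_eq ?_) (ENNReal.ofReal_le_ofReal key)
  rw [ENNReal.ofReal_sum_of_nonneg fun i _ => Real.rpow_nonneg (hm i).le _, Fintype.sum_sigma,
    ← Finset.sum_coe_sort s]
  refine Finset.sum_congr rfl fun μ _ => ?_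
  simp [m]

/-- The bound through orthonormal systems gives membership in the Schatten class. -/
theorem SchattenBound.memSchatten {α B : ℝ} (hα : 0 < α) (hB : 0 ≤ B) {T : H →L[ℂ] H}
    (h : SchattenBound α B T) : MemSchatten α T ∧ schattenNorm α T ≤ B := by
  refine ⟨⟨h.isCompactOperator hα, h.schattenSum_le.trans_lt ENNReal.ofReal_lt_top⟩, ?_⟩
  have h1 : (schattenSum α T).toReal ≤ B ^ α :=
    ENNReal.toReal_le_of_le_ofReal (by positivity) h.schattenSum_le
  calc schattenNorm α T ≤ (B ^ α) ^ (1 / α) :=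
        Real.rpow_le_rpow ENNReal.toReal_nonneg h1 (by positivity)
    _ = B := by rw [← Real.rpow_mul hB, mul_one_div_cancel hα.ne', Real.rpow_one]

end Schatten

/-! ### The diagonal Hardy–Littlewood–Sobolev inequality -/

section HLS

variable {N : ℕ}

lemma lintegral_radial (hN : 1 ≤ N) {f : ℝ → ℝ} (hf : ∀ r, 0 ≤ r → 0 ≤ f r)
    (hintegrable : IntegrableOn (fun y : ℝ => y ^ (N - 1) * f y) (Ioi 0)) :
    ∫⁻ x : EuclideanSpace ℝ (Fin N), ENNReal.ofReal (f ‖x‖) =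
      ENNReal.ofReal (N * volume.real (ball (0 : EuclideanSpace ℝ (Fin N)) 1) *
        ∫ y in Ioi (0 : ℝ), y ^ (N - 1) * f y) := by
  have : Nonempty (Fin N) := ⟨⟨0, hN⟩⟩
  have h1 : Integrable (fun x : EuclideanSpace ℝ (Fin N) => f ‖x‖) := by
    rw [integrable_fun_norm_addHaar volume (f := f)]
    simpa using hintegrable
  rw [← ofReal_integral_eq_lintegral_ofReal h1 (.of_forall fun x => hf _ (norm_nonneg x)),
    integral_fun_norm_addHaar volume f]
  simp [mul_assoc]

lemma exists_lintegral_ball_rpow_le {s : ℝ} (hN : 1 ≤ N) (hs : s < N) :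
    ∃ C : ℝ, 0 ≤ C ∧ ∀ r : ℝ, 0 < r →
      ∫⁻ x in ball (0 : EuclideanSpace ℝ (Fin N)) r, ENNReal.ofReal (‖x‖ ^ (-s)) ≤
        ENNReal.ofReal (C * r ^ (N - s)) := by
  set V := volume.real (ball (0 : EuclideanSpace ℝ (Fin N)) 1)
  have hNs : 0 < (N : ℝ) - s := by linarith
  refine ⟨N * V / (N - s), by positivity, fun r hr => ?_⟩
  have hfun : ∀ y ∈ Ioi (0 : ℝ), y ^ (N - 1) * (Iio r).indicator (fun t => t ^ (-s)) y =
      (Ioo 0 r).indicator (fun t : ℝ => t ^ ((N : ℝ) - s - 1)) y := by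
    intro y hy
    rw [mem_Ioi] at hy
    by_cases hyr : y < r
    · rw [indicator_of_mem (by exact hyr), indicator_of_mem (by exact ⟨hy, hyr⟩),
        ← Real.rpow_natCast, ← Real.rpow_add hy]
      congr 1
      push_cast [Nat.cast_sub hN]
      ring
    · rw [indicator_of_notMem (by exact hyr), indicator_of_notMem (fun h => hyr h.2), mul_zero]
  have hpow : IntegrableOn (fun t : ℝ => t ^ ((N : ℝ) - s - 1)) (Ioo 0 r) :=
    (intervalIntegral.integrableOn_Ioo_rpow_iff hr).2 (by linarith)
  have hintegrable : IntegrableOn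
      (fun y : ℝ => y ^ (N - 1) * (Iio r).indicator (fun t => t ^ (-s)) y) (Ioi 0) := by
    rw [integrableOn_congr_fun hfun measurableSet_Ioi]
    exact (hpow.integrable_indicator measurableSet_Ioo).integrableOn
  have hval : ∫ y in Ioi (0 : ℝ), y ^ (N - 1) * (Iio r).indicator (fun t => t ^ (-s)) y =
      r ^ (N - s) / (N - s) := by
    rw [setIntegral_congr_fun measurableSet_Ioi hfun, setIntegral_indicator measurableSet_Ioo,
      inter_eq_self_of_subset_right (fun y hy => hy.1), ← integral_Ioc_eq_integral_Ioo,
      ← intervalIntegral.integral_of_le hr.le, integral_rpow (Or.inl (by linarith))]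
    have : (N : ℝ) - s - 1 + 1 = N - s := by ring
    rw [this, Real.zero_rpow (by linarith), sub_zero]
  have hrad := lintegral_radial (N := N) hN
    (f := (Iio r).indicator (fun t => t ^ (-s)))
    (fun t ht => indicator_apply_nonneg (fun _ => Real.rpow_nonneg ht _)) hintegrable
  have heq : ∫⁻ x in ball (0 : EuclideanSpace ℝ (Fin N)) r, ENNReal.ofReal (‖x‖ ^ (-s)) =
      ∫⁻ x : EuclideanSpace ℝ (Fin N),
        ENNReal.ofReal ((Iio r).indicator (fun t => t ^ (-s)) ‖x‖) := by
    rw [← lintegral_indicator measurableSet_ball]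
    refine lintegral_congr fun x => ?_
    by_cases hx : ‖x‖ < r <;> simp [indicator, hx]
  rw [heq, hrad, hval]
  refine ENNReal.ofReal_le_ofReal (le_of_eq ?_)
  change (N : ℝ) * V * _ = _
  ring

lemma exists_lintegral_compl_ball_rpow_le {s : ℝ} (hN : 1 ≤ N) (hs : (N : ℝ) < s) :
    ∃ C : ℝ, 0 ≤ C ∧ ∀ r : ℝ, 0 < r →
      ∫⁻ x in (ball (0 : EuclideanSpace ℝ (Fin N)) r)ᶜ, ENNReal.ofReal (‖x‖ ^ (-s)) ≤
        ENNReal.ofReal (C * r ^ (N - s)) := by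
  set V := volume.real (ball (0 : EuclideanSpace ℝ (Fin N)) 1)
  have hNs : 0 < s - (N : ℝ) := by linarith
  refine ⟨N * V / (s - N), by positivity, fun r hr => ?_⟩
  have hfun : ∀ y ∈ Ioi (0 : ℝ), y ^ (N - 1) * (Ici r).indicator (fun t => t ^ (-s)) y =
      (Ici r).indicator (fun t : ℝ => t ^ ((N : ℝ) - s - 1)) y := by
    intro y hy
    rw [mem_Ioi] at hy
    by_cases hyr : r ≤ y
    · rw [indicator_of_mem (by exact hyr), indicator_of_mem (by exact hyr),
        ← Real.rpow_natCast, ← Real.rpow_add hy]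
      congr 1
      push_cast [Nat.cast_sub hN]
      ring
    · rw [indicator_of_notMem (by exact hyr), indicator_of_notMem (by exact hyr), mul_zero]
  have hpow : IntegrableOn (fun t : ℝ => t ^ ((N : ℝ) - s - 1)) (Ici r) :=
    (integrableOn_Ici_iff_integrableOn_Ioi (by finiteness)).2
      (integrableOn_Ioi_rpow_of_lt (by linarith) hr)
  have hintegrable : IntegrableOn
      (fun y : ℝ => y ^ (N - 1) * (Ici r).indicator (fun t => t ^ (-s)) y) (Ioi 0) := by
    rw [integrableOn_congr_fun hfun measurableSet_Ioi]
    exact (hpow.integrable_indicator measurableSet_Ici).integrableOn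
  have hval : ∫ y in Ioi (0 : ℝ), y ^ (N - 1) * (Ici r).indicator (fun t => t ^ (-s)) y =
      r ^ (N - s) / (s - N) := by
    rw [setIntegral_congr_fun measurableSet_Ioi hfun, setIntegral_indicator measurableSet_Ici,
      inter_eq_self_of_subset_right (Ici_subset_Ioi.2 hr), integral_Ici_eq_integral_Ioi,
      integral_Ioi_rpow_of_lt (by linarith) hr]
    have : (N : ℝ) - s - 1 + 1 = N - s := by ring
    rw [this, ← neg_div_neg_eq, neg_neg, neg_sub]
  have hrad := lintegral_radial (N := N) hN
    (f := (Ici r).indicator (fun t => t ^ (-s)))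
    (fun t ht => indicator_apply_nonneg (fun _ => Real.rpow_nonneg ht _)) hintegrable
  have heq : ∫⁻ x in (ball (0 : EuclideanSpace ℝ (Fin N)) r)ᶜ, ENNReal.ofReal (‖x‖ ^ (-s)) =
      ∫⁻ x : EuclideanSpace ℝ (Fin N),
        ENNReal.ofReal ((Ici r).indicator (fun t => t ^ (-s)) ‖x‖) := by
    rw [← lintegral_indicator measurableSet_ball.compl]
    refine lintegral_congr fun x => ?_
    by_cases hx : r ≤ ‖x‖ <;> simp [indicator, hx]
  rw [heq, hrad, hval]
  refine ENNReal.ofReal_le_ofReal (le_of_eq ?_)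
  change (N : ℝ) * V * _ = _
  ring

/-- Cut the integral at a radius `r` around `x`. Inside, `g ≤ h` leaves the integral of the kernel;
outside, Hölder's inequality uses the normalisation of `g`. Both parts are of order `h^(p-1)` for
the right `r`. -/
lemma exists_truncated_potential_le {s : ℝ} (hN : 1 ≤ N) (hs0 : 0 < s) (hs : s < N) :
    ∃ C : ℝ, 0 ≤ C ∧ ∀ g : EuclideanSpace ℝ (Fin N) → ℝ≥0, Measurable g →
      ∫⁻ y, (g y : ℝ≥0∞) ^ (2 * N / (2 * N - s)) ≤ 1 → ∀ (h : ℝ≥0), 0 < h →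
        ∀ x : EuclideanSpace ℝ (Fin N),
          ∫⁻ y in {y | g y ≤ h}, ENNReal.ofReal (‖x - y‖ ^ (-s)) * g y ≤
            ENNReal.ofReal C * (h : ℝ≥0∞) ^ (2 * N / (2 * N - s) - 1) := by
  set p : ℝ := 2 * N / (2 * N - s) with hp
  set p' : ℝ := 2 * N / s with hp'
  have hN0 : (0 : ℝ) < N := hs0.trans hs
  have hden : 0 < 2 * (N : ℝ) - s := by linarith
  have hpp : p.HolderConjugate p' := by
    rw [Real.holderConjugate_iff]
    constructor
    · rw [hp, lt_div_iff₀ hden]; linarith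
    · rw [hp, hp']; field_simp; ring
  obtain ⟨C₁, hC₁, h₁⟩ := exists_lintegral_ball_rpow_le (N := N) hN hs
  -- The conjugate exponent is `p' = 2N / s`, so the `p'`-th power of the kernel is `‖x‖^(-2N)`.
  obtain ⟨C₂, hC₂, h₂⟩ := exists_lintegral_compl_ball_rpow_le (N := N) (s := 2 * N) hN (by linarith)
  refine ⟨C₁ + C₂ ^ (1 / p'), by positivity, fun g hg hg1 h hh x => ?_⟩
  -- The radius that balances the two parts: `r^(N-s) h` and `r^(-s/2)` both equal `h^(s/(2N-s)) =
  -- h^(p-1)`.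
  set r : ℝ := (h : ℝ) ^ (-(2 / (2 * N - s))) with hr
  have hh' : (0 : ℝ) < h := hh
  have hr0 : 0 < r := by positivity
  have hk : Measurable fun y => ENNReal.ofReal (‖x - y‖ ^ (-s)) := by fun_prop
  have hgm : Measurable fun y => (g y : ℝ≥0∞) := hg.coe_nnreal_ennreal
  have hset : MeasurableSet {y | g y ≤ h} := hg measurableSet_Iic
  have hball : MeasurableSet (ball x r) := measurableSet_ball
  have htrans : ∀ (S : Set (EuclideanSpace ℝ (Fin N))) (F : EuclideanSpace ℝ (Fin N) → ℝ≥0∞),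
      MeasurableSet S →
      ∫⁻ y in (fun y => x - y) ⁻¹' S, F (x - y) = ∫⁻ y in S, F y := by
    intro S F hS
    rw [← lintegral_indicator hS, ← lintegral_indicator (hS.preimage (by fun_prop)),
      ← lintegral_sub_left_eq_self (S.indicator F) x]
    rfl
  have hbx : ball x r = (fun y => x - y) ⁻¹' ball 0 r := by
    ext y; simp [dist_eq_norm, norm_sub_rev]
  have hnear : ∫⁻ y in {y | g y ≤ h} ∩ ball x r, ENNReal.ofReal (‖x - y‖ ^ (-s)) * g y ≤
      ENNReal.ofReal C₁ * (h : ℝ≥0∞) ^ (p - 1) := by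
    calc _ ≤ ∫⁻ y in {y | g y ≤ h} ∩ ball x r, ENNReal.ofReal (‖x - y‖ ^ (-s)) * h := by
          refine setLIntegral_mono' (hset.inter hball) fun y hy => ?_
          gcongr
          exact hy.1
      _ ≤ ∫⁻ y in ball x r, ENNReal.ofReal (‖x - y‖ ^ (-s)) * h :=
          lintegral_mono_set inter_subset_right
      _ = (∫⁻ y in ball (0 : EuclideanSpace ℝ (Fin N)) r, ENNReal.ofReal (‖y‖ ^ (-s))) * h := by
          rw [lintegral_mul_const _ hk, hbx,
            htrans _ (fun y => ENNReal.ofReal (‖y‖ ^ (-s))) measurableSet_ball]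
      _ ≤ ENNReal.ofReal (C₁ * r ^ (N - s)) * h := by gcongr; exact h₁ r hr0
      _ = ENNReal.ofReal C₁ * (h : ℝ≥0∞) ^ (p - 1) := by
          rw [ENNReal.ofReal_mul hC₁, mul_assoc, ← ENNReal.ofReal_coe_nnreal,
            ENNReal.ofReal_rpow_of_pos hh', ← ENNReal.ofReal_mul (by positivity)]
          congr 2
          rw [hr, ← Real.rpow_mul hh'.le]
          nth_rewrite 2 [← Real.rpow_one (h : ℝ)]
          rw [← Real.rpow_add hh']
          congr 1
          rw [hp]; field_simp; ring
  have hfar : ∫⁻ y in {y | g y ≤ h} ∩ (ball x r)ᶜ, ENNReal.ofReal (‖x - y‖ ^ (-s)) * g y ≤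
      ENNReal.ofReal (C₂ ^ (1 / p')) * (h : ℝ≥0∞) ^ (p - 1) := by
    calc _ ≤ ∫⁻ y in (ball x r)ᶜ, ENNReal.ofReal (‖x - y‖ ^ (-s)) * g y :=
          lintegral_mono_set inter_subset_right
      _ ≤ (∫⁻ y in (ball x r)ᶜ, ENNReal.ofReal (‖x - y‖ ^ (-s)) ^ p') ^ (1 / p') *
            (∫⁻ y in (ball x r)ᶜ, (g y : ℝ≥0∞) ^ p) ^ (1 / p) :=
          ENNReal.lintegral_mul_le_Lp_mul_Lq _ hpp.symm hk.aemeasurable hgm.aemeasurable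
      _ ≤ (ENNReal.ofReal (C₂ * r ^ ((N : ℝ) - 2 * N))) ^ (1 / p') * 1 := by
          have hp0 : 0 < p := hpp.pos
          have hp'0 : 0 < p' := hpp.symm.pos
          gcongr
          · refine le_trans (le_of_eq ?_) (h₂ r hr0)
            rw [← htrans _ (fun y => ENNReal.ofReal (‖y‖ ^ (-(2 * (N : ℝ)))))
              measurableSet_ball.compl, preimage_compl, ← hbx]
            refine setLIntegral_congr_fun hball.compl fun y _ => ?_
            rw [ENNReal.ofReal_rpow_of_nonneg (by positivity) hp'0.le,
              ← Real.rpow_mul (norm_nonneg _)]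
            congr 2
            rw [hp']; field_simp
          · refine ENNReal.rpow_le_one ?_ (by positivity)
            exact (setLIntegral_le_lintegral _ _).trans hg1
      _ = ENNReal.ofReal (C₂ ^ (1 / p')) * (h : ℝ≥0∞) ^ (p - 1) := by
          have hp'0 : 0 < p' := hpp.symm.pos
          rw [mul_one, ENNReal.ofReal_rpow_of_nonneg (by positivity) (by positivity),
            Real.mul_rpow hC₂ (by positivity), ENNReal.ofReal_mul (by positivity),
            ← ENNReal.ofReal_coe_nnreal, ENNReal.ofReal_rpow_of_pos hh']
          congr 2
          rw [hr, ← Real.rpow_mul hh'.le, ← Real.rpow_mul hh'.le]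
          congr 1
          rw [hp, hp']; field_simp; ring
  rw [← lintegral_inter_add_sdiff _ _ hball, sdiff_eq]
  refine (add_le_add hnear hfar).trans (le_of_eq ?_)
  rw [← add_mul, ← ENNReal.ofReal_add hC₁ (by positivity)]

/-- Split the double integral according to which of `f x`, `g y` is larger. Where `g y ≤ f x`, the
truncated potential at height `h = f x` is at most `C (f x)^(p-1)`, and integrating it against `f`
leaves `C ∫ f^p`. The other half is the same with the roles exchanged. -/
lemma exists_hls_normalized {s : ℝ} (hN : 1 ≤ N) (hs0 : 0 < s) (hs : s < N) :
    ∃ C : ℝ, 0 ≤ C ∧ ∀ f g : EuclideanSpace ℝ (Fin N) → ℝ≥0, Measurable f → Measurable g →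
      ∫⁻ y, (f y : ℝ≥0∞) ^ (2 * N / (2 * N - s)) ≤ 1 →
      ∫⁻ y, (g y : ℝ≥0∞) ^ (2 * N / (2 * N - s)) ≤ 1 →
        ∫⁻ x, ∫⁻ y, f x * (ENNReal.ofReal (‖x - y‖ ^ (-s)) * g y) ≤ ENNReal.ofReal C := by
  obtain ⟨C, hC, h⟩ := exists_truncated_potential_le (N := N) hN hs0 hs
  set p : ℝ := 2 * N / (2 * N - s) with hp
  have hp0 : 1 < p := by
    rw [hp, lt_div_iff₀ (by linarith)]; linarith
  have half : ∀ f g : EuclideanSpace ℝ (Fin N) → ℝ≥0, Measurable f → Measurable g →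
      ∫⁻ y, (f y : ℝ≥0∞) ^ p ≤ 1 → ∫⁻ y, (g y : ℝ≥0∞) ^ p ≤ 1 →
      ∫⁻ x, f x * ∫⁻ y in {y | g y ≤ f x}, (ENNReal.ofReal (‖x - y‖ ^ (-s)) * g y) ≤
        ENNReal.ofReal C := by
    intro f g hf hg hf1 hg1
    calc _ ≤ ∫⁻ x, ENNReal.ofReal C * (f x : ℝ≥0∞) ^ p := by
          refine lintegral_mono fun x => ?_
          rcases eq_or_ne (f x) 0 with h0 | h0
          · simp [h0]
          · have hpos : 0 < f x := pos_iff_ne_zero.2 h0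
            refine (mul_le_mul_right (h g hg hg1 (f x) hpos x) _).trans (le_of_eq ?_)
            rw [mul_left_comm]
            congr 1
            nth_rewrite 1 [← ENNReal.rpow_one (f x : ℝ≥0∞)]
            rw [← ENNReal.rpow_add _ _ (by simpa using h0) ENNReal.coe_ne_top]
            congr 1; ring
      _ = ENNReal.ofReal C * ∫⁻ x, (f x : ℝ≥0∞) ^ p :=
          lintegral_const_mul _ (hf.coe_nnreal_ennreal.pow_const _)
      _ ≤ ENNReal.ofReal C := mul_le_of_le_one_right' hf1
  refine ⟨C + C, by positivity, fun f g hf hg hf1 hg1 => ?_⟩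
  let K : EuclideanSpace ℝ (Fin N) → EuclideanSpace ℝ (Fin N) → ℝ≥0∞ :=
    fun x y => f x * (ENNReal.ofReal (‖x - y‖ ^ (-s)) * g y)
  have hKm : Measurable (Function.uncurry K) := by
    simp only [K, Function.uncurry_def]
    fun_prop
  let S : Set (EuclideanSpace ℝ (Fin N) × EuclideanSpace ℝ (Fin N)) := {z | g z.2 ≤ f z.1}
  let S' : Set (EuclideanSpace ℝ (Fin N) × EuclideanSpace ℝ (Fin N)) := {z | f z.1 ≤ g z.2}
  have hS : MeasurableSet S := measurableSet_le (by fun_prop) (by fun_prop)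
  have hS' : MeasurableSet S' := measurableSet_le (by fun_prop) (by fun_prop)
  have h1 : ∫⁻ x, ∫⁻ y, S.indicator (Function.uncurry K) (x, y) ≤ ENNReal.ofReal C := by
    refine le_trans (le_of_eq (lintegral_congr fun x => ?_)) (half f g hf hg hf1 hg1)
    rw [← lintegral_const_mul _ (by fun_prop),
      ← lintegral_indicator (show MeasurableSet {y | g y ≤ f x} from hg measurableSet_Iic)]
    rfl
  have h2 : ∫⁻ y, ∫⁻ x, S'.indicator (Function.uncurry K) (x, y) ≤ ENNReal.ofReal C := by
    refine le_trans (le_of_eq (lintegral_congr fun y => ?_)) (half g f hg hf hg1 hf1)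
    rw [← lintegral_const_mul _ (by fun_prop),
      ← lintegral_indicator (show MeasurableSet {x | f x ≤ g y} from hf measurableSet_Iic)]
    refine lintegral_congr fun x => ?_
    by_cases hx : f x ≤ g y
    · rw [indicator_of_mem (by exact hx), indicator_of_mem (by exact hx)]
      simp only [Function.uncurry, K, norm_sub_rev x y]
      ring
    · rw [indicator_of_notMem (by exact hx), indicator_of_notMem (by exact hx)]
  have hsum : ∀ x y, K x y ≤
      S.indicator (Function.uncurry K) (x, y) + S'.indicator (Function.uncurry K) (x, y) := by
    intro x y
    rcases le_total (g y) (f x) with hxy | hxy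
    · rw [indicator_of_mem (show (x, y) ∈ S from hxy)]; exact le_self_add
    · rw [indicator_of_mem (show (x, y) ∈ S' from hxy)]; exact le_add_self
  have hm1 : Measurable (S.indicator (Function.uncurry K)) := hKm.indicator hS
  have hm2 : Measurable (S'.indicator (Function.uncurry K)) := hKm.indicator hS'
  calc ∫⁻ x, ∫⁻ y, K x y ≤ ∫⁻ x, ∫⁻ y, (S.indicator (Function.uncurry K) (x, y) +
          S'.indicator (Function.uncurry K) (x, y)) :=
        lintegral_mono fun x => lintegral_mono fun y => hsum x y
    _ = ∫⁻ x, ((∫⁻ y, S.indicator (Function.uncurry K) (x, y)) +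
          ∫⁻ y, S'.indicator (Function.uncurry K) (x, y)) :=
        lintegral_congr fun x => lintegral_add_left (hm1.comp measurable_prodMk_left) _
    _ = (∫⁻ x, ∫⁻ y, S.indicator (Function.uncurry K) (x, y)) +
          ∫⁻ x, ∫⁻ y, S'.indicator (Function.uncurry K) (x, y) :=
        lintegral_add_left hm1.lintegral_prod_right' _
    _ ≤ ENNReal.ofReal (C + C) := by
        rw [ENNReal.ofReal_add hC hC]
        refine add_le_add h1 ?_
        rw [lintegral_lintegral_swap
          (f := fun x y => S'.indicator (Function.uncurry K) (x, y)) hm2.aemeasurable]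
        exact h2

/-- The Hardy–Littlewood–Sobolev inequality for two functions in the same Lebesgue space. -/
theorem exists_hls {s : ℝ} (hN : 1 ≤ N) (hs0 : 0 ≤ s) (hs : s < N) :
    ∃ C : ℝ, 0 ≤ C ∧ ∀ f g : EuclideanSpace ℝ (Fin N) → ℝ≥0, Measurable f → Measurable g →
      ∀ A B : ℝ≥0, ∫⁻ y, (f y : ℝ≥0∞) ^ (2 * N / (2 * N - s)) ≤ A ^ (2 * N / (2 * N - s)) →
      ∫⁻ y, (g y : ℝ≥0∞) ^ (2 * N / (2 * N - s)) ≤ B ^ (2 * N / (2 * N - s)) →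
        ∫⁻ x, ∫⁻ y, f x * (ENNReal.ofReal (‖x - y‖ ^ (-s)) * g y) ≤
          ENNReal.ofReal C * A * B := by
  have hN0 : (0 : ℝ) < N := by exact_mod_cast hN
  rcases hs0.eq_or_lt with rfl | hs0
  -- For `s = 0` the kernel is `1`, the exponent is `1`, and the double integral factorises.
  · refine ⟨1, zero_le_one, fun f g hf hg A B hA hB => ?_⟩
    have h1 : 2 * (N : ℝ) / (2 * N - 0) = 1 := by field_simp; simp
    simp only [h1, ENNReal.rpow_one] at hA hB
    simp only [neg_zero, Real.rpow_zero, ENNReal.ofReal_one, one_mul]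
    simp_rw [lintegral_const_mul _ hg.coe_nnreal_ennreal]
    rw [lintegral_mul_const _ hf.coe_nnreal_ennreal]
    gcongr
  obtain ⟨C, hC, h⟩ := exists_hls_normalized (N := N) hN hs0 hs
  set p : ℝ := 2 * N / (2 * N - s) with hp
  have hp0 : 0 < p := by
    have : 0 < 2 * (N : ℝ) - s := by linarith
    positivity
  refine ⟨C, hC, fun f g hf hg A B hA hB => ?_⟩
  have hzero : ∀ u : EuclideanSpace ℝ (Fin N) → ℝ≥0, Measurable u →
      ∫⁻ y, (u y : ℝ≥0∞) ^ p ≤ ((0 : ℝ≥0) : ℝ≥0∞) ^ p → ∀ᵐ y, u y = 0 := by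
    intro u hu h0
    rw [ENNReal.coe_zero, ENNReal.zero_rpow_of_pos hp0, nonpos_iff_eq_zero,
      lintegral_eq_zero_iff (hu.coe_nnreal_ennreal.pow_const _)] at h0
    filter_upwards [h0] with y hy
    simpa [hp0.ne', hp0, hp0.le, hp0.not_gt] using hy
  -- The normalisation divides by `A` and `B`; if one of them vanishes, so does the function almost
  -- everywhere.
  rcases eq_or_ne A 0 with rfl | hA0
  · refine le_of_eq_of_le (b := 0) ?_ bot_le
    rw [← lintegral_zero (μ := (volume : Measure (EuclideanSpace ℝ (Fin N))))]
    refine lintegral_congr_ae ?_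
    filter_upwards [hzero f hf hA] with x hx
    simp [hx]
  rcases eq_or_ne B 0 with rfl | hB0
  · refine le_of_eq_of_le (b := 0) ?_ bot_le
    rw [← lintegral_zero (μ := (volume : Measure (EuclideanSpace ℝ (Fin N))))]
    refine lintegral_congr fun x => ?_
    rw [← lintegral_zero (μ := (volume : Measure (EuclideanSpace ℝ (Fin N))))]
    refine lintegral_congr_ae ?_
    filter_upwards [hzero g hg hB] with y hy
    simp [hy]
  have hnorm : ∀ (u : EuclideanSpace ℝ (Fin N) → ℝ≥0) (D : ℝ≥0), D ≠ 0 → Measurable u →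
      ∫⁻ y, (u y : ℝ≥0∞) ^ p ≤ (D : ℝ≥0∞) ^ p →
      ∫⁻ y, ((D⁻¹ * u y : ℝ≥0) : ℝ≥0∞) ^ p ≤ 1 := by
    intro u D hD hu hle
    simp only [ENNReal.coe_mul, ENNReal.mul_rpow_of_nonneg _ _ hp0.le]
    rw [lintegral_const_mul _ (hu.coe_nnreal_ennreal.pow_const _)]
    refine (mul_le_mul_right hle _).trans (le_of_eq ?_)
    rw [← ENNReal.mul_rpow_of_nonneg _ _ hp0.le, ← ENNReal.coe_mul, inv_mul_cancel₀ hD]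
    simp
  have key := h _ _ (hf.const_mul A⁻¹) (hg.const_mul B⁻¹) (hnorm f A hA0 hf hA)
    (hnorm g B hB0 hg hB)
  have hrw : ∀ x y, (f x : ℝ≥0∞) * (ENNReal.ofReal (‖x - y‖ ^ (-s)) * g y) = (A * B : ℝ≥0∞) *
      (((A⁻¹ * f x : ℝ≥0) : ℝ≥0∞) *
        (ENNReal.ofReal (‖x - y‖ ^ (-s)) * ((B⁻¹ * g y : ℝ≥0) : ℝ≥0∞))) := by
    intro x y
    have e1 : (f x : ℝ≥0∞) = A * ((A⁻¹ * f x : ℝ≥0) : ℝ≥0∞) := by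
      rw [← ENNReal.coe_mul, mul_inv_cancel_left₀ hA0]
    have e2 : (g y : ℝ≥0∞) = B * ((B⁻¹ * g y : ℝ≥0) : ℝ≥0∞) := by
      rw [← ENNReal.coe_mul, mul_inv_cancel_left₀ hB0]
    generalize ((A⁻¹ * f x : ℝ≥0) : ℝ≥0∞) = u at *
    generalize ((B⁻¹ * g y : ℝ≥0) : ℝ≥0∞) = v at *
    rw [e1, e2]
    ring
  simp_rw [hrw]
  have hmm : Measurable fun z : EuclideanSpace ℝ (Fin N) × EuclideanSpace ℝ (Fin N) =>
      ((A⁻¹ * f z.1 : ℝ≥0) : ℝ≥0∞) *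
        (ENNReal.ofReal (‖z.1 - z.2‖ ^ (-s)) * ((B⁻¹ * g z.2 : ℝ≥0) : ℝ≥0∞)) := by fun_prop
  have hi : ∀ x, ∫⁻ y, (A * B : ℝ≥0∞) * (((A⁻¹ * f x : ℝ≥0) : ℝ≥0∞) *
        (ENNReal.ofReal (‖x - y‖ ^ (-s)) * ((B⁻¹ * g y : ℝ≥0) : ℝ≥0∞))) =
      (A * B : ℝ≥0∞) * ∫⁻ y, (((A⁻¹ * f x : ℝ≥0) : ℝ≥0∞) *
        (ENNReal.ofReal (‖x - y‖ ^ (-s)) * ((B⁻¹ * g y : ℝ≥0) : ℝ≥0∞))) := fun x =>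
    lintegral_const_mul _ (hmm.comp measurable_prodMk_left)
  simp_rw [hi]
  rw [lintegral_const_mul _ hmm.lintegral_prod_right', mul_assoc (ENNReal.ofReal C),
    mul_comm (ENNReal.ofReal C)]
  exact mul_le_mul_right key _

end HLS

variable {N : ℕ}

/-! ### A Bessel type integral -/

/-- The phase of the Bessel type integral. -/
def phase (y : ℝ) : ℝ := (y ^ 2 + (y⁻¹) ^ 2) / 2

lemma phase_nonneg (y : ℝ) : 0 ≤ phase y := by unfold phase; positivity

lemma measurable_phase : Measurable phase := by unfold phase; fun_prop

/-- `∫₀^∞ y ^ c * exp (-w * phase y) dy`, twice a modified Bessel function of the second kind of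
order `(c + 1) / 2`. -/
def besselIntegral (c w : ℂ) : ℂ :=
  ∫ y in Ioi (0 : ℝ), (y : ℂ) ^ c * Complex.exp (-w * phase y)

lemma norm_bessel_integrand {c w : ℂ} {y : ℝ} (hy : 0 < y) :
    ‖(y : ℂ) ^ c * Complex.exp (-w * phase y)‖ = y ^ c.re * Real.exp (-w.re * phase y) := by
  rw [norm_mul, Complex.norm_cpow_eq_rpow_re_of_pos hy, Complex.norm_exp]
  simp

lemma measurable_bessel_integrand (c w : ℂ) :
    Measurable fun y : ℝ => (y : ℂ) ^ c * Complex.exp (-w * phase y) := by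
  have := measurable_phase
  fun_prop

/-- For `y ≥ 1` the part `y²` of the phase gives Gaussian decay. For `y < 1` the part `y⁻²` beats
any negative power of `y`, through `x^k / k! ≤ exp x`. -/
lemma integrableOn_rpow_mul_exp_phase (s : ℝ) {δ : ℝ} (hδ : 0 < δ) :
    IntegrableOn (fun y : ℝ => y ^ s * Real.exp (-δ * phase y)) (Ioi 0) := by
  obtain ⟨k, hk⟩ := exists_nat_ge |s|
  set K : ℝ := k.factorial * (2 / δ) ^ k with hK
  have h1 : IntegrableOn (fun y : ℝ => y ^ |s| * Real.exp (-(δ / 2) * y ^ 2)) (Ioi 0) :=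
    integrableOn_rpow_mul_exp_neg_mul_sq (by positivity) (by linarith [abs_nonneg s])
  have h2 : IntegrableOn (fun y : ℝ => (Ioo (0 : ℝ) 1).indicator (fun _ => K) y) (Ioi 0) :=
    (IntegrableOn.integrable_indicator (by simp) measurableSet_Ioo).integrableOn
  refine (h1.add h2).mono' (by have := measurable_phase; fun_prop) ?_
  rw [ae_restrict_iff' measurableSet_Ioi]
  refine .of_forall fun y (hy : 0 < y) => ?_
  rw [Real.norm_of_nonneg (by positivity)]
  simp only [Pi.add_apply]
  by_cases hy1 : y < 1
  · rw [indicator_of_mem (by exact ⟨hy, hy1⟩)]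
    suffices h : y ^ s * Real.exp (-δ * phase y) ≤ K from
      h.trans (le_add_of_nonneg_left (by positivity))
    have hx : 0 ≤ δ / 2 * (y⁻¹) ^ 2 := by positivity
    have h3 : y ^ s ≤ ((y⁻¹) ^ 2) ^ k := by
      have hy2 : 1 ≤ y⁻¹ := (one_le_inv₀ hy).2 hy1.le
      calc y ^ s = (y⁻¹) ^ (-s) := by rw [Real.inv_rpow hy.le, Real.rpow_neg hy.le, inv_inv]
        _ ≤ (y⁻¹) ^ (k : ℝ) := Real.rpow_le_rpow_of_exponent_le hy2 ((neg_le_abs s).trans hk)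
        _ = (y⁻¹) ^ k := Real.rpow_natCast _ _
        _ ≤ ((y⁻¹) ^ 2) ^ k := by
          gcongr
          exact le_self_pow₀ hy2 two_ne_zero
    have h4 : Real.exp (-δ * phase y) ≤ Real.exp (-(δ / 2 * (y⁻¹) ^ 2)) := by
      refine Real.exp_le_exp.2 ?_
      unfold phase
      nlinarith [sq_nonneg y]
    have h5 := Real.pow_div_factorial_le_exp _ hx k
    have h6 : ((y⁻¹) ^ 2) ^ k ≤ K * Real.exp (δ / 2 * (y⁻¹) ^ 2) := by
      rw [div_le_iff₀ (by positivity), mul_pow] at h5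
      have : ((y⁻¹) ^ 2) ^ k = (2 / δ) ^ k * ((δ / 2) ^ k * ((y⁻¹) ^ 2) ^ k) := by
        rw [← mul_assoc, ← mul_pow]; field_simp; simp
      rw [this, hK]
      calc _ ≤ (2 / δ) ^ k * (Real.exp (δ / 2 * (y⁻¹) ^ 2) * k.factorial) := by gcongr
        _ = _ := by ring
    calc y ^ s * Real.exp (-δ * phase y)
        ≤ K * Real.exp (δ / 2 * (y⁻¹) ^ 2) * Real.exp (-(δ / 2 * (y⁻¹) ^ 2)) := by
          gcongr; exact h3.trans h6
      _ = K := by rw [mul_assoc, ← Real.exp_add]; simp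
  · rw [indicator_of_notMem (fun h => hy1 h.2), add_zero]
    refine mul_le_mul (Real.rpow_le_rpow_of_exponent_le (not_lt.1 hy1) (le_abs_self s))
      (Real.exp_le_exp.2 ?_) (Real.exp_pos _).le (by positivity)
    unfold phase
    nlinarith [sq_nonneg (y⁻¹)]

lemma integrableOn_bessel_integrand (c : ℂ) {w : ℂ} (hw : 0 < w.re) :
    IntegrableOn (fun y : ℝ => (y : ℂ) ^ c * Complex.exp (-w * phase y)) (Ioi 0) := by
  refine (integrableOn_rpow_mul_exp_phase c.re hw).mono'
    (measurable_bessel_integrand c w).aestronglyMeasurable ?_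
  rw [ae_restrict_iff' measurableSet_Ioi]
  exact .of_forall fun y hy => (norm_bessel_integrand hy).le

lemma differentiableAt_besselIntegral (c : ℂ) {w : ℂ} (hw : 0 < w.re) :
    DifferentiableAt ℂ (besselIntegral c) w := by
  have hre : ∀ ζ ∈ ball w (w.re / 2), w.re / 2 ≤ ζ.re := fun ζ hζ => by
    rw [mem_ball, dist_eq_norm] at hζ
    have := (Complex.abs_re_le_norm (ζ - w)).trans hζ.le
    rw [Complex.sub_re] at this
    linarith [(abs_le.1 this).1]
  refine differentiableAt_integral_of_dominated (half_pos hw)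
    (integrableOn_rpow_mul_exp_phase c.re (half_pos hw))
    (fun ζ _ => (measurable_bessel_integrand c ζ).aestronglyMeasurable) (.of_forall fun y => ?_) ?_
  · exact Differentiable.differentiableOn (by fun_prop)
  · rw [ae_restrict_iff' measurableSet_Ioi]
    refine .of_forall fun y hy ζ hζ => ?_
    rw [mem_Ioi] at hy
    rw [norm_bessel_integrand hy]
    have := phase_nonneg y
    have := hre ζ hζ
    gcongr

lemma integral_Ioi_inv_sub_one_sq {ρ : ℝ} (hρ : 0 < ρ) :
    IntegrableOn (fun y : ℝ => ((y - 1) ^ 2)⁻¹) (Ioi (1 + ρ)) ∧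
      ∫ y in Ioi (1 + ρ), ((y - 1) ^ 2)⁻¹ = ρ⁻¹ := by
  have hd : ∀ y ∈ Ici (1 + ρ), HasDerivAt (fun y : ℝ => -(y - 1)⁻¹) (((y - 1) ^ 2)⁻¹) y := by
    intro y hy
    have hy0 : y - 1 ≠ 0 := by have := mem_Ici.1 hy; intro h; linarith
    refine (((hasDerivAt_id y).sub_const 1).inv hy0).neg.congr_deriv ?_
    simp [neg_div]
  have hpos : ∀ y ∈ Ioi (1 + ρ), 0 ≤ ((y - 1) ^ 2)⁻¹ := fun y _ => by positivity
  have hlim : Tendsto (fun y : ℝ => -(y - 1)⁻¹) atTop (𝓝 0) := by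
    have : Tendsto (fun y : ℝ => y - 1) atTop atTop := tendsto_atTop_add_const_right _ _ tendsto_id
    simpa using this.inv_tendsto_atTop.neg
  refine ⟨integrableOn_Ioi_deriv_of_nonneg' hd hpos hlim, ?_⟩
  rw [integral_Ioi_of_hasDerivAt_of_nonneg' hd hpos hlim]
  simp

/-- Integration by parts away from the critical point `y = 1` of the phase. Here `d` is the
derivative of the phase, and `G = y^c / d * exp (-w * phase)` satisfies `G' = h - w f`. Since `d y ≥
y - 1`, the remainder `h` is `O((y - 1)⁻²)` and the boundary term is at most `ρ⁻¹`. Of the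
exponential only modulus at most `1` is used, which makes the bound uniform up to the imaginary
axis. -/
lemma norm_setIntegral_Ioi_bessel_le {c w : ℂ} (hc : c.re ≤ 0) (hw : 0 < w.re)
    {ρ : ℝ} (hρ : 0 < ρ) :
    ‖w‖ * ‖∫ y in Ioi (1 + ρ), (y : ℂ) ^ c * Complex.exp (-w * phase y)‖ ≤ (5 + ‖c‖) * ρ⁻¹ := by
  set f : ℝ → ℂ := fun y => (y : ℂ) ^ c * Complex.exp (-w * phase y) with hf
  set d : ℝ → ℝ := fun y => y - (y⁻¹) ^ 3 with hd
  set h : ℝ → ℂ := fun y =>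
    (c * (y : ℂ) ^ (c - 1) * d y - (y : ℂ) ^ c * ((1 + 3 * (y⁻¹) ^ 4 : ℝ) : ℂ)) / (d y : ℂ) ^ 2 *
      Complex.exp (-w * phase y) with hh
  set G : ℝ → ℂ := fun y => (y : ℂ) ^ c / (d y : ℂ) * Complex.exp (-w * phase y) with hG
  have hy1 : ∀ y ∈ Ici (1 + ρ), 1 < y := fun y hy => by have := mem_Ici.1 hy; linarith
  have hdle : ∀ y : ℝ, 1 < y → y - 1 ≤ d y := fun y hy => by
    have : (y⁻¹) ^ 3 ≤ 1 := pow_le_one₀ (by positivity) (inv_le_one_of_one_le₀ hy.le)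
    simp only [hd]; linarith
  have hdpos : ∀ y : ℝ, 1 < y → 0 < d y := fun y hy => lt_of_lt_of_le (by linarith) (hdle y hy)
  have hE : ∀ y, ‖Complex.exp (-w * phase y)‖ ≤ 1 := fun y => by
    rw [Complex.norm_exp, Real.exp_le_one_iff]
    have := phase_nonneg y
    simp only [neg_mul, Complex.neg_re, Complex.re_mul_ofReal, Left.neg_nonpos_iff]
    positivity
  have hyc : ∀ y : ℝ, 1 < y → ‖(y : ℂ) ^ c‖ ≤ 1 := fun y hy => by
    rw [Complex.norm_cpow_eq_rpow_re_of_pos (by linarith)]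
    exact Real.rpow_le_one_of_one_le_of_nonpos hy.le hc
  have hyc1 : ∀ y : ℝ, 1 < y → ‖(y : ℂ) ^ (c - 1)‖ ≤ y⁻¹ := fun y hy => by
    rw [Complex.norm_cpow_eq_rpow_re_of_pos (by linarith), ← Real.rpow_neg_one]
    exact Real.rpow_le_rpow_of_exponent_le hy.le (by simp; linarith)
  have hder : ∀ y ∈ Ici (1 + ρ), HasDerivAt G (h y - w * f y) y := by
    intro y hy
    have hy := hy1 y hy
    have hy0 : y ≠ 0 := by linarith
    have hd0 : d y ≠ 0 := (hdpos y hy).ne'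
    have e1 : HasDerivAt (fun y : ℝ => (y : ℂ) ^ c) (c * (y : ℂ) ^ (c - 1)) y := by
      have := (hasDerivAt_id (y : ℂ)).cpow_const (c := c) (Or.inl (by simp; linarith))
      simpa using this.comp_ofReal
    have e2 : HasDerivAt d (1 + 3 * (y⁻¹) ^ 4) y := by
      have := (hasDerivAt_id y).sub ((hasDerivAt_inv hy0).pow 3)
      refine this.congr_deriv ?_
      simp only [Nat.cast_ofNat, Nat.add_one_sub_one, inv_pow]
      field_simp
      ring
    have e3 : HasDerivAt phase (d y) y := by
      have := (((hasDerivAt_id y).pow 2).add ((hasDerivAt_inv hy0).pow 2)).div_const 2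
      refine this.congr_deriv ?_
      simp only [hd, id, Nat.cast_ofNat, Nat.add_one_sub_one, inv_pow, pow_one]
      field_simp
      ring
    have e4 : HasDerivAt (fun y => Complex.exp (-w * phase y))
        (Complex.exp (-w * phase y) * (-w * (d y : ℂ))) y := (e3.ofReal_comp.const_mul (-w)).cexp
    refine ((e1.div e2.ofReal_comp (by exact_mod_cast hd0)).mul e4).congr_deriv ?_
    have hd0' : (d y : ℂ) ≠ 0 := by exact_mod_cast hd0
    simp only [hh, hf, Pi.div_apply]
    field_simp
    ring
  -- The `4` bounds the derivative `1 + 3 y⁻⁴` of `d`; the `‖c‖` comes from differentiating `y^c`.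
  have hhle : ∀ y ∈ Ioi (1 + ρ), ‖h y‖ ≤ (4 + ‖c‖) * ((y - 1) ^ 2)⁻¹ := by
    intro y hy
    have hy := hy1 y (mem_Ioi.1 hy).le
    have hdy := hdpos y hy
    have hdy' := hdle y hy
    have hi : y⁻¹ ≤ 1 := inv_le_one_of_one_le₀ hy.le
    have hi0 : 0 < y⁻¹ := by positivity
    have hdy2 : d y ≤ y := by simp only [hd]; linarith [pow_pos hi0 3]
    have hnum : ‖c * (y : ℂ) ^ (c - 1) * d y - (y : ℂ) ^ c * ((1 + 3 * (y⁻¹) ^ 4 : ℝ) : ℂ)‖ ≤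
        4 + ‖c‖ := by
      refine (norm_sub_le _ _).trans ?_
      rw [norm_mul, norm_mul, norm_mul, Complex.norm_real, Complex.norm_real,
        Real.norm_of_nonneg hdy.le, Real.norm_of_nonneg (by positivity)]
      have a1 : ‖c‖ * ‖(y : ℂ) ^ (c - 1)‖ * d y ≤ ‖c‖ := by
        calc ‖c‖ * ‖(y : ℂ) ^ (c - 1)‖ * d y ≤ ‖c‖ * y⁻¹ * y := by
              gcongr
              exact hyc1 y hy
          _ = ‖c‖ := by field_simp
      have a2 : ‖(y : ℂ) ^ c‖ * (1 + 3 * (y⁻¹) ^ 4) ≤ 1 * (1 + 3 * 1) := by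
        gcongr
        · exact hyc y hy
        · exact pow_le_one₀ hi0.le hi
      linarith
    simp only [hh]
    rw [norm_mul, norm_div, norm_pow, Complex.norm_real, Real.norm_of_nonneg hdy.le]
    calc _ ≤ (4 + ‖c‖) / (y - 1) ^ 2 * 1 := by
          have : 0 < y - 1 := by linarith
          gcongr
          exact hE y
      _ = _ := by rw [mul_one, div_eq_mul_inv]
  have hI := integral_Ioi_inv_sub_one_sq hρ
  have hhm : AEStronglyMeasurable h (volume.restrict (Ioi (1 + ρ))) := by
    have := measurable_phase
    have : Measurable h := by simp only [hh, hd]; fun_prop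
    exact this.aestronglyMeasurable
  have hhint : IntegrableOn h (Ioi (1 + ρ)) :=
    (hI.1.const_mul (4 + ‖c‖)).mono' hhm
      ((ae_restrict_iff' measurableSet_Ioi).2 (.of_forall hhle))
  have hfint : IntegrableOn f (Ioi (1 + ρ)) :=
    (integrableOn_bessel_integrand c hw).mono_set (Ioi_subset_Ioi (by linarith))
  have hGle : ∀ y ∈ Ici (1 + ρ), ‖G y‖ ≤ (y - 1)⁻¹ := by
    intro y hy
    have hy := hy1 y hy
    simp only [hG]
    rw [norm_mul, norm_div, Complex.norm_real, Real.norm_of_nonneg (hdpos y hy).le]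
    calc _ ≤ 1 / (y - 1) * 1 := by
          have : 0 < y - 1 := by linarith
          gcongr
          · exact hyc y hy
          · exact hdle y hy
          · exact hE y
      _ = _ := by rw [mul_one, one_div]
  have hlim : Tendsto G atTop (𝓝 0) := by
    have h1 : Tendsto (fun y : ℝ => (y - 1)⁻¹) atTop (𝓝 0) :=
      (tendsto_atTop_add_const_right _ _ tendsto_id : Tendsto (fun y : ℝ => y - 1) atTop
        atTop).inv_tendsto_atTop
    refine squeeze_zero_norm' ?_ h1
    filter_upwards [eventually_ge_atTop (1 + ρ)] with y hy using hGle y hy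
  have hkey := integral_Ioi_of_hasDerivAt_of_tendsto' hder (hhint.sub (hfint.const_mul w)) hlim
  rw [integral_sub hhint (hfint.const_mul w), integral_const_mul] at hkey
  have hw' : w * ∫ y in Ioi (1 + ρ), f y = (∫ y in Ioi (1 + ρ), h y) + G (1 + ρ) := by
    linear_combination -hkey
  rw [← norm_mul, hw']
  refine (norm_add_le _ _).trans ?_
  have b1 : ‖∫ y in Ioi (1 + ρ), h y‖ ≤ (4 + ‖c‖) * ρ⁻¹ := by
    rw [← hI.2, ← integral_const_mul]
    exact norm_integral_le_of_norm_le (hI.1.const_mul _)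
      ((ae_restrict_iff' measurableSet_Ioi).2 (.of_forall hhle))
  have b2 : ‖G (1 + ρ)‖ ≤ ρ⁻¹ := by simpa using hGle (1 + ρ) self_mem_Ici
  linarith

/-- Near the critical point the trivial bound gives the length `ρ`; beyond `1 + ρ` integration by
parts gives `O(1 / (‖w‖ ρ))`. The choice `ρ = ‖w‖^(-1/2)` balances them. -/
lemma norm_setIntegral_Ioi_one_bessel_le {c w : ℂ} (hc : c.re ≤ 0) (hw : 0 < w.re) :
    ‖∫ y in Ioi (1 : ℝ), (y : ℂ) ^ c * Complex.exp (-w * phase y)‖ ≤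
      (6 + ‖c‖) * ‖w‖ ^ (-(1 / 2) : ℝ) := by
  have hw0 : 0 < ‖w‖ := norm_pos_iff.2 fun h => by simp [h] at hw
  set ρ : ℝ := ‖w‖ ^ (-(1 / 2) : ℝ) with hρ
  have hρ0 : 0 < ρ := by positivity
  have hintegrable := integrableOn_bessel_integrand c hw
  have hsplit : Ioi (1 : ℝ) = Ioc 1 (1 + ρ) ∪ Ioi (1 + ρ) :=
    (Ioc_union_Ioi_eq_Ioi (by linarith)).symm
  rw [hsplit, setIntegral_union (Ioc_disjoint_Ioi le_rfl) measurableSet_Ioi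
    (hintegrable.mono_set fun y hy => lt_trans one_pos hy.1)
    (hintegrable.mono_set (Ioi_subset_Ioi (by linarith)))]
  refine (norm_add_le _ _).trans ?_
  have h1 : ‖∫ y in Ioc (1 : ℝ) (1 + ρ), (y : ℂ) ^ c * Complex.exp (-w * phase y)‖ ≤ 1 * ρ := by
    refine (norm_setIntegral_le_of_norm_le_const (C := 1) (by simp) fun y hy => ?_).trans
      (le_of_eq ?_)
    · have hy1 : 1 < y := hy.1
      rw [norm_bessel_integrand (by linarith)]
      have := phase_nonneg y
      refine mul_le_one₀ (Real.rpow_le_one_of_one_le_of_nonpos hy1.le hc) (by positivity) ?_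
      rw [Real.exp_le_one_iff]
      nlinarith
    · simp [hρ0.le]
  have h2 := norm_setIntegral_Ioi_bessel_le hc hw hρ0
  have h3 : ρ⁻¹ = ‖w‖ * ρ := by
    rw [hρ, ← Real.rpow_neg hw0.le]
    nth_rewrite 2 [← Real.rpow_one ‖w‖]
    rw [← Real.rpow_add hw0]
    norm_num
  rw [h3, mul_left_comm] at h2
  have h4 := le_of_mul_le_mul_left h2 hw0
  linarith

/-- The inversion `y ↦ y⁻¹` preserves the phase, and its Jacobian `y⁻²` turns the exponent `c` into
`-2 - c`. -/
lemma setIntegral_Ioo_bessel_eq (c w : ℂ) :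
    ∫ y in Ioo (0 : ℝ) 1, (y : ℂ) ^ c * Complex.exp (-w * phase y) =
      ∫ y in Ioi (1 : ℝ), (y : ℂ) ^ (-2 - c) * Complex.exp (-w * phase y) := by
  have h := integral_comp_rpow_Ioi
    ((Ioo (0 : ℝ) 1).indicator fun y : ℝ => (y : ℂ) ^ c * Complex.exp (-w * phase y))
    (p := -1) (by norm_num)
  rw [setIntegral_indicator measurableSet_Ioo,
    inter_eq_self_of_subset_right (fun y hy => hy.1)] at h
  rw [← h, ← integral_indicator measurableSet_Ioi, ← integral_indicator measurableSet_Ioi]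
  congr 1
  ext y
  by_cases hy : 1 < y
  · have hy0 : 0 < y := by linarith
    have hy' : y⁻¹ ∈ Ioo (0 : ℝ) 1 := ⟨by positivity, inv_lt_one_of_one_lt₀ hy⟩
    rw [indicator_of_mem (show y ∈ Ioi 0 from hy0), indicator_of_mem (show y ∈ Ioi 1 from hy),
      Real.rpow_neg_one, indicator_of_mem hy']
    have hph : phase y⁻¹ = phase y := by unfold phase; rw [inv_inv]; ring
    have hyC : (y : ℂ) ≠ 0 := by exact_mod_cast hy0.ne'
    rw [hph, Complex.real_smul, ← mul_assoc]
    congr 1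
    have e1 : ((y⁻¹ : ℝ) : ℂ) ^ c = (y : ℂ) ^ (-c) := by
      rw [Complex.ofReal_inv, Complex.inv_cpow _ _ (by
        rw [Complex.arg_ofReal_of_nonneg hy0.le]; exact Real.pi_pos.ne), Complex.cpow_neg]
    have e2 : ((|(-1 : ℝ)| * y ^ (-1 - 1 : ℝ) : ℝ) : ℂ) = (y : ℂ) ^ (-2 : ℂ) := by
      rw [abs_neg, abs_one, one_mul, Complex.ofReal_cpow hy0.le]
      norm_num
    rw [e1, e2, ← Complex.cpow_add _ _ hyC]
    congr 1
  · rw [indicator_of_notMem (show y ∉ Ioi 1 from hy)]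
    by_cases hy0 : 0 < y
    · rw [indicator_of_mem (show y ∈ Ioi 0 from hy0), Real.rpow_neg_one,
        indicator_of_notMem, smul_zero]
      rintro ⟨-, h2⟩
      exact hy ((inv_lt_one₀ hy0).1 h2)
    · rw [indicator_of_notMem (show y ∉ Ioi 0 from hy0)]

/-- Decay of the Bessel type integral, uniformly up to the imaginary axis. -/
theorem norm_besselIntegral_le {c w : ℂ} (hc : c.re ≤ 0) (hc' : -2 ≤ c.re) (hw : 0 < w.re) :
    ‖besselIntegral c w‖ ≤ (14 + 2 * ‖c‖) * ‖w‖ ^ (-(1 / 2) : ℝ) := by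
  have hintegrable := integrableOn_bessel_integrand c hw
  have hsplit : Ioi (0 : ℝ) = Ioc 0 1 ∪ Ioi 1 := (Ioc_union_Ioi_eq_Ioi zero_le_one).symm
  rw [besselIntegral, hsplit, setIntegral_union (Ioc_disjoint_Ioi le_rfl) measurableSet_Ioi
    (hintegrable.mono_set fun y hy => hy.1) (hintegrable.mono_set (Ioi_subset_Ioi zero_le_one)),
    integral_Ioc_eq_integral_Ioo, setIntegral_Ioo_bessel_eq]
  refine (norm_add_le _ _).trans ?_
  have h1 := norm_setIntegral_Ioi_one_bessel_le hc hw
  -- The condition `-2 ≤ Re c` says that the reflected exponent also has nonpositive real part.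
  have h2 := norm_setIntegral_Ioi_one_bessel_le (c := -2 - c) (by simp; linarith) hw
  have h3 : ‖-2 - c‖ ≤ 2 + ‖c‖ := by
    refine (norm_sub_le _ _).trans ?_
    simp
  have h4 : 0 ≤ ‖w‖ ^ (-(1 / 2) : ℝ) := by positivity
  nlinarith

/-! ### The Fourier transform on `L¹ ∩ L²` -/

lemma continuous_fourier_of_integrable {f : EuclideanSpace ℝ (Fin N) → ℂ} (hf : Integrable f) :
    Continuous (𝓕 f) :=
  VectorFourier.fourierIntegral_continuous Real.continuous_fourierChar
    (by exact continuous_inner) hf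

/-- The `L²` Fourier transform is given by the Fourier integral on `L¹ ∩ L²`. -/
theorem coeFn_fourier_toLp {f : EuclideanSpace ℝ (Fin N) → ℂ} (hf : Integrable f)
    (hf2 : MemLp f 2) : (𝓕 (hf2.toLp f) : L2 N) =ᵐ[volume] 𝓕 f := by
  refine ae_eq_of_integral_contDiff_smul_eq
    ((Lp.memLp (𝓕 (hf2.toLp f) : L2 N)).locallyIntegrable (by norm_num))
    (continuous_fourier_of_integrable hf).locallyIntegrable ?_
  intro φ hφ hφc
  have hc : HasCompactSupport (fun x => (φ x : ℂ)) := hφc.comp_left Complex.ofReal_zero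
  have hs : ContDiff ℝ (⊤ : ℕ∞) (fun x => (φ x : ℂ)) := Complex.ofRealCLM.contDiff.comp hφ
  let ψ : 𝓢(EuclideanSpace ℝ (Fin N), ℂ) := hc.toSchwartzMap hs
  have h1 := congrArg (fun L : 𝓢'(EuclideanSpace ℝ (Fin N), ℂ) => L ψ)
    (Lp.fourier_toTemperedDistribution_eq (hf2.toLp f))
  simp only [TemperedDistribution.fourier_apply, Lp.toTemperedDistribution_apply] at h1
  have h2 : ∫ x, (𝓕 ψ) x • (hf2.toLp f) x = ∫ x, (𝓕 ψ) x • f x :=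
    integral_congr_ae (by filter_upwards [hf2.coeFn_toLp] with x hx; rw [hx])
  -- The multiplication formula moves the Fourier integral from the test function to `f`; the
  -- distributional and the pointwise transform then have equal pairings with every test function.
  have h3 : ∫ x, (𝓕 ψ) x • f x = ∫ x, ψ x • 𝓕 f x := by
    have := VectorFourier.integral_fourierIntegral_smul_eq_flip
      (L := innerₗ (EuclideanSpace ℝ (Fin N))) (μ := volume) (ν := volume)
      Real.continuous_fourierChar continuous_inner ψ.integrable hf
    rw [flip_innerₗ] at this
    exact this
  rw [h2, h3] at h1
  simpa [ψ] using h1.symm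

/-! ### The heat kernel -/

/-- The heat kernel at time `t` and distance `r`. -/
def heatKernel (N : ℕ) (t r : ℝ) : ℝ :=
  (4 * Real.pi * t) ^ (-((N : ℝ) / 2)) * Real.exp (-(r ^ 2 / (4 * t)))

lemma heatKernel_nonneg {t : ℝ} (ht : 0 < t) (r : ℝ) : 0 ≤ heatKernel N t r := by
  unfold heatKernel; positivity

lemma integral_gaussian_character {t : ℝ} (ht : 0 < t) (v : EuclideanSpace ℝ (Fin N)) :
    ∫ ξ : EuclideanSpace ℝ (Fin N),
      Complex.exp (((2 * Real.pi * inner ℝ ξ v : ℝ) : ℂ) * Complex.I) *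
        (Real.exp (-((2 * Real.pi) ^ 2 * ‖ξ‖ ^ 2 * t)) : ℂ) = (heatKernel N t ‖v‖ : ℂ) := by
  have hb : 0 < (((2 * Real.pi) ^ 2 * t : ℝ) : ℂ).re := by
    rw [Complex.ofReal_re]; positivity
  -- The point `-v` turns the character of the Fourier integral into one with a plus sign.
  have h := fourier_gaussian_innerProductSpace hb (-v)
  rw [Real.fourier_eq'] at h
  have hb' : Real.pi / ((2 * Real.pi) ^ 2 * t) = (4 * Real.pi * t)⁻¹ := by
    field_simp; norm_num
  have hrhs : ((Real.pi : ℂ) / (((2 * Real.pi) ^ 2 * t : ℝ) : ℂ)) ^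
      ((Module.finrank ℝ (EuclideanSpace ℝ (Fin N)) : ℂ) / 2) *
      Complex.exp (-(Real.pi : ℂ) ^ 2 * (‖-v‖ : ℂ) ^ 2 / (((2 * Real.pi) ^ 2 * t : ℝ) : ℂ)) =
      (heatKernel N t ‖v‖ : ℂ) := by
    rw [heatKernel, ← Complex.ofReal_div, hb', norm_neg, finrank_euclideanSpace_fin,
      Complex.ofReal_mul (_ ^ (-((N : ℝ) / 2))), Complex.ofReal_exp]
    congr 1
    · rw [Real.rpow_neg (by positivity), ← Real.inv_rpow (by positivity),
        Complex.ofReal_cpow (by positivity)]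
      push_cast; rfl
    · congr 1
      push_cast
      have : (Real.pi : ℂ) ≠ 0 := by exact_mod_cast Real.pi_pos.ne'
      have ht' : (t : ℂ) ≠ 0 := by exact_mod_cast ht.ne'
      field_simp
      norm_num
  rw [← hrhs, ← h]
  congr 1
  ext ξ
  rw [smul_eq_mul]
  congr 1
  · congr 2
    rw [inner_neg_right]; push_cast; ring
  · rw [Complex.ofReal_exp]; congr 1; push_cast; ring

/-- Expand both Fourier integrals. The Gaussian makes the triple integral absolutely convergent, and
integrating in `ξ` first produces the heat kernel at `p.1 - p.2`. -/
lemma integral_conj_fourier_mul_gaussian {g h : EuclideanSpace ℝ (Fin N) → ℂ}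
    (hg : Integrable g) (hh : Integrable h) {t : ℝ} (ht : 0 < t) :
    ∫ ξ, conj (𝓕 g ξ) * 𝓕 h ξ * (Real.exp (-((2 * Real.pi) ^ 2 * ‖ξ‖ ^ 2 * t)) : ℂ) =
      ∫ p : EuclideanSpace ℝ (Fin N) × EuclideanSpace ℝ (Fin N),
        conj (g p.1) * h p.2 * (heatKernel N t ‖p.1 - p.2‖ : ℂ) := by
  let Φ : EuclideanSpace ℝ (Fin N) → EuclideanSpace ℝ (Fin N) × EuclideanSpace ℝ (Fin N) → ℂ :=
    fun ξ p => (Complex.exp (((2 * Real.pi * inner ℝ ξ (p.1 - p.2) : ℝ) : ℂ) * Complex.I) *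
      (Real.exp (-((2 * Real.pi) ^ 2 * ‖ξ‖ ^ 2 * t)) : ℂ)) * (conj (g p.1) * h p.2)
  have hgc : Integrable fun x => conj (g x) :=
    (Complex.conjCLE : ℂ →L[ℝ] ℂ).integrable_comp hg
  have hgh : Integrable fun p : EuclideanSpace ℝ (Fin N) × EuclideanSpace ℝ (Fin N) =>
      conj (g p.1) * h p.2 := hgc.mul_prod hh
  have hG : Integrable fun ξ : EuclideanSpace ℝ (Fin N) =>
      (Real.exp (-((2 * Real.pi) ^ 2 * ‖ξ‖ ^ 2 * t)) : ℂ) := by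
    have hb : 0 < (((2 * Real.pi) ^ 2 * t : ℝ) : ℂ).re := by rw [Complex.ofReal_re]; positivity
    have := GaussianFourier.integrable_cexp_neg_mul_sq_norm_add hb 0 (0 : EuclideanSpace ℝ (Fin N))
    refine this.congr (.of_forall fun ξ => ?_)
    simp only [zero_mul, add_zero]
    rw [Complex.ofReal_exp]; congr 1; push_cast; ring
  have hΦ : Integrable (Function.uncurry Φ) (volume.prod volume) := by
    refine (hG.mul_prod hgh).mono ?_ (.of_forall fun z => ?_)
    · refine AEStronglyMeasurable.mul ?_ hgh.aestronglyMeasurable.comp_snd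
      exact Continuous.aestronglyMeasurable (by fun_prop)
    · simp only [Function.uncurry, Φ, norm_mul, Complex.norm_exp_ofReal_mul_I, one_mul]
      exact le_rfl
  have hswap := integral_integral_swap hΦ
  calc _ = ∫ ξ, ∫ p, Φ ξ p := by
        refine integral_congr_ae (.of_forall fun ξ => ?_)
        simp only [Φ]
        have : ∀ p : EuclideanSpace ℝ (Fin N) × EuclideanSpace ℝ (Fin N),
            (Complex.exp (((2 * Real.pi * inner ℝ ξ (p.1 - p.2) : ℝ) : ℂ) * Complex.I) *
              (Real.exp (-((2 * Real.pi) ^ 2 * ‖ξ‖ ^ 2 * t)) : ℂ)) * (conj (g p.1) * h p.2) =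
            (Real.exp (-((2 * Real.pi) ^ 2 * ‖ξ‖ ^ 2 * t)) : ℂ) *
            (conj (Complex.exp (((-2 * Real.pi * inner ℝ p.1 ξ : ℝ) : ℂ) * Complex.I) * g p.1) *
              (Complex.exp (((-2 * Real.pi * inner ℝ p.2 ξ : ℝ) : ℂ) * Complex.I) * h p.2)) := by
          intro p
          have e : Complex.exp (((2 * Real.pi * inner ℝ ξ (p.1 - p.2) : ℝ) : ℂ) * Complex.I) =
              conj (Complex.exp (((-2 * Real.pi * inner ℝ p.1 ξ : ℝ) : ℂ) * Complex.I)) *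
                Complex.exp (((-2 * Real.pi * inner ℝ p.2 ξ : ℝ) : ℂ) * Complex.I) := by
            rw [← Complex.exp_conj, ← Complex.exp_add, map_mul, Complex.conj_ofReal,
              Complex.conj_I, inner_sub_right, real_inner_comm p.1 ξ, real_inner_comm p.2 ξ]
            congr 1
            push_cast
            ring
          rw [e, map_mul]
          ring
        simp_rw [this]
        rw [integral_const_mul, Measure.volume_eq_prod, integral_prod_mul
          (fun x => conj (Complex.exp (((-2 * Real.pi * inner ℝ x ξ : ℝ) : ℂ) * Complex.I) * g x))
          (fun y => Complex.exp (((-2 * Real.pi * inner ℝ y ξ : ℝ) : ℂ) * Complex.I) * h y),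
          integral_conj, Real.fourier_eq', Real.fourier_eq']
        simp only [smul_eq_mul]
        ring
    _ = ∫ p, ∫ ξ, Φ ξ p := hswap
    _ = _ := by
        refine integral_congr_ae (.of_forall fun p => ?_)
        simp only [Φ]
        rw [integral_mul_const, integral_gaussian_character ht]
        ring

/-! ### Kernels of complex powers of the resolvent -/

/-- The kernel of `Γ(ζ) * (-Δ + w²) ^ (-ζ)` at distance `r`. -/
def resolventKernel (N : ℕ) (ζ w : ℂ) (r : ℝ) : ℂ :=
  2 * (((4 * Real.pi) ^ (-((N : ℝ) / 2)) : ℝ) : ℂ) * ((r : ℂ) / (2 * w)) ^ (ζ - N / 2) *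
    besselIntegral (2 * ζ - N - 1) (w * r)

lemma measurable_besselIntegral (c : ℂ) : Measurable (besselIntegral c) := by
  have h : Measurable fun p : ℂ × ℝ => (p.2 : ℂ) ^ c * Complex.exp (-p.1 * phase p.2) := by
    have := measurable_phase
    fun_prop
  exact (h.stronglyMeasurable.integral_prod_right (ν := volume.restrict (Ioi 0))).measurable

lemma measurable_resolventKernel (N : ℕ) (ζ w : ℂ) : Measurable (resolventKernel N ζ w) := by
  have h := (measurable_besselIntegral (2 * ζ - N - 1)).comp
    (by fun_prop : Measurable fun r : ℝ => w * (r : ℂ))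
  refine Measurable.mul ?_ h
  fun_prop

lemma div_two_mul_mem_slitPlane {w : ℂ} (hw : 0 < w.re) {r : ℝ} (hr : 0 < r) :
    (r : ℂ) / (2 * w) ∈ Complex.slitPlane := by
  have hw0 : w ≠ 0 := fun h => by simp [h] at hw
  have : (r : ℂ) / (2 * w) = ((r / 2 : ℝ) : ℂ) * w⁻¹ := by
    push_cast; field_simp
  left
  rw [this, Complex.re_ofReal_mul, Complex.inv_re]
  have := Complex.normSq_pos.2 hw0
  positivity

lemma differentiableAt_resolventKernel (N : ℕ) (ζ : ℂ) {w : ℂ} (hw : 0 < w.re) {r : ℝ}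
    (hr : 0 < r) : DifferentiableAt ℂ (fun w => resolventKernel N ζ w r) w := by
  have hw0 : w ≠ 0 := fun h => by simp [h] at hw
  unfold resolventKernel
  refine DifferentiableAt.mul (DifferentiableAt.const_mul ?_ _) ?_
  · refine DifferentiableAt.cpow_const ?_ (div_two_mul_mem_slitPlane hw hr)
    exact (differentiableAt_const _).div (by fun_prop) (by simpa using hw0)
  · have hre : 0 < (w * (r : ℂ)).re := by
      simp only [Complex.re_mul_ofReal]
      positivity
    have h := DifferentiableAt.comp (g := besselIntegral (2 * ζ - N - 1))
      (f := fun w : ℂ => w * (r : ℂ)) w (differentiableAt_besselIntegral _ hre) (by fun_prop)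
    exact h

/-- Pointwise decay of the kernel, uniformly in the direction of `w`. -/
theorem norm_resolventKernel_le {ζ w : ℂ} (h1 : ((N : ℝ) - 1) / 2 ≤ ζ.re)
    (h2 : ζ.re ≤ ((N : ℝ) + 1) / 2) (hw : 0 < w.re) {r : ℝ} (hr : 0 < r) :
    ‖resolventKernel N ζ w r‖ ≤ 4 * (14 + 2 * ‖2 * ζ - N - 1‖) * Real.exp (Real.pi * |ζ.im|) *
      ‖w‖ ^ (((N : ℝ) - 1) / 2 - ζ.re) * r ^ (ζ.re - ((N : ℝ) + 1) / 2) := by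
  have hw0 : 0 < ‖w‖ := norm_pos_iff.2 fun h => by simp [h] at hw
  -- The two bounds on `ζ.re` amount to `-2 ≤ Re c ≤ 0` for `c = 2ζ - N - 1`.
  have hbes := norm_besselIntegral_le (c := 2 * ζ - N - 1) (w := w * r) (by simp; linarith)
    (by simp; linarith) (by simp only [Complex.re_mul_ofReal]; positivity)
  rw [norm_mul, Complex.norm_real, Real.norm_of_nonneg hr.le] at hbes
  have hne : (r : ℂ) / (2 * w) ≠ 0 := Complex.slitPlane_ne_zero (div_two_mul_mem_slitPlane hw hr)
  have hnorm : ‖(r : ℂ) / (2 * w)‖ = r / 2 * ‖w‖⁻¹ := by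
    rw [norm_div, norm_mul, Complex.norm_real, Real.norm_of_nonneg hr.le]
    simp; field_simp
  have hpow : ‖((r : ℂ) / (2 * w)) ^ (ζ - N / 2)‖ ≤
      2 * r ^ (ζ.re - N / 2) * ‖w‖ ^ (N / 2 - ζ.re) * Real.exp (Real.pi * |ζ.im|) := by
    have hre : (ζ - N / 2).re = ζ.re - N / 2 := by simp
    have him : (ζ - N / 2).im = ζ.im := by simp
    rw [Complex.norm_cpow_of_ne_zero hne, hre, him, hnorm, div_eq_mul_inv, ← Real.exp_neg]
    have e1 : (r / 2 * ‖w‖⁻¹) ^ (ζ.re - N / 2) ≤ 2 * r ^ (ζ.re - N / 2) * ‖w‖ ^ (N / 2 - ζ.re) := by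
      rw [Real.mul_rpow (by positivity) (by positivity), Real.div_rpow hr.le (by norm_num),
        Real.inv_rpow hw0.le, ← Real.rpow_neg hw0.le, neg_sub, div_eq_mul_inv,
        ← Real.rpow_neg (by norm_num), neg_sub]
      have : (2 : ℝ) ^ (N / 2 - ζ.re) ≤ 2 := by
        calc (2 : ℝ) ^ (N / 2 - ζ.re) ≤ 2 ^ (1 : ℝ) :=
              Real.rpow_le_rpow_of_exponent_le (by norm_num) (by linarith)
          _ = 2 := Real.rpow_one 2
      calc _ ≤ r ^ (ζ.re - N / 2) * 2 * ‖w‖ ^ (N / 2 - ζ.re) := by gcongr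
        _ = _ := by ring
    gcongr
    calc -(((r : ℂ) / (2 * w)).arg * ζ.im) ≤ |((r : ℂ) / (2 * w)).arg * ζ.im| := neg_le_abs _
      _ = |((r : ℂ) / (2 * w)).arg| * |ζ.im| := abs_mul _ _
      _ ≤ Real.pi * |ζ.im| := by gcongr; exact Complex.abs_arg_le_pi _
  have hpi : ‖(((4 * Real.pi) ^ (-((N : ℝ) / 2)) : ℝ) : ℂ)‖ ≤ 1 := by
    rw [Complex.norm_real, Real.norm_of_nonneg (by positivity)]
    refine Real.rpow_le_one_of_one_le_of_nonpos ?_ (by simp; positivity)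
    linarith [Real.pi_gt_three]
  unfold resolventKernel
  rw [norm_mul, norm_mul, norm_mul]
  calc _ ≤ ‖(2 : ℂ)‖ * 1 *
        (2 * r ^ (ζ.re - N / 2) * ‖w‖ ^ (N / 2 - ζ.re) * Real.exp (Real.pi * |ζ.im|)) *
        ((14 + 2 * ‖2 * ζ - N - 1‖) * (‖w‖ * r) ^ (-(1 / 2) : ℝ)) := by gcongr
    _ = 4 * (14 + 2 * ‖2 * ζ - N - 1‖) * Real.exp (Real.pi * |ζ.im|) *
      (‖w‖ ^ (N / 2 - ζ.re) * ‖w‖ ^ (-(1 / 2) : ℝ)) *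
      (r ^ (ζ.re - N / 2) * r ^ (-(1 / 2) : ℝ)) := by
        rw [Real.mul_rpow hw0.le hr.le, Complex.norm_ofNat]; ring
    _ = _ := by
        rw [← Real.rpow_add hw0, ← Real.rpow_add hr]
        rw [show (N : ℝ) / 2 - ζ.re + -(1 / 2) = ((N : ℝ) - 1) / 2 - ζ.re by ring,
          show ζ.re - (N : ℝ) / 2 + -(1 / 2) = ζ.re - ((N : ℝ) + 1) / 2 by ring]

lemma ofReal_mul_sq_cpow {k y : ℝ} (hk : 0 < k) (hy : 0 < y) (s : ℂ) :
    ((k * y ^ (2 : ℝ) : ℝ) : ℂ) ^ s = (k : ℂ) ^ s * (y : ℂ) ^ (2 * s) := by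
  rw [Complex.ofReal_mul, Complex.mul_cpow_ofReal_nonneg hk.le (by positivity),
    Complex.ofReal_cpow hy.le, ← Complex.cpow_mul]
  · norm_num
  · rw [← Complex.ofReal_log hy.le]; simp [Complex.mul_im, Real.pi_pos]
  · rw [← Complex.ofReal_log hy.le]; simp [Complex.mul_im, Real.pi_pos.le]

/-- The integrand of the Laplace transform of the heat kernel. -/
def heatLaplaceIntegrand (N : ℕ) (ζ : ℂ) (w r t : ℝ) : ℂ :=
  (t : ℂ) ^ (ζ - 1) * (Real.exp (-(w ^ 2 * t)) : ℂ) * (heatKernel N t r : ℂ)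

/-- The substitution `t = (r / 2w) y²` balances the two exponents: `w² t` and `r² / (4t)` become `w
r y² / 2` and `w r y⁻² / 2`, with sum `w r * phase y`. -/
lemma heatLaplaceIntegrand_subst (ζ : ℂ) {w r : ℝ} (hw : 0 < w) (hr : 0 < r) {y : ℝ} (hy : 0 < y) :
    (r / (2 * w)) • (2 * y ^ (2 - 1 : ℝ)) •
        heatLaplaceIntegrand N ζ w r (r / (2 * w) * y ^ (2 : ℝ)) =
      2 * (((4 * Real.pi) ^ (-((N : ℝ) / 2)) : ℝ) : ℂ) *
        ((r : ℂ) / (2 * (w : ℂ))) ^ (ζ - N / 2) *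
        ((y : ℂ) ^ (2 * ζ - N - 1) * Complex.exp (-((w : ℂ) * r) * phase y)) := by
  set k : ℝ := r / (2 * w) with hk
  have hk0 : 0 < k := by positivity
  have hkC : (k : ℂ) ≠ 0 := by exact_mod_cast hk0.ne'
  have hyC : (y : ℂ) ≠ 0 := by exact_mod_cast hy.ne'
  have hexp : Real.exp (-(w ^ 2 * (k * y ^ (2 : ℝ)))) *
      Real.exp (-(r ^ 2 / (4 * (k * y ^ (2 : ℝ))))) = Real.exp (-(w * r) * phase y) := by
    rw [← Real.exp_add, Real.rpow_ofNat]
    congr 1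
    unfold phase
    rw [hk]
    field_simp
    ring
  have hkw : (r : ℂ) / (2 * (w : ℂ)) = (k : ℂ) := by rw [hk]; push_cast; rfl
  have hexpC : (Real.exp (-(w ^ 2 * (k * y ^ (2 : ℝ)))) : ℂ) *
      (Real.exp (-(r ^ 2 / (4 * (k * y ^ (2 : ℝ))))) : ℂ) =
      Complex.exp (-((w : ℂ) * r) * phase y) := by
    rw [← Complex.ofReal_mul, hexp]; push_cast; rfl
  have hheat : (heatKernel N (k * y ^ (2 : ℝ)) r : ℂ) =
      (((4 * Real.pi) ^ (-((N : ℝ) / 2)) : ℝ) : ℂ) *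
        ((k : ℂ) ^ (-((N : ℂ) / 2)) * (y : ℂ) ^ (2 * (-((N : ℂ) / 2)))) *
        (Real.exp (-(r ^ 2 / (4 * (k * y ^ (2 : ℝ))))) : ℂ) := by
    rw [heatKernel, Real.mul_rpow (by positivity) (by positivity), Complex.ofReal_mul,
      Complex.ofReal_mul, ← ofReal_mul_sq_cpow hk0 hy, Complex.ofReal_cpow (by positivity)
        (-((N : ℝ) / 2)) (x := k * y ^ (2 : ℝ))]
    push_cast
    rfl
  rw [heatLaplaceIntegrand, hheat, hkw, ofReal_mul_sq_cpow hk0 hy, ← hexpC]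
  have hk1 : (k : ℂ) ^ (ζ - N / 2) = k * ((k : ℂ) ^ (ζ - 1) * (k : ℂ) ^ (-((N : ℂ) / 2))) := by
    rw [← Complex.cpow_add _ _ hkC]
    nth_rewrite 2 [← Complex.cpow_one (k : ℂ)]
    rw [← Complex.cpow_add _ _ hkC]
    congr 1; ring
  have hy1 : (y : ℂ) ^ (2 * ζ - N - 1) =
      y * ((y : ℂ) ^ (2 * (ζ - 1)) * (y : ℂ) ^ (2 * (-((N : ℂ) / 2)))) := by
    rw [← Complex.cpow_add _ _ hyC]
    nth_rewrite 2 [← Complex.cpow_one (y : ℂ)]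
    rw [← Complex.cpow_add _ _ hyC]
    congr 1; ring
  rw [hk1, hy1]
  have h21 : (2 - 1 : ℝ) = 1 := by norm_num
  rw [h21, Real.rpow_one, Complex.real_smul, Complex.real_smul]
  push_cast
  ring

/-- For positive `w` the kernel is the Laplace transform of the heat kernel. -/
theorem integral_heatLaplaceIntegrand (ζ : ℂ) {w r : ℝ} (hw : 0 < w) (hr : 0 < r) :
    ∫ t in Ioi (0 : ℝ), heatLaplaceIntegrand N ζ w r t = resolventKernel N ζ w r := by
  have hk0 : 0 < r / (2 * w) := by positivity
  have e1 := integral_comp_mul_left_Ioi' (heatLaplaceIntegrand N ζ w r) 0 hk0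
  rw [mul_zero] at e1
  rw [← e1, ← integral_comp_rpow_Ioi_of_pos
    (g := fun u => heatLaplaceIntegrand N ζ w r (r / (2 * w) * u)) (p := 2) two_pos,
    resolventKernel, besselIntegral, ← integral_const_mul, ← integral_smul]
  exact setIntegral_congr_fun measurableSet_Ioi fun y hy => heatLaplaceIntegrand_subst ζ hw hr hy

lemma integrableOn_heatLaplaceIntegrand (ζ : ℂ) {w r : ℝ} (hw : 0 < w) (hr : 0 < r) :
    IntegrableOn (heatLaplaceIntegrand N ζ w r) (Ioi 0) := by
  have hk0 : 0 < r / (2 * w) := by positivity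
  have h1 := integrableOn_Ioi_comp_mul_left_iff (heatLaplaceIntegrand N ζ w r) 0 hk0
  rw [mul_zero] at h1
  rw [← h1, ← integrableOn_Ioi_comp_rpow_iff _ (two_ne_zero (α := ℝ))]
  have hre : 0 < ((w : ℂ) * r).re := by simp; positivity
  have h2 := ((integrableOn_bessel_integrand (2 * ζ - N - 1) hre).const_mul
    (2 * (((4 * Real.pi) ^ (-((N : ℝ) / 2)) : ℝ) : ℂ) *
        ((r : ℂ) / (2 * (w : ℂ))) ^ (ζ - N / 2))).smul (r / (2 * w))⁻¹
  refine IntegrableOn.congr_fun h2 (fun y hy => ?_) measurableSet_Ioi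
  simp only [Pi.smul_apply]
  rw [← heatLaplaceIntegrand_subst ζ hw hr hy, inv_smul_smul₀ hk0.ne', abs_of_pos two_pos]

/-- Taking absolute values only replaces `ζ` by its real part, so the pointwise kernel bound also
controls the absolute integral needed for Fubini's theorem. -/
lemma integral_norm_heatLaplaceIntegrand (ζ : ℂ) {w r : ℝ} (hw : 0 < w) (hr : 0 < r) :
    ∫ t in Ioi (0 : ℝ), ‖heatLaplaceIntegrand N ζ w r t‖ = ‖resolventKernel N ζ.re w r‖ := by
  rw [← integral_heatLaplaceIntegrand _ hw hr]
  have h : ∫ t in Ioi (0 : ℝ), heatLaplaceIntegrand N ζ.re w r t =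
      ∫ t in Ioi (0 : ℝ), ((‖heatLaplaceIntegrand N ζ w r t‖ : ℝ) : ℂ) := by
    refine setIntegral_congr_fun measurableSet_Ioi fun t ht => ?_
    rw [mem_Ioi] at ht
    simp only [heatLaplaceIntegrand]
    rw [norm_mul, norm_mul, Complex.norm_real, Complex.norm_real,
      Complex.norm_cpow_eq_rpow_re_of_pos ht, Real.norm_of_nonneg (Real.exp_pos _).le,
      Real.norm_of_nonneg (heatKernel_nonneg ht r), Complex.ofReal_mul, Complex.ofReal_mul,
      Complex.ofReal_cpow ht.le]
    simp
  rw [h, integral_complex_ofReal, Complex.norm_real, Real.norm_of_nonneg]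
  exact integral_nonneg fun t => norm_nonneg _

lemma ae_fst_ne_snd (hN : 1 ≤ N) :
    ∀ᵐ p : EuclideanSpace ℝ (Fin N) × EuclideanSpace ℝ (Fin N), 0 < ‖p.1 - p.2‖ := by
  have : Nonempty (Fin N) := ⟨⟨0, hN⟩⟩
  rw [Measure.volume_eq_prod]
  refine (Measure.ae_prod_iff_ae_ae ?_).2 (.of_forall fun x => ?_)
  · exact measurableSet_lt measurable_const (by fun_prop)
  · filter_upwards [Measure.ae_ne volume x] with y hy
    rw [norm_pos_iff, sub_ne_zero]
    exact hy.symm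

/-! ### The kernel formula, continued analytically in `w`. -/

/-- The Fourier symbol of `-Δ + w²`. -/
def shiftedSymbol (w : ℂ) (ξ : EuclideanSpace ℝ (Fin N)) : ℂ :=
  (((2 * Real.pi) ^ 2 * ‖ξ‖ ^ 2 : ℝ) : ℂ) + w ^ 2

/-- The imaginary part `2 Re w Im w` vanishes only for real `w`, and then the sum is positive. Hence
principal powers are holomorphic in `w`. -/
lemma add_sq_mem_slitPlane {w : ℂ} (hw : 0 < w.re) {s : ℝ} (hs : 0 ≤ s) :
    (s : ℂ) + w ^ 2 ∈ Complex.slitPlane := by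
  rw [Complex.mem_slitPlane_iff]
  by_cases him : w.im = 0
  · left
    simp only [sq, Complex.add_re, Complex.ofReal_re, Complex.mul_re, him]
    nlinarith
  · right
    simp only [sq, Complex.add_im, Complex.ofReal_im, Complex.mul_im]
    have : w.re * w.im ≠ 0 := mul_ne_zero hw.ne' him
    intro h
    apply this
    linarith

/-- The sum factors as `(w + i√s)(w - i√s)`, and both factors have real part `Re w`. -/
lemma sq_re_le_norm_add_sq {w : ℂ} (hw : 0 < w.re) {s : ℝ} (hs : 0 ≤ s) :
    w.re ^ 2 ≤ ‖(s : ℂ) + w ^ 2‖ := by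
  have hfac : (s : ℂ) + w ^ 2 =
      (w + (√s : ℝ) * Complex.I) * (w - (√s : ℝ) * Complex.I) := by
    have : ((√s : ℝ) : ℂ) ^ 2 = s := by rw [← Complex.ofReal_pow, Real.sq_sqrt hs]
    linear_combination (-1 : ℂ) * this + ((√s : ℝ) : ℂ) ^ 2 * Complex.I_sq
  rw [hfac, norm_mul, sq]
  have h1 : w.re ≤ ‖w + (√s : ℝ) * Complex.I‖ := by
    refine le_trans (le_of_eq ?_) (Complex.re_le_norm _)
    simp
  have h2 : w.re ≤ ‖w - (√s : ℝ) * Complex.I‖ := by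
    refine le_trans (le_of_eq ?_) (Complex.re_le_norm _)
    simp
  gcongr

lemma shiftedSymbol_mem_slitPlane {w : ℂ} (hw : 0 < w.re) (ξ : EuclideanSpace ℝ (Fin N)) :
    shiftedSymbol w ξ ∈ Complex.slitPlane := add_sq_mem_slitPlane hw (by positivity)

lemma sq_re_le_norm_shiftedSymbol {w : ℂ} (hw : 0 < w.re) (ξ : EuclideanSpace ℝ (Fin N)) :
    w.re ^ 2 ≤ ‖shiftedSymbol w ξ‖ := sq_re_le_norm_add_sq hw (by positivity)

lemma continuous_shiftedSymbol (w : ℂ) :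
    Continuous (shiftedSymbol w : EuclideanSpace ℝ (Fin N) → ℂ) := by
  unfold shiftedSymbol; fun_prop

lemma continuous_shiftedSymbol_cpow {w : ℂ} (hw : 0 < w.re) (ζ : ℂ) :
    Continuous fun ξ : EuclideanSpace ℝ (Fin N) => shiftedSymbol w ξ ^ (-ζ) :=
  (continuous_shiftedSymbol w).cpow continuous_const fun ξ => shiftedSymbol_mem_slitPlane hw ξ

/-- The free parameter `δ` allows one bound for all `w` in a ball. At `ζ.re = 0` nothing depends on
`w`. -/
lemma norm_shiftedSymbol_cpow_le {w ζ : ℂ} (hw : 0 < w.re) (hζ : 0 ≤ ζ.re) {δ : ℝ} (hδ : 0 < δ)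
    (hδw : δ ≤ w.re ^ 2) (ξ : EuclideanSpace ℝ (Fin N)) :
    ‖shiftedSymbol w ξ ^ (-ζ)‖ ≤ δ ^ (-ζ.re) * Real.exp (Real.pi * |ζ.im|) := by
  have hne := Complex.slitPlane_ne_zero (shiftedSymbol_mem_slitPlane hw ξ)
  have hle := hδw.trans (sq_re_le_norm_shiftedSymbol hw ξ)
  rw [Complex.norm_cpow_of_ne_zero hne, div_eq_mul_inv, ← Real.exp_neg]
  simp only [Complex.neg_re, Complex.neg_im]
  refine mul_le_mul (Real.rpow_le_rpow_of_nonpos hδ hle (by linarith))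
    (Real.exp_le_exp.2 ?_) (Real.exp_pos _).le (by positivity)
  · calc -((shiftedSymbol w ξ).arg * -ζ.im) ≤ |(shiftedSymbol w ξ).arg * ζ.im| := by
          rw [mul_neg, neg_neg]; exact le_abs_self _
      _ = |(shiftedSymbol w ξ).arg| * |ζ.im| := abs_mul _ _
      _ ≤ Real.pi * |ζ.im| := by gcongr; exact Complex.abs_arg_le_pi _

lemma half_re_le_of_mem_ball {w v : ℂ} (hv : v ∈ ball w (w.re / 2)) : w.re / 2 ≤ v.re := by
  rw [mem_ball, dist_eq_norm] at hv
  have := (Complex.abs_re_le_norm (v - w)).trans hv.le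
  rw [Complex.sub_re] at this
  linarith [(abs_le.1 this).1]

lemma differentiableAt_integral_shiftedSymbol {u : EuclideanSpace ℝ (Fin N) → ℂ}
    (hu : Integrable u) {w ζ : ℂ} (hw : 0 < w.re) (hζ : 0 ≤ ζ.re) :
    DifferentiableAt ℂ (fun w => ∫ ξ, u ξ * shiftedSymbol w ξ ^ (-ζ)) w := by
  have hpos : ∀ v ∈ ball w (w.re / 2), 0 < v.re := fun v hv =>
    (half_pos hw).trans_le (half_re_le_of_mem_ball hv)
  refine differentiableAt_integral_of_dominated (half_pos hw)
    (hu.norm.mul_const (((w.re / 2) ^ 2) ^ (-ζ.re) * Real.exp (Real.pi * |ζ.im|)))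
    (fun v hv => hu.aestronglyMeasurable.mul
      (continuous_shiftedSymbol_cpow (hpos v hv) ζ).aestronglyMeasurable)
    (.of_forall fun ξ => ?_) (.of_forall fun ξ v hv => ?_)
  · intro v hv
    have : DifferentiableAt ℂ (fun w => u ξ * shiftedSymbol w ξ ^ (-ζ)) v := by
      refine DifferentiableAt.const_mul ?_ _
      refine DifferentiableAt.cpow_const ?_ (shiftedSymbol_mem_slitPlane (hpos v hv) ξ)
      unfold shiftedSymbol
      fun_prop
    exact this.differentiableWithinAt
  · rw [norm_mul]
    gcongr
    refine norm_shiftedSymbol_cpow_le (hpos v hv) hζ (by positivity) ?_ ξ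
    gcongr
    exact half_re_le_of_mem_ball hv

/-- The pointwise kernel bound dominates the integrand locally in `w`: its power of `‖w‖` has
nonpositive exponent, so a lower bound on `‖w‖` over the ball suffices. -/
lemma differentiableAt_integral_resolventKernel (hN : 1 ≤ N)
    {v : EuclideanSpace ℝ (Fin N) × EuclideanSpace ℝ (Fin N) → ℂ} {ζ w : ℂ}
    (h1 : ((N : ℝ) - 1) / 2 ≤ ζ.re) (h2 : ζ.re ≤ ((N : ℝ) + 1) / 2)
    (hvm : AEStronglyMeasurable v)
    (hv : Integrable fun p => ‖v p‖ * ‖p.1 - p.2‖ ^ (ζ.re - ((N : ℝ) + 1) / 2)) (hw : 0 < w.re) :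
    DifferentiableAt ℂ (fun w => ∫ p, v p * resolventKernel N ζ w ‖p.1 - p.2‖) w := by
  have hw0 : 0 < ‖w‖ := norm_pos_iff.2 fun h => by simp [h] at hw
  have hpos : ∀ u ∈ ball w (w.re / 2), 0 < u.re := fun u hu =>
    (half_pos hw).trans_le (half_re_le_of_mem_ball hu)
  set M : ℝ := 4 * (14 + 2 * ‖2 * ζ - N - 1‖) * Real.exp (Real.pi * |ζ.im|) *
    (w.re / 2) ^ (((N : ℝ) - 1) / 2 - ζ.re) with hM
  refine differentiableAt_integral_of_dominated (half_pos hw) (hv.mul_const M)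
    (fun u hu => hvm.mul ?_) ?_ ?_
  · exact ((measurable_resolventKernel N ζ u).comp (by fun_prop)).aestronglyMeasurable
  · filter_upwards [ae_fst_ne_snd hN] with p hp u hu
    exact ((differentiableAt_resolventKernel N ζ (hpos u hu) hp).const_mul _).differentiableWithinAt
  · filter_upwards [ae_fst_ne_snd hN] with p hp u hu
    rw [norm_mul, mul_assoc]
    gcongr
    refine (norm_resolventKernel_le h1 h2 (hpos u hu) hp).trans ?_
    rw [hM, mul_comm (‖p.1 - p.2‖ ^ _)]
    have hu0 : w.re / 2 ≤ ‖u‖ := (half_re_le_of_mem_ball hu).trans (Complex.re_le_norm u)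
    gcongr ?_ * _ * ?_ * ?_
    exact Real.rpow_le_rpow_of_nonpos (half_pos hw) hu0 (by linarith)

lemma gamma_mul_cpow_neg {A : ℝ} (hA : 0 < A) {ζ : ℂ} (hζ : 0 < ζ.re) :
    Complex.Gamma ζ * (A : ℂ) ^ (-ζ) =
      ∫ t in Ioi (0 : ℝ), (t : ℂ) ^ (ζ - 1) * (Real.exp (-(A * t)) : ℂ) := by
  have h := Complex.integral_cpow_mul_exp_neg_mul_Ioi hζ hA
  have e : ((1 : ℂ) / (A : ℂ)) ^ ζ = (A : ℂ) ^ (-ζ) := by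
    rw [one_div, Complex.inv_cpow _ _ (by
      rw [Complex.arg_ofReal_of_nonneg hA.le]; exact Real.pi_pos.ne), Complex.cpow_neg]
  rw [e] at h
  rw [mul_comm, ← h]
  refine setIntegral_congr_fun measurableSet_Ioi fun t _ => ?_
  push_cast
  rfl

lemma integrableOn_gamma_integrand {w : ℝ} (hw : 0 < w) {ζ : ℂ} (hζ : 0 < ζ.re) :
    IntegrableOn (fun t : ℝ => (t : ℂ) ^ (ζ - 1) * (Real.exp (-(w ^ 2 * t)) : ℂ)) (Ioi 0) := by
  have h := integrableOn_rpow_mul_exp_neg_mul_rpow (s := ζ.re - 1) (p := 1) (b := w ^ 2)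
    (by linarith) zero_lt_one (by positivity)
  refine Integrable.mono' h (by fun_prop) ?_
  rw [ae_restrict_iff' measurableSet_Ioi]
  refine .of_forall fun t (ht : 0 < t) => ?_
  rw [norm_mul, Complex.norm_cpow_eq_rpow_re_of_pos ht, Complex.norm_real,
    Real.norm_of_nonneg (Real.exp_pos _).le, Real.rpow_one]
  simp

/-- The kernel formula for positive `w`. -/
lemma gamma_mul_integral_shiftedSymbol_of_pos (hN : 1 ≤ N)
    {g h : EuclideanSpace ℝ (Fin N) → ℂ} (hg : Integrable g) (hh : Integrable h)
    (hu : Integrable fun ξ => conj (𝓕 g ξ) * 𝓕 h ξ) {ζ : ℂ} (hζ : 0 < ζ.re)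
    (h1 : ((N : ℝ) - 1) / 2 ≤ ζ.re) (h2 : ζ.re ≤ ((N : ℝ) + 1) / 2)
    (hv : Integrable fun p : EuclideanSpace ℝ (Fin N) × EuclideanSpace ℝ (Fin N) =>
      ‖conj (g p.1) * h p.2‖ * ‖p.1 - p.2‖ ^ (ζ.re - ((N : ℝ) + 1) / 2)) {w : ℝ} (hw : 0 < w) :
    Complex.Gamma ζ * ∫ ξ, conj (𝓕 g ξ) * 𝓕 h ξ * shiftedSymbol (w : ℂ) ξ ^ (-ζ) =
      ∫ p : EuclideanSpace ℝ (Fin N) × EuclideanSpace ℝ (Fin N),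
        conj (g p.1) * h p.2 * resolventKernel N ζ w ‖p.1 - p.2‖ := by
  set u : EuclideanSpace ℝ (Fin N) → ℂ := fun ξ => conj (𝓕 g ξ) * 𝓕 h ξ
  set v : EuclideanSpace ℝ (Fin N) × EuclideanSpace ℝ (Fin N) → ℂ := fun p => conj (g p.1) * h p.2
  have hgc : Integrable fun x => conj (g x) :=
    (Complex.conjCLE : ℂ →L[ℝ] ℂ).integrable_comp hg
  have hvi : Integrable v := hgc.mul_prod hh
  let γ : ℝ → ℂ := fun t => (t : ℂ) ^ (ζ - 1) * (Real.exp (-(w ^ 2 * t)) : ℂ)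
  have hγ : IntegrableOn γ (Ioi 0) := integrableOn_gamma_integrand hw hζ
  have hγm : Measurable γ := by simp only [γ]; fun_prop
  let G : EuclideanSpace ℝ (Fin N) → ℝ → ℂ :=
    fun ξ t => (Real.exp (-((2 * Real.pi) ^ 2 * ‖ξ‖ ^ 2 * t)) : ℂ)
  have hGm : Measurable (Function.uncurry G) := by simp only [G, Function.uncurry_def]; fun_prop
  -- Fubini on the frequency side: the Gaussian is at most `1`, leaving the product of `u` and `γ`.
  have hΨ : Integrable (Function.uncurry fun ξ t => u ξ * γ t * G ξ t)
      (volume.prod (volume.restrict (Ioi 0))) := by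
    refine (hu.mul_prod hγ).mono ((hu.mul_prod hγ).aestronglyMeasurable.mul
      hGm.aestronglyMeasurable) ?_
    filter_upwards [Measure.quasiMeasurePreserving_snd.ae
      (ae_restrict_mem (measurableSet_Ioi : MeasurableSet (Ioi (0 : ℝ))))] with z hz
    simp only [Function.uncurry]
    rw [norm_mul]
    refine mul_le_of_le_one_right (norm_nonneg _) ?_
    have hz' : (0 : ℝ) < z.2 := hz
    simp only [G]
    rw [Complex.norm_real, Real.norm_of_nonneg (Real.exp_pos _).le, Real.exp_le_one_iff]
    have : 0 ≤ (2 * Real.pi) ^ 2 * ‖z.1‖ ^ 2 * z.2 := by positivity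
    linarith
  -- Fubini on the space side: the absolute integral in `t` is the kernel at the real exponent
  -- `ζ.re`, and its decay bound reduces the matter to `hv`.
  have hΘ : Integrable (Function.uncurry fun p t => v p * heatLaplaceIntegrand N ζ w ‖p.1 - p.2‖ t)
      (volume.prod (volume.restrict (Ioi 0))) := by
    have hm : Measurable (fun z : (EuclideanSpace ℝ (Fin N) × EuclideanSpace ℝ (Fin N)) × ℝ =>
        heatLaplaceIntegrand N ζ w ‖z.1.1 - z.1.2‖ z.2) := by
      unfold heatLaplaceIntegrand heatKernel; fun_prop
    refine (integrable_prod_iff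
      (hvi.aestronglyMeasurable.comp_fst.mul hm.aestronglyMeasurable)).2 ⟨?_, ?_⟩
    · filter_upwards [ae_fst_ne_snd hN] with p hp
      exact (integrableOn_heatLaplaceIntegrand ζ hw hp).const_mul (v p)
    · set M : ℝ := 4 * (14 + 2 * ‖2 * (ζ.re : ℂ) - N - 1‖) *
        Real.exp (Real.pi * |(ζ.re : ℂ).im|) * ‖(w : ℂ)‖ ^ (((N : ℝ) - 1) / 2 - ζ.re)
      refine (hv.mul_const M).mono' ?_ ?_
      · exact (hvi.aestronglyMeasurable.comp_fst.mul
          hm.aestronglyMeasurable).norm.integral_prod_right'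
      · filter_upwards [ae_fst_ne_snd hN] with p hp
        have e : ∫ t in Ioi (0 : ℝ), ‖v p * heatLaplaceIntegrand N ζ w ‖p.1 - p.2‖ t‖ =
            ‖v p‖ * ‖resolventKernel N ζ.re w ‖p.1 - p.2‖‖ := by
          rw [← integral_norm_heatLaplaceIntegrand ζ hw hp, ← integral_const_mul]
          exact integral_congr_ae (.of_forall fun t => norm_mul _ _)
        have hk := norm_resolventKernel_le (N := N) (ζ := (ζ.re : ℂ)) (w := (w : ℂ)) h1 h2 hw hp
        refine (le_of_eq (congrArg norm e)).trans ?_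
        rw [norm_mul, norm_norm, norm_norm]
        calc _ ≤ ‖v p‖ * (M * ‖p.1 - p.2‖ ^ (ζ.re - ((N : ℝ) + 1) / 2)) := by
              gcongr
              exact hk
          _ = _ := by ring
  calc Complex.Gamma ζ * ∫ ξ, u ξ * shiftedSymbol (w : ℂ) ξ ^ (-ζ)
      = ∫ ξ, ∫ t in Ioi (0 : ℝ), u ξ * γ t * G ξ t := by
        rw [← integral_const_mul]
        refine integral_congr_ae (.of_forall fun ξ => ?_)
        have hA : 0 < (2 * Real.pi) ^ 2 * ‖ξ‖ ^ 2 + w ^ 2 := by positivity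
        have e := gamma_mul_cpow_neg hA hζ
        have e' : shiftedSymbol (w : ℂ) ξ = (((2 * Real.pi) ^ 2 * ‖ξ‖ ^ 2 + w ^ 2 : ℝ) : ℂ) := by
          unfold shiftedSymbol; push_cast; rfl
        simp only
        rw [e', mul_left_comm, e, ← integral_const_mul]
        refine setIntegral_congr_fun measurableSet_Ioi fun t _ => ?_
        simp only [γ, G]
        rw [add_mul, neg_add, Real.exp_add, Complex.ofReal_mul]
        ring
    _ = ∫ t in Ioi (0 : ℝ), ∫ ξ, u ξ * γ t * G ξ t := integral_integral_swap hΨ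
    _ = ∫ t in Ioi (0 : ℝ), ∫ p, v p * heatLaplaceIntegrand N ζ w ‖p.1 - p.2‖ t := by
        refine setIntegral_congr_fun measurableSet_Ioi fun t ht => ?_
        have e := integral_conj_fourier_mul_gaussian hg hh ht
        calc ∫ ξ, u ξ * γ t * G ξ t = γ t * ∫ ξ, u ξ * G ξ t := by
              rw [← integral_const_mul]; congr 1; ext ξ; ring
          _ = γ t * ∫ p, v p * (heatKernel N t ‖p.1 - p.2‖ : ℂ) := by rw [← e]
          _ = _ := by
              rw [← integral_const_mul]; congr 1; ext p
              simp only [heatLaplaceIntegrand, γ]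
              ring
    _ = ∫ p, ∫ t in Ioi (0 : ℝ), v p * heatLaplaceIntegrand N ζ w ‖p.1 - p.2‖ t :=
        (integral_integral_swap hΘ).symm
    _ = ∫ p, v p * resolventKernel N ζ w ‖p.1 - p.2‖ := by
        refine integral_congr_ae ?_
        filter_upwards [ae_fst_ne_snd hN] with p hp
        rw [integral_const_mul, integral_heatLaplaceIntegrand ζ hw hp]

/-- The form of `Γ(ζ) * (-Δ + w²) ^ (-ζ)` is given by `resolventKernel`. -/
theorem gamma_mul_integral_shiftedSymbol (hN : 1 ≤ N)
    {g h : EuclideanSpace ℝ (Fin N) → ℂ} (hg : Integrable g) (hh : Integrable h)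
    (hu : Integrable fun ξ => conj (𝓕 g ξ) * 𝓕 h ξ) {ζ : ℂ} (hζ : 0 < ζ.re)
    (h1 : ((N : ℝ) - 1) / 2 ≤ ζ.re) (h2 : ζ.re ≤ ((N : ℝ) + 1) / 2)
    (hv : Integrable fun p : EuclideanSpace ℝ (Fin N) × EuclideanSpace ℝ (Fin N) =>
      ‖conj (g p.1) * h p.2‖ * ‖p.1 - p.2‖ ^ (ζ.re - ((N : ℝ) + 1) / 2)) {w : ℂ} (hw : 0 < w.re) :
    Complex.Gamma ζ * ∫ ξ, conj (𝓕 g ξ) * 𝓕 h ξ * shiftedSymbol w ξ ^ (-ζ) =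
      ∫ p : EuclideanSpace ℝ (Fin N) × EuclideanSpace ℝ (Fin N),
        conj (g p.1) * h p.2 * resolventKernel N ζ w ‖p.1 - p.2‖ := by
  have hgc : Integrable fun x => conj (g x) :=
    (Complex.conjCLE : ℂ →L[ℝ] ℂ).integrable_comp hg
  have hvm := (hgc.mul_prod hh).aestronglyMeasurable
  let U : Set ℂ := {w | 0 < w.re}
  have hU : IsOpen U := isOpen_lt continuous_const Complex.continuous_re
  have hconv : Convex ℝ U := convex_halfSpace_re_gt 0
  have hL : AnalyticOnNhd ℂ (fun w => Complex.Gamma ζ *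
      ∫ ξ, conj (𝓕 g ξ) * 𝓕 h ξ * shiftedSymbol w ξ ^ (-ζ)) U := by
    refine DifferentiableOn.analyticOnNhd (fun w hw => ?_) hU
    exact ((differentiableAt_integral_shiftedSymbol hu hw hζ.le).const_mul _).differentiableWithinAt
  have hR : AnalyticOnNhd ℂ (fun w => ∫ p : EuclideanSpace ℝ (Fin N) × EuclideanSpace ℝ (Fin N),
        conj (g p.1) * h p.2 * resolventKernel N ζ w ‖p.1 - p.2‖) U := by
    refine DifferentiableOn.analyticOnNhd (fun w hw => ?_) hU
    exact (differentiableAt_integral_resolventKernel hN h1 h2 hvm hv hw).differentiableWithinAt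
  -- Identity theorem on the right half plane: both sides agree at the positive numbers `1 + 1 / (n
  -- + 1)`, which accumulate at `1`.
  refine hL.eqOn_of_preconnected_of_frequently_eq hR hconv.isPreconnected
    (show (1 : ℂ) ∈ U by simp [U]) ?_ hw
  have hseq : Tendsto (fun n : ℕ => ((1 + 1 / ((n : ℝ) + 1) : ℝ) : ℂ)) atTop (𝓝[≠] 1) := by
    refine tendsto_nhdsWithin_iff.2 ⟨?_, .of_forall fun n => ?_⟩
    · have := (Complex.continuous_ofReal.tendsto _).comp
        (tendsto_one_div_add_atTop_nhds_zero_nat.const_add (1 : ℝ))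
      rwa [add_zero, Complex.ofReal_one] at this
    · have : (0 : ℝ) < 1 / ((n : ℝ) + 1) := by positivity
      rw [mem_compl_iff, mem_singleton_iff, ← Complex.ofReal_one, Complex.ofReal_inj]
      linarith
  refine hseq.frequently (Frequently.of_forall fun n => ?_)
  exact gamma_mul_integral_shiftedSymbol_of_pos hN hg hh hu hζ h1 h2 hv (by positivity)

/-! ### Interpolation between uniform and square summable bounds -/

/-- Three lines theorem for a finite family that is uniformly bounded on one edge of a strip and
square summable on the other one. -/
theorem sum_rpow_le_of_interpolation {ι : Type*} [Fintype ι] {a : ℝ} (ha : 1 ≤ a)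
    {q : ι → ℂ → ℂ} {K M₀ M₁ : ℝ} (hM₀ : 0 ≤ M₀) (hM₁ : 0 ≤ M₁)
    (hq : ∀ j, DiffContOnCl ℂ (q j) (Complex.HadamardThreeLines.verticalStrip 0 a))
    (hK : ∀ j, ∀ ζ ∈ Complex.HadamardThreeLines.verticalClosedStrip 0 a, ‖q j ζ‖ ≤ K)
    (h0 : ∀ j, ∀ ζ : ℂ, ζ.re = 0 → ‖q j ζ‖ ≤ M₀)
    (h1 : ∀ ζ : ℂ, ζ.re = a → ∑ j, ‖q j ζ‖ ^ 2 ≤ M₁ ^ 2) :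
    ∑ j, ‖q j 1‖ ^ (2 * a) ≤ (M₀ ^ (1 - 1 / a) * M₁ ^ (1 / a)) ^ (2 * a) := by
  classical
  have ha0 : 0 < a := by linarith
  -- Indices with `q j 1 = 0` contribute nothing; without them the complex powers of `m j` have
  -- nonzero base.
  set s : Finset ι := Finset.univ.filter fun j => q j 1 ≠ 0 with hs
  set m : ι → ℝ := fun j => ‖q j 1‖ with hm
  have hmpos : ∀ j ∈ s, 0 < m j := fun j hj => norm_pos_iff.2 (Finset.mem_filter.1 hj).2
  set S : ℝ := ∑ j ∈ s, m j ^ (2 * a) with hS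
  have hsum : ∑ j, ‖q j 1‖ ^ (2 * a) = S := by
    rw [hS, hs, Finset.sum_filter]
    refine Finset.sum_congr rfl fun j _ => ?_
    split_ifs with h
    · rfl
    · rw [not_not.1 h, norm_zero, Real.zero_rpow (by positivity)]
  rw [hsum]
  have hS0 : 0 ≤ S := Finset.sum_nonneg fun j _ => by positivity
  rcases hS0.eq_or_lt with hS0 | hSpos
  · rw [← hS0]; positivity
  -- Duality built into one scalar function: the phases and weights are chosen so that `F 1 = S`. On
  -- the left edge `|F| ≤ M₀ S`, and on the right edge the Cauchy–Schwarz inequality gives `|F| ≤ M₁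
  -- √S`.
  let F : ℂ → ℂ := fun ζ => ∑ j ∈ s, (conj (q j 1) / m j) * ((m j : ℂ) ^ (2 * a - ζ) * q j ζ)
  have hph : ∀ j ∈ s, ‖conj (q j 1) / m j‖ = 1 := fun j hj => by
    rw [norm_div, RCLike.norm_conj, Complex.norm_real, norm_norm]
    exact div_self (hmpos j hj).ne'
  have hpow : ∀ j ∈ s, ∀ ζ : ℂ, ‖(m j : ℂ) ^ (2 * a - ζ)‖ = m j ^ (2 * a - ζ.re) := fun j hj ζ => by
    rw [Complex.norm_cpow_eq_rpow_re_of_pos (hmpos j hj)]; simp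
  have hFle : ∀ ζ, ‖F ζ‖ ≤ ∑ j ∈ s, m j ^ (2 * a - ζ.re) * ‖q j ζ‖ := fun ζ => by
    refine (norm_sum_le _ _).trans (Finset.sum_le_sum fun j hj => ?_)
    rw [norm_mul, norm_mul, hph j hj, one_mul, hpow j hj]
  have hF1 : F 1 = S := by
    simp only [F, hS, Complex.ofReal_sum]
    refine Finset.sum_congr rfl fun j hj => ?_
    have hne : (m j : ℂ) ≠ 0 := by exact_mod_cast (hmpos j hj).ne'
    have e1 : conj (q j 1) * q j 1 = (m j : ℂ) ^ 2 := by
      rw [mul_comm, Complex.mul_conj, Complex.normSq_eq_norm_sq]; push_cast; rfl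
    calc conj (q j 1) / m j * ((m j : ℂ) ^ (2 * (a : ℂ) - 1) * q j 1)
        = (conj (q j 1) * q j 1) / m j * (m j : ℂ) ^ (2 * (a : ℂ) - 1) := by ring
      _ = (m j : ℂ) ^ (1 : ℂ) * (m j : ℂ) ^ (2 * (a : ℂ) - 1) := by
          rw [e1, Complex.cpow_one]; field_simp
      _ = (m j : ℂ) ^ (2 * (a : ℂ)) := by
          rw [← Complex.cpow_add _ _ hne]; congr 1; ring
      _ = ((m j ^ (2 * a) : ℝ) : ℂ) := by
          rw [Complex.ofReal_cpow (hmpos j hj).le]; push_cast; rfl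
  have hd : DiffContOnCl ℂ F (Complex.HadamardThreeLines.verticalStrip 0 a) := by
    have : ∀ j ∈ s, DiffContOnCl ℂ
        (fun ζ : ℂ => (conj (q j 1) / m j) * ((m j : ℂ) ^ (2 * (a : ℂ) - ζ) * q j ζ))
        (Complex.HadamardThreeLines.verticalStrip 0 a) := fun j hj => by
      have hne : (m j : ℂ) ≠ 0 := by exact_mod_cast (hmpos j hj).ne'
      have hdf : Differentiable ℂ fun ζ : ℂ => (m j : ℂ) ^ (2 * a - ζ) := fun ζ =>
        DifferentiableAt.const_cpow (by fun_prop) (Or.inl hne)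
      have := (hdf.diffContOnCl.smul (hq j)).const_smul (conj (q j 1) / (m j : ℂ))
      exact this
    constructor
    · exact DifferentiableOn.fun_sum fun j hj => (this j hj).1
    · exact continuousOn_finsetSum _ fun j hj => (this j hj).2
  have hB : BddAbove ((norm ∘ F) '' Complex.HadamardThreeLines.verticalClosedStrip 0 a) := by
    refine ⟨∑ j ∈ s, max (m j ^ (2 * a)) (m j ^ a) * K, ?_⟩
    rintro _ ⟨ζ, hζ, rfl⟩
    refine (hFle ζ).trans (Finset.sum_le_sum fun j hj => ?_)
    have hK' := hK j ζ hζ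
    refine mul_le_mul ?_ hK' (norm_nonneg _) (le_max_of_le_left (by positivity))
    have hζ' : 0 ≤ ζ.re ∧ ζ.re ≤ a := hζ
    rcases le_total 1 (m j) with hmj | hmj
    · exact le_max_of_le_left (Real.rpow_le_rpow_of_exponent_le hmj (by linarith))
    · exact le_max_of_le_right
        (Real.rpow_le_rpow_of_exponent_ge (hmpos j hj) hmj (by linarith))
  have hleft : ∀ ζ ∈ Complex.re ⁻¹' {(0 : ℝ)}, ‖F ζ‖ ≤ M₀ * S := fun ζ hζ => by
    have hζ' : ζ.re = 0 := hζ
    refine (hFle ζ).trans ?_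
    rw [hS, Finset.mul_sum]
    refine Finset.sum_le_sum fun j hj => ?_
    rw [hζ', sub_zero, mul_comm]
    gcongr
    exact h0 j ζ hζ'
  have hright : ∀ ζ ∈ Complex.re ⁻¹' {a}, ‖F ζ‖ ≤ M₁ * √S := fun ζ hζ => by
    have hζ' : ζ.re = a := hζ
    refine (hFle ζ).trans ((Real.sum_mul_le_sqrt_mul_sqrt _ _ _).trans ?_)
    rw [mul_comm]
    gcongr
    · rw [Real.sqrt_le_left hM₁]
      exact (Finset.sum_le_sum_of_subset_of_nonneg (Finset.subset_univ s)
        fun _ _ _ => by positivity).trans (h1 ζ hζ')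
    · rw [hS]
      refine le_of_eq (Finset.sum_congr rfl fun j hj => ?_)
      rw [hζ', ← Real.rpow_natCast, ← Real.rpow_mul (hmpos j hj).le]
      congr 1; push_cast; ring
  have hmem : (1 : ℂ) ∈ Complex.HadamardThreeLines.verticalClosedStrip 0 a := by
    simp [Complex.HadamardThreeLines.verticalClosedStrip, ha]
  have key := Complex.HadamardThreeLines.norm_le_interp_of_mem_verticalClosedStrip' ha0 hmem hd hB
    hleft hright
  rw [hF1, Complex.norm_real, Real.norm_of_nonneg hS0, Complex.one_re, sub_zero, sub_zero,
    Real.mul_rpow hM₀ hS0, Real.mul_rpow hM₁ (Real.sqrt_nonneg _), Real.sqrt_eq_rpow,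
    ← Real.rpow_mul hS0] at key
  have e1 : M₀ ^ (1 - 1 / a) * S ^ (1 - 1 / a) * (M₁ ^ (1 / a) * S ^ (1 / 2 * (1 / a))) =
      (M₀ ^ (1 - 1 / a) * M₁ ^ (1 / a)) * S ^ (1 - 1 / (2 * a)) := by
    have : S ^ (1 - 1 / (2 * a)) = S ^ (1 - 1 / a) * S ^ (1 / 2 * (1 / a)) := by
      rw [← Real.rpow_add hSpos]; congr 1; field_simp; ring
    rw [this]; ring
  rw [e1] at key
  have e2 : S = S ^ (1 / (2 * a)) * S ^ (1 - 1 / (2 * a)) := by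
    rw [← Real.rpow_add hSpos]; simp
  -- The three lines bound contains `S^(1 - 1/(2a))` on the right; dividing by it leaves a bound
  -- free of `S`.
  have key2 : S ^ (1 / (2 * a)) ≤ M₀ ^ (1 - 1 / a) * M₁ ^ (1 / a) := by
    refine le_of_mul_le_mul_right ?_ (Real.rpow_pos_of_pos hSpos (1 - 1 / (2 * a)))
    rw [← e2]; exact key
  calc S = (S ^ (1 / (2 * a))) ^ (2 * a) := by
        rw [← Real.rpow_mul hS0, one_div_mul_cancel (by positivity), Real.rpow_one]
    _ ≤ _ := by gcongr

/-! ### Multiplication operators and complex powers of the resolvent -/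

/-- Multiplication by an essentially bounded function. -/
def mulOp (m : EuclideanSpace ℝ (Fin N) → ℂ) (hm : MemLp m ∞) : L2 N →L[ℂ] L2 N :=
  (ContinuousLinearMap.lsmul ℂ ℂ).holderL volume ∞ 2 2 (hm.toLp m)

lemma coeFn_mulOp {m : EuclideanSpace ℝ (Fin N) → ℂ} (hm : MemLp m ∞) (f : L2 N) :
    mulOp m hm f =ᵐ[volume] fun x => m x * f x := by
  filter_upwards [(ContinuousLinearMap.lsmul ℂ ℂ).coeFn_holder (r := 2) (hm.toLp m) f,
    hm.coeFn_toLp] with x h1 h2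
  refine h1.trans ?_
  rw [h2]
  rfl

lemma norm_mulOp_le {m : EuclideanSpace ℝ (Fin N) → ℂ} (hm : MemLp m ∞) {C : ℝ}
    (hC : ∀ x, ‖m x‖ ≤ C) (f : L2 N) : ‖mulOp m hm f‖ ≤ C * ‖f‖ := by
  refine Lp.norm_le_mul_norm_of_ae_le_mul ?_
  filter_upwards [coeFn_mulOp hm f] with x hx
  rw [hx, norm_mul]
  gcongr
  exact hC x

/-- The sesquilinear form of `(-Δ + w²) ^ (-ζ)`. -/
def powerForm (w ζ : ℂ) (u v : L2 N) : ℂ :=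
  ∫ ξ, conj ((𝓕 u : L2 N) ξ) * (𝓕 v : L2 N) ξ * shiftedSymbol w ξ ^ (-ζ)

lemma memLp_shiftedSymbol_cpow {w ζ : ℂ} (hw : 0 < w.re) (hζ : 0 ≤ ζ.re) :
    MemLp (fun ξ : EuclideanSpace ℝ (Fin N) => shiftedSymbol w ξ ^ (-ζ)) ∞ :=
  memLp_top_of_bound (continuous_shiftedSymbol_cpow hw ζ).aestronglyMeasurable _
    (.of_forall (norm_shiftedSymbol_cpow_le hw hζ (by positivity) le_rfl))

lemma powerForm_eq_inner {w ζ : ℂ} (hw : 0 < w.re) (hζ : 0 ≤ ζ.re) (u v : L2 N) :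
    powerForm w ζ u v = inner ℂ (Lp.fourierTransformₗᵢ (EuclideanSpace ℝ (Fin N)) ℂ u)
      (mulOp _ (memLp_shiftedSymbol_cpow hw hζ)
        (Lp.fourierTransformₗᵢ (EuclideanSpace ℝ (Fin N)) ℂ v)) := by
  rw [L2.inner_def, powerForm]
  refine integral_congr_ae ?_
  filter_upwards [coeFn_mulOp (memLp_shiftedSymbol_cpow hw hζ)
    (Lp.fourierTransformₗᵢ (EuclideanSpace ℝ (Fin N)) ℂ v)] with ξ hξ
  rw [hξ, RCLike.inner_apply]
  change conj ((𝓕 u : L2 N) ξ) * (𝓕 v : L2 N) ξ * _ =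
    _ * (𝓕 v : L2 N) ξ * conj ((𝓕 u : L2 N) ξ)
  ring

lemma norm_powerForm_le {w ζ : ℂ} (hw : 0 < w.re) (hζ : 0 ≤ ζ.re) (u v : L2 N) :
    ‖powerForm w ζ u v‖ ≤
      (w.re ^ 2) ^ (-ζ.re) * Real.exp (Real.pi * |ζ.im|) * (‖u‖ * ‖v‖) := by
  rw [powerForm_eq_inner hw hζ]
  refine (norm_inner_le_norm _ _).trans ?_
  have h := norm_mulOp_le (memLp_shiftedSymbol_cpow (N := N) hw hζ)
    (norm_shiftedSymbol_cpow_le hw hζ (by positivity) le_rfl)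
    (Lp.fourierTransformₗᵢ (EuclideanSpace ℝ (Fin N)) ℂ v)
  rw [LinearIsometryEquiv.norm_map] at h ⊢
  calc _ ≤ ‖u‖ * ((w.re ^ 2) ^ (-ζ.re) * Real.exp (Real.pi * |ζ.im|) * ‖v‖) := by gcongr
    _ = _ := by ring

/-- The form is conjugate linear in its first slot; the `conj` on the coefficients lets `c` enter
linearly, hence holomorphically when `c` depends on `ζ`. -/
lemma powerForm_sum_sum {w ζ : ℂ} (hw : 0 < w.re) (hζ : 0 ≤ ζ.re) {ι κ : Type*} (s : Finset ι)
    (t : Finset κ) (c : ι → ℂ) (d : κ → ℂ) (u : ι → L2 N) (v : κ → L2 N) :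
    powerForm w ζ (∑ i ∈ s, conj (c i) • u i) (∑ k ∈ t, d k • v k) =
      ∑ i ∈ s, ∑ k ∈ t, c i * d k * powerForm w ζ (u i) (v k) := by
  simp only [powerForm_eq_inner hw hζ, map_sum, map_smul, sum_inner, inner_sum, inner_smul_left,
    inner_smul_right, Complex.conj_conj, Finset.mul_sum]
  rw [Finset.sum_comm]
  refine Finset.sum_congr rfl fun i _ => Finset.sum_congr rfl fun k _ => ?_
  ring

lemma integrable_conj_fourier_mul (u v : L2 N) :
    Integrable fun ξ => conj ((𝓕 u : L2 N) ξ) * (𝓕 v : L2 N) ξ := by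
  have h := L2.integrable_inner (𝕜 := ℂ) (𝓕 u : L2 N) (𝓕 v : L2 N)
  refine h.congr (.of_forall fun ξ => ?_)
  simp only [RCLike.inner_apply]
  ring

/-- Capping the base at `1` makes its negative powers monotone in the exponent, which gives one
bound for all `ζ` in a bounded region. -/
lemma norm_shiftedSymbol_cpow_le_of_le {w ζ : ℂ} (hw : 0 < w.re) {X Y : ℝ} (hζ : 0 ≤ ζ.re)
    (hX : ζ.re ≤ X) (hY : |ζ.im| ≤ Y) (ξ : EuclideanSpace ℝ (Fin N)) :
    ‖shiftedSymbol w ξ ^ (-ζ)‖ ≤ (min (w.re ^ 2) 1) ^ (-X) * Real.exp (Real.pi * Y) := by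
  have hδ : 0 < min (w.re ^ 2) 1 := lt_min (by positivity) one_pos
  refine (norm_shiftedSymbol_cpow_le hw hζ hδ (min_le_left _ _) ξ).trans ?_
  have : min (w.re ^ 2) 1 ^ (-ζ.re) ≤ min (w.re ^ 2) 1 ^ (-X) :=
    Real.rpow_le_rpow_of_exponent_ge hδ (min_le_right _ _) (by linarith)
  have := Real.pi_pos
  gcongr

lemma differentiableAt_powerForm {w ζ : ℂ} (hw : 0 < w.re) (hζ : 0 < ζ.re) (u v : L2 N) :
    DifferentiableAt ℂ (fun ζ => powerForm w ζ u v) ζ := by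
  have hu := integrable_conj_fourier_mul u v
  have hball : ∀ η ∈ ball ζ ζ.re, 0 ≤ η.re ∧ η.re ≤ 2 * ζ.re ∧ |η.im| ≤ |ζ.im| + ζ.re := by
    intro η hη
    rw [mem_ball, dist_eq_norm] at hη
    have h1 := abs_le.1 ((Complex.abs_re_le_norm (η - ζ)).trans hη.le)
    have h2 := (Complex.abs_im_le_norm (η - ζ)).trans hη.le
    rw [Complex.sub_re] at h1
    rw [Complex.sub_im] at h2
    refine ⟨by linarith, by linarith, ?_⟩
    have := abs_sub_abs_le_abs_sub η.im ζ.im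
    linarith
  refine differentiableAt_integral_of_dominated hζ (hu.norm.mul_const
    ((min (w.re ^ 2) 1) ^ (-(2 * ζ.re)) * Real.exp (Real.pi * (|ζ.im| + ζ.re)))) (fun η hη =>
    hu.aestronglyMeasurable.mul (continuous_shiftedSymbol_cpow hw η).aestronglyMeasurable)
    (.of_forall fun ξ => ?_) (.of_forall fun ξ η hη => ?_)
  · have hne := Complex.slitPlane_ne_zero (shiftedSymbol_mem_slitPlane hw ξ)
    refine Differentiable.differentiableOn fun η => ?_
    exact (DifferentiableAt.const_cpow (by fun_prop) (Or.inl hne)).const_mul _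
  · rw [norm_mul]
    gcongr
    obtain ⟨h1, h2, h3⟩ := hball η hη
    exact norm_shiftedSymbol_cpow_le_of_le hw h1 h2 h3 ξ

/-- Dominated convergence from within the closed half plane, so that the edge `Re ζ = 0` is
included, as the three lines theorem requires. -/
lemma continuousOn_powerForm {w : ℂ} (hw : 0 < w.re) (u v : L2 N) :
    ContinuousOn (fun ζ => powerForm w ζ u v) {ζ | 0 ≤ ζ.re} := by
  have hu := integrable_conj_fourier_mul u v
  intro ζ hζ
  have hnear : ∀ᶠ η in 𝓝[{ζ | 0 ≤ ζ.re}] ζ,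
      0 ≤ η.re ∧ η.re ≤ ζ.re + 1 ∧ |η.im| ≤ |ζ.im| + 1 := by
    filter_upwards [self_mem_nhdsWithin, mem_nhdsWithin_of_mem_nhds (ball_mem_nhds ζ one_pos)]
      with η hη0 hη
    rw [mem_ball, dist_eq_norm] at hη
    have h1 := abs_le.1 ((Complex.abs_re_le_norm (η - ζ)).trans hη.le)
    have h2 := (Complex.abs_im_le_norm (η - ζ)).trans hη.le
    rw [Complex.sub_re] at h1
    rw [Complex.sub_im] at h2
    have := abs_sub_abs_le_abs_sub η.im ζ.im
    exact ⟨hη0, by linarith, by linarith⟩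
  refine continuousWithinAt_of_dominated
    (bound := fun ξ => ‖conj ((𝓕 u : L2 N) ξ) * (𝓕 v : L2 N) ξ‖ *
      ((min (w.re ^ 2) 1) ^ (-(ζ.re + 1)) * Real.exp (Real.pi * (|ζ.im| + 1)))) ?_ ?_
    (hu.norm.mul_const _) (.of_forall fun ξ => ?_)
  · exact .of_forall fun η =>
      hu.aestronglyMeasurable.mul (continuous_shiftedSymbol_cpow hw η).aestronglyMeasurable
  · filter_upwards [hnear] with η hη
    refine .of_forall fun ξ => ?_
    rw [norm_mul]
    gcongr
    exact norm_shiftedSymbol_cpow_le_of_le hw hη.1 hη.2.1 hη.2.2 ξ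
  · have hne := Complex.slitPlane_ne_zero (shiftedSymbol_mem_slitPlane hw ξ)
    have hd : DifferentiableAt ℂ (fun η : ℂ => shiftedSymbol w ξ ^ (-η)) ζ :=
      DifferentiableAt.const_cpow (by fun_prop) (Or.inl hne)
    exact (hd.continuousAt.const_mul _).continuousWithinAt

lemma diffContOnCl_powerForm {w : ℂ} (hw : 0 < w.re) {a : ℝ} (u v : L2 N) :
    DiffContOnCl ℂ (fun ζ => powerForm w ζ u v)
      (Complex.HadamardThreeLines.verticalStrip 0 a) := by
  refine ⟨fun ζ hζ => (differentiableAt_powerForm hw hζ.1 u v).differentiableWithinAt, ?_⟩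
  refine (continuousOn_powerForm hw u v).mono ?_
  refine closure_minimal (fun ζ hζ => (hζ.1 : 0 < ζ.re).le) ?_
  exact isClosed_le continuous_const Complex.continuous_re

/-! ### The Hilbert-Schmidt bound -/

/-- The tensor product of two square integrable functions is square integrable. -/
lemma memLp_tensor (u v : L2 N) :
    MemLp (fun p : EuclideanSpace ℝ (Fin N) × EuclideanSpace ℝ (Fin N) =>
      u p.1 * conj (v p.2)) 2 := by
  have hm : AEStronglyMeasurable (fun p : EuclideanSpace ℝ (Fin N) × EuclideanSpace ℝ (Fin N) =>
      u p.1 * conj (v p.2)) := by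
    rw [Measure.volume_eq_prod]
    exact (Lp.memLp u).1.comp_fst.mul
      (Complex.continuous_conj.comp_aestronglyMeasurable (Lp.memLp v).1.comp_snd)
  rw [memLp_two_iff_integrable_sq_norm hm]
  have h := ((memLp_two_iff_integrable_sq_norm (Lp.memLp u).1).1 (Lp.memLp u)).mul_prod
    ((memLp_two_iff_integrable_sq_norm (Lp.memLp v).1).1 (Lp.memLp v))
  rw [Measure.volume_eq_prod]
  refine h.congr (.of_forall fun p => ?_)
  simp [mul_pow]

lemma inner_toLp_tensor (u v u' v' : L2 N) :
    inner ℂ ((memLp_tensor u v).toLp _) ((memLp_tensor u' v').toLp _) =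
      inner ℂ u u' * inner ℂ v' v := by
  rw [L2.inner_def, L2.inner_def, L2.inner_def, ← integral_prod_mul]
  refine integral_congr_ae ?_
  filter_upwards [(memLp_tensor u v).coeFn_toLp, (memLp_tensor u' v').coeFn_toLp] with p h1 h2
  rw [h1, h2]
  simp only [RCLike.inner_apply, map_mul, Complex.conj_conj]
  ring

/-- Bessel's inequality for the tensor products of two orthonormal families. -/
lemma sum_norm_sq_integral_tensor_le {n : ℕ} {e f : Fin n → L2 N} (he : Orthonormal ℂ e)
    (hf : Orthonormal ℂ f) {K : EuclideanSpace ℝ (Fin N) × EuclideanSpace ℝ (Fin N) → ℂ}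
    (hK : MemLp K 2) :
    ∑ j, ‖∫ p : EuclideanSpace ℝ (Fin N) × EuclideanSpace ℝ (Fin N),
      conj (f j p.1) * e j p.2 * K p‖ ^ 2 ≤ ∫ p, ‖K p‖ ^ 2 := by
  have hon : Orthonormal ℂ fun j => (memLp_tensor (f j) (e j)).toLp _ := by
    rw [orthonormal_iff_ite] at he hf ⊢
    intro i j
    rw [inner_toLp_tensor, hf i j, he j i]
    by_cases h : i = j
    · simp [h]
    · simp [h]
  have h := hon.sum_inner_products_le (hK.toLp K) (s := Finset.univ)
  have hn : ‖hK.toLp K‖ ^ 2 = ∫ p, ‖K p‖ ^ 2 := by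
    rw [← Complex.ofReal_inj]
    have := inner_self_eq_norm_sq_to_K (𝕜 := ℂ) (hK.toLp K)
    rw [L2.inner_def] at this
    push_cast
    rw [← integral_complex_ofReal]
    refine this.symm.trans (integral_congr_ae ?_)
    filter_upwards [hK.coeFn_toLp] with p hp
    rw [hp, inner_self_eq_norm_sq_to_K]
    push_cast
    rfl
  rw [hn] at h
  refine le_trans (le_of_eq (Finset.sum_congr rfl fun j _ =>
    congrArg (fun c : ℂ => ‖c‖ ^ 2) ?_)) h
  rw [L2.inner_def]
  refine integral_congr_ae ?_
  filter_upwards [(memLp_tensor (f j) (e j)).coeFn_toLp, hK.coeFn_toLp] with p h1 h2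
  rw [h1, h2]
  simp only [RCLike.inner_apply, map_mul, Complex.conj_conj]
  ring

/-! ### Complex powers of simple functions -/

/-- The complex power `c |c| ^ (ζ - 1)`. -/
def cpowMod (c ζ : ℂ) : ℂ := c / ‖c‖ * (‖c‖ : ℂ) ^ ζ

lemma cpowMod_zero_left (ζ : ℂ) : cpowMod 0 ζ = 0 := by simp [cpowMod]

lemma cpowMod_one (c : ℂ) : cpowMod c 1 = c := by
  rcases eq_or_ne c 0 with rfl | h
  · simp [cpowMod]
  · rw [cpowMod, Complex.cpow_one, div_mul_cancel₀]
    simpa using h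

/-- Equality fails only at `c = 0` with `ζ.re = 0`, where the left side is `0` and the right side is
`0^0 = 1`. -/
lemma norm_cpowMod_le (c ζ : ℂ) : ‖cpowMod c ζ‖ ≤ ‖c‖ ^ ζ.re := by
  rcases eq_or_ne c 0 with rfl | h
  · rw [cpowMod_zero_left, norm_zero]; positivity
  · rw [cpowMod, norm_mul, norm_div, Complex.norm_real, norm_norm, div_self (norm_ne_zero_iff.2 h),
      one_mul, Complex.norm_cpow_eq_rpow_re_of_pos (norm_pos_iff.2 h)]

lemma differentiable_cpowMod (c : ℂ) : Differentiable ℂ (cpowMod c) := by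
  rcases eq_or_ne c 0 with rfl | h
  · simpa only [funext cpowMod_zero_left] using differentiable_const (0 : ℂ)
  · exact fun ζ => (DifferentiableAt.const_cpow differentiableAt_id
      (Or.inl (by simpa using h))).const_mul _

/-- Multiplication by a simple function. -/
def simpleOp (W : SimpleFunc (EuclideanSpace ℝ (Fin N)) ℂ) : L2 N →L[ℂ] L2 N :=
  mulOp W (W.memLp_top volume)

lemma coeFn_simpleOp (W : SimpleFunc (EuclideanSpace ℝ (Fin N)) ℂ) (f : L2 N) :
    simpleOp W f =ᵐ[volume] fun x => W x * f x := coeFn_mulOp _ f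

/-- Multiplication by the indicator function of a level set of a simple function. -/
def levelOp (W : SimpleFunc (EuclideanSpace ℝ (Fin N)) ℂ) (c : ℂ) : L2 N →L[ℂ] L2 N :=
  simpleOp (W.map fun b => if b = c then 1 else 0)

/-- A function of a simple function is a finite combination of indicators. With `φ = cpowMod · ζ`,
all dependence on `ζ` sits in scalar coefficients of fixed operators. -/
lemma sum_smul_levelOp (W : SimpleFunc (EuclideanSpace ℝ (Fin N)) ℂ) (φ : ℂ → ℂ) (f : L2 N) :
    ∑ c ∈ W.range, φ c • levelOp W c f = simpleOp (W.map φ) f := by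
  refine Lp.ext ?_
  have h1 : ∀ c ∈ W.range, (φ c • levelOp W c f : L2 N) =ᵐ[volume]
      fun x => φ c * ((if W x = c then 1 else 0) * f x) := fun c _ => by
    filter_upwards [Lp.coeFn_smul (φ c) (levelOp W c f),
      coeFn_simpleOp (W.map fun b => if b = c then 1 else 0) f] with x h1 h2
    rw [h1, Pi.smul_apply, smul_eq_mul, levelOp, h2]
    rfl
  have h2 : ∀ᵐ x, ∀ c ∈ W.range, (φ c • levelOp W c f : L2 N) x =
      φ c * ((if W x = c then 1 else 0) * f x) := by
    rw [Finset.eventually_all]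
    exact h1
  filter_upwards [coeFn_simpleOp (W.map φ) f, h2, Lp.coeFn_finsetSum W.range
    (fun c => φ c • levelOp W c f)] with x h3 h4 h5
  rw [h3, h5, Finset.sum_apply, Finset.sum_congr rfl h4,
    Finset.sum_eq_single_of_mem (W x) (W.mem_range_self x)]
  · simp
  · intro c _ hc
    simp [hc.symm]

/-- The analytic family of the forms of `W₁ ^ ζ (-Δ + w²) ^ (-ζ) W₂ ^ ζ`. -/
def formFamily (w : ℂ) (W₁ W₂ : SimpleFunc (EuclideanSpace ℝ (Fin N)) ℂ) (u v : L2 N) (ζ : ℂ) : ℂ :=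
  ∑ c ∈ W₁.range, ∑ d ∈ W₂.range,
    cpowMod c ζ * cpowMod d ζ * powerForm w ζ (levelOp W₁ c u) (levelOp W₂ d v)

lemma formFamily_eq {w ζ : ℂ} (hw : 0 < w.re) (hζ : 0 ≤ ζ.re)
    (W₁ W₂ : SimpleFunc (EuclideanSpace ℝ (Fin N)) ℂ) (u v : L2 N) :
    formFamily w W₁ W₂ u v ζ = powerForm w ζ (simpleOp (W₁.map fun c => conj (cpowMod c ζ)) u)
      (simpleOp (W₂.map fun c => cpowMod c ζ) v) := by
  rw [← sum_smul_levelOp, ← sum_smul_levelOp, powerForm_sum_sum hw hζ, formFamily]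

lemma diffContOnCl_formFamily {w : ℂ} (hw : 0 < w.re) {a : ℝ}
    (W₁ W₂ : SimpleFunc (EuclideanSpace ℝ (Fin N)) ℂ) (u v : L2 N) :
    DiffContOnCl ℂ (formFamily w W₁ W₂ u v) (Complex.HadamardThreeLines.verticalStrip 0 a) := by
  have h : ∀ c d : ℂ, DiffContOnCl ℂ (fun ζ => cpowMod c ζ * cpowMod d ζ *
      powerForm w ζ (levelOp W₁ c u) (levelOp W₂ d v))
      (Complex.HadamardThreeLines.verticalStrip 0 a) := fun c d =>
    ((differentiable_cpowMod c).mul (differentiable_cpowMod d)).diffContOnCl.smul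
      (diffContOnCl_powerForm hw _ _)
  constructor
  · exact DifferentiableOn.fun_sum fun c _ => DifferentiableOn.fun_sum fun d _ => (h c d).1
  · exact continuousOn_finsetSum _ fun c _ => continuousOn_finsetSum _ fun d _ => (h c d).2

/-- At `ζ.re = 0` only `exp (π |Im ζ|)` remains, which is the uniform bound on the left edge. Inside
the strip, the dependence on `w` and the potentials serves only boundedness. -/
lemma norm_formFamily_le {w ζ : ℂ} (hw : 0 < w.re) (hζ : 0 ≤ ζ.re)
    {W₁ W₂ : SimpleFunc (EuclideanSpace ℝ (Fin N)) ℂ} {B₁ B₂ : ℝ} (h₁ : ∀ x, ‖W₁ x‖ ≤ B₁)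
    (h₂ : ∀ x, ‖W₂ x‖ ≤ B₂) (u v : L2 N) :
    ‖formFamily w W₁ W₂ u v ζ‖ ≤ Real.exp (Real.pi * |ζ.im|) *
      ((w.re ^ 2)⁻¹ ^ ζ.re * B₁ ^ ζ.re * B₂ ^ ζ.re) * (‖u‖ * ‖v‖) := by
  have hp : ∀ {W : SimpleFunc (EuclideanSpace ℝ (Fin N)) ℂ} {B : ℝ} (h : ∀ x, ‖W x‖ ≤ B) x,
      ‖cpowMod (W x) ζ‖ ≤ B ^ ζ.re := fun h x =>
    (norm_cpowMod_le _ _).trans (Real.rpow_le_rpow (norm_nonneg _) (h x) hζ)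
  have e1 := norm_mulOp_le ((W₁.map fun c => conj (cpowMod c ζ)).memLp_top volume)
    (C := B₁ ^ ζ.re) (fun x => by simpa using hp h₁ x) u
  have e2 := norm_mulOp_le ((W₂.map fun c => cpowMod c ζ).memLp_top volume)
    (C := B₂ ^ ζ.re) (fun x => by simpa using hp h₂ x) v
  have hB₁ : 0 ≤ B₁ := (norm_nonneg _).trans (h₁ 0)
  rw [formFamily_eq hw hζ]
  refine (norm_powerForm_le hw hζ _ _).trans ?_
  calc _ ≤ (w.re ^ 2) ^ (-ζ.re) * Real.exp (Real.pi * |ζ.im|) *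
        ((B₁ ^ ζ.re * ‖u‖) * (B₂ ^ ζ.re * ‖v‖)) := by
        gcongr
        · exact e1
        · exact e2
    _ = _ := by
        rw [Real.rpow_neg (by positivity), Real.inv_rpow (by positivity)]
        ring

/-! ### Bounds for the Gamma function and the Gaussian factor. -/

lemma norm_Gamma_le {s : ℂ} (hs : 0 < s.re) : ‖Complex.Gamma s‖ ≤ Real.Gamma s.re := by
  rw [Complex.Gamma_eq_integral hs, Complex.GammaIntegral, Real.Gamma_eq_integral hs]
  refine (norm_integral_le_integral_norm _).trans
    (le_of_eq (setIntegral_congr_fun measurableSet_Ioi fun x hx => ?_))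
  rw [norm_mul, Complex.norm_real, Real.norm_of_nonneg (Real.exp_pos _).le,
    Complex.norm_cpow_eq_rpow_re_of_pos hx, Complex.sub_re, Complex.one_re]

/-- The modulus is at most Gamma of the real part, which is continuous on `[1, 1 + a]`. The shift by
`1` keeps the strip away from the pole at `0`. -/
lemma exists_norm_Gamma_le (a : ℝ) :
    ∃ G, 0 < G ∧ ∀ ζ : ℂ, 0 ≤ ζ.re → ζ.re ≤ a → ‖Complex.Gamma (1 + ζ)‖ ≤ G := by
  have hc : ContinuousOn Real.Gamma (Icc 1 (1 + a)) := fun x hx =>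
    (Real.differentiableAt_Gamma fun m => by
      have := hx.1
      have : (0 : ℝ) ≤ m := m.cast_nonneg
      linarith).continuousAt.continuousWithinAt
  obtain ⟨G, hG⟩ := isCompact_Icc.exists_bound_of_continuousOn hc
  refine ⟨max G 1, by positivity, fun ζ h0 h1 => ?_⟩
  have := norm_Gamma_le (s := 1 + ζ) (by simp; linarith)
  refine this.trans ((le_abs_self _).trans ((hG _ ?_).trans (le_max_left _ _)))
  simp
  constructor <;> linarith

lemma norm_exp_sq_sub_one (ζ : ℂ) :
    ‖Complex.exp (ζ ^ 2 - 1)‖ = Real.exp (ζ.re ^ 2 - ζ.im ^ 2 - 1) := by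
  rw [Complex.norm_exp]
  congr 1
  simp [pow_two]

/-! ### The Hilbert–Schmidt edge of the strip. -/

/-- The function `|W₁(x)|ᵃ |W₂(y)|ᵃ |x - y| ^ (a - (N + 1) / 2)`. -/
def weightedRiesz (a : ℝ) (W₁ W₂ : EuclideanSpace ℝ (Fin N) → ℂ)
    (p : EuclideanSpace ℝ (Fin N) × EuclideanSpace ℝ (Fin N)) : ℝ :=
  ‖W₁ p.1‖ ^ a * ‖W₂ p.2‖ ^ a * ‖p.1 - p.2‖ ^ (a - ((N : ℝ) + 1) / 2)

lemma measurable_weightedRiesz (a : ℝ) {W₁ W₂ : EuclideanSpace ℝ (Fin N) → ℂ}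
    (h₁ : Measurable W₁) (h₂ : Measurable W₂) : Measurable (weightedRiesz a W₁ W₂) := by
  unfold weightedRiesz
  fun_prop

/-- The Hardy-Littlewood-Sobolev inequality as a square integrability statement. -/
lemma exists_memLp_weightedRiesz (hN : 1 ≤ N) {a : ℝ} (ha : 1 / 2 < a)
    (ha' : a ≤ ((N : ℝ) + 1) / 2) :
    ∃ C : ℝ, 0 ≤ C ∧ ∀ W₁ W₂ : EuclideanSpace ℝ (Fin N) → ℂ, Measurable W₁ → Measurable W₂ →
      ∀ A B : ℝ≥0,
      eLpNorm W₁ (ENNReal.ofReal (4 * N * a / (N - 1 + 2 * a))) ≤ A →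
      eLpNorm W₂ (ENNReal.ofReal (4 * N * a / (N - 1 + 2 * a))) ≤ B →
      MemLp (weightedRiesz a W₁ W₂) 2 ∧
        ∫ p, weightedRiesz a W₁ W₂ p ^ 2 ≤ C * (A : ℝ) ^ (2 * a) * (B : ℝ) ^ (2 * a) := by
  have hN' : (1 : ℝ) ≤ N := by exact_mod_cast hN
  -- Squaring the weight gives the Riesz kernel with exponent `-s`, `s = N + 1 - 2a`; the two bounds
  -- on `a` say that `0 ≤ s < N`.
  obtain ⟨C, hC, h⟩ := exists_hls (s := N + 1 - 2 * a) hN (by linarith) (by linarith)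
  refine ⟨C, hC, fun W₁ W₂ h₁ h₂ A B hA hB => ?_⟩
  set Q : ℝ := 4 * N * a / (N - 1 + 2 * a) with hQ
  have hden : (0 : ℝ) < N - 1 + 2 * a := by linarith
  have hQ0 : 0 < Q := by positivity
  -- The Hardy–Littlewood–Sobolev exponent applied to `|W|^(2a)` is the exponent `Q` for `W`.
  have hp : 2 * a * (2 * N / (2 * N - (N + 1 - 2 * a))) = Q := by
    rw [hQ, show (2 * N - (N + 1 - 2 * a) : ℝ) = N - 1 + 2 * a by ring]; ring
  have hpow : ∀ {W : EuclideanSpace ℝ (Fin N) → ℂ} {A : ℝ≥0}, eLpNorm W (ENNReal.ofReal Q) ≤ A →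
      ∫⁻ y, ((‖W y‖₊ ^ (2 * a) : ℝ≥0) : ℝ≥0∞) ^ (2 * N / (2 * N - (N + 1 - 2 * a))) ≤
        ((A ^ (2 * a) : ℝ≥0) : ℝ≥0∞) ^ (2 * N / (2 * N - (N + 1 - 2 * a))) := by
    intro W A hA
    have e : ∀ x : ℝ≥0, ((x ^ (2 * a) : ℝ≥0) : ℝ≥0∞) ^ (2 * N / (2 * N - (N + 1 - 2 * a))) =
        (x : ℝ≥0∞) ^ Q := fun x => by
      rw [ENNReal.coe_rpow_of_nonneg _ (by linarith), ← ENNReal.rpow_mul, hp]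
    simp only [e]
    rw [eLpNorm_eq_eLpNorm' (by simpa using hQ0) ENNReal.ofReal_ne_top,
      ENNReal.toReal_ofReal hQ0.le] at hA
    calc _ = eLpNorm' W Q volume ^ Q := lintegral_rpow_enorm_eq_rpow_eLpNorm' hQ0
      _ ≤ _ := ENNReal.rpow_le_rpow hA hQ0.le
  have key := h _ _ (h₁.nnnorm.pow_const (2 * a)) (h₂.nnnorm.pow_const (2 * a)) _ _
    (hpow hA) (hpow hB)
  have hsq : ∀ p, ENNReal.ofReal (weightedRiesz a W₁ W₂ p ^ 2) =
      ((‖W₁ p.1‖₊ ^ (2 * a) : ℝ≥0) : ℝ≥0∞) * (ENNReal.ofReal (‖p.1 - p.2‖ ^ (-(N + 1 - 2 * a))) *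
        ((‖W₂ p.2‖₊ ^ (2 * a) : ℝ≥0) : ℝ≥0∞)) := fun p => by
    have e1 : ∀ {x : ℝ}, 0 ≤ x → (x ^ a) ^ 2 = x ^ (2 * a) := fun hx => by
      rw [← Real.rpow_natCast, ← Real.rpow_mul hx]; congr 1; push_cast; ring
    have e2 : (‖p.1 - p.2‖ ^ (a - ((N : ℝ) + 1) / 2)) ^ 2 = ‖p.1 - p.2‖ ^ (-(N + 1 - 2 * a)) := by
      rw [← Real.rpow_natCast, ← Real.rpow_mul (norm_nonneg _)]; congr 1; push_cast; ring
    rw [weightedRiesz, mul_pow, mul_pow, e1 (norm_nonneg _), e1 (norm_nonneg _), e2,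
      ENNReal.ofReal_mul (by positivity), ENNReal.ofReal_mul (by positivity)]
    have e3 : ∀ c : ℂ, ENNReal.ofReal (‖c‖ ^ (2 * a)) = ((‖c‖₊ ^ (2 * a) : ℝ≥0) : ℝ≥0∞) :=
      fun c => by
        rw [← ENNReal.ofReal_coe_nnreal, NNReal.coe_rpow, coe_nnnorm]
    rw [e3, e3]
    ring
  have hmeas := measurable_weightedRiesz a h₁ h₂
  have hle : ∫⁻ p, ENNReal.ofReal (weightedRiesz a W₁ W₂ p ^ 2) ≤
      ENNReal.ofReal (C * (A : ℝ) ^ (2 * a) * (B : ℝ) ^ (2 * a)) := by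
    rw [Measure.volume_eq_prod, lintegral_prod _ (by fun_prop)]
    simp only [hsq]
    refine key.trans (le_of_eq ?_)
    rw [ENNReal.ofReal_mul (by positivity), ENNReal.ofReal_mul (by positivity),
      ← ENNReal.ofReal_coe_nnreal, ← ENNReal.ofReal_coe_nnreal, NNReal.coe_rpow, NNReal.coe_rpow]
  have hintegrable : Integrable fun p => weightedRiesz a W₁ W₂ p ^ 2 := by
    refine ⟨by fun_prop, ?_⟩
    rw [hasFiniteIntegral_iff_ofReal (.of_forall fun p => sq_nonneg _)]
    exact hle.trans_lt ENNReal.ofReal_lt_top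
  refine ⟨(memLp_two_iff_integrable_sq hmeas.aestronglyMeasurable).2 hintegrable, ?_⟩
  rw [integral_eq_lintegral_of_nonneg_ae (.of_forall fun p => sq_nonneg _)
    hintegrable.aestronglyMeasurable]
  exact ENNReal.toReal_le_of_le_ofReal (by positivity) hle

/-- A simple function in `L^Q` has support of finite measure, which `φ` with `φ 0 = 0` preserves. -/
lemma memLp_two_map {W : SimpleFunc (EuclideanSpace ℝ (Fin N)) ℂ} {Q : ℝ} (hQ : 0 < Q)
    (hW : MemLp W (ENNReal.ofReal Q)) {φ : ℂ → ℂ} (hφ : φ 0 = 0) : MemLp (W.map φ) 2 := by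
  rw [SimpleFunc.memLp_iff_finMeasSupp (by norm_num) (by norm_num)]
  rw [SimpleFunc.memLp_iff_finMeasSupp (by simpa using hQ) ENNReal.ofReal_ne_top] at hW
  exact hW.map hφ

/-- The Hilbert-Schmidt bound for the operators `W₁ ^ ζ (-Δ + w²) ^ (-ζ) W₂ ^ ζ`. -/
lemma sum_norm_sq_formFamily_le (hN : 1 ≤ N) {w ζ : ℂ} (hw : 0 < w.re)
    (h1 : ((N : ℝ) - 1) / 2 ≤ ζ.re) (h2 : ζ.re ≤ ((N : ℝ) + 1) / 2) (hζ : 0 < ζ.re) {Q : ℝ}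
    (hQ : 0 < Q) {W₁ W₂ : SimpleFunc (EuclideanSpace ℝ (Fin N)) ℂ}
    (hW₁ : MemLp W₁ (ENNReal.ofReal Q)) (hW₂ : MemLp W₂ (ENNReal.ofReal Q))
    (hρ : MemLp (weightedRiesz ζ.re W₁ W₂) 2) {n : ℕ} {e f : Fin n → L2 N} (he : Orthonormal ℂ e)
    (hf : Orthonormal ℂ f) :
    ∑ j, ‖Complex.Gamma ζ * formFamily w W₁ W₂ (f j) (e j) ζ‖ ^ 2 ≤
      (4 * (14 + 2 * ‖2 * ζ - N - 1‖) * Real.exp (Real.pi * |ζ.im|) *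
        ‖w‖ ^ (((N : ℝ) - 1) / 2 - ζ.re)) ^ 2 * ∫ p, weightedRiesz ζ.re W₁ W₂ p ^ 2 := by
  set κ : ℝ := 4 * (14 + 2 * ‖2 * ζ - N - 1‖) * Real.exp (Real.pi * |ζ.im|) *
        ‖w‖ ^ (((N : ℝ) - 1) / 2 - ζ.re) with hκ
  have hκ0 : 0 ≤ κ := by positivity
  set V₁ := W₁.map fun c => cpowMod c ζ with hV₁
  set V₁' := W₁.map fun c => conj (cpowMod c ζ) with hV₁'
  set V₂ := W₂.map fun c => cpowMod c ζ with hV₂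
  let K : EuclideanSpace ℝ (Fin N) × EuclideanSpace ℝ (Fin N) → ℂ := fun p =>
    V₁ p.1 * V₂ p.2 * resolventKernel N ζ w ‖p.1 - p.2‖
  have hKm : Measurable K := by
    have := (measurable_resolventKernel N ζ w).comp
      ((measurable_fst.sub measurable_snd).norm :
        Measurable fun p : EuclideanSpace ℝ (Fin N) × EuclideanSpace ℝ (Fin N) => ‖p.1 - p.2‖)
    exact ((V₁.measurable.comp measurable_fst).mul (V₂.measurable.comp measurable_snd)).mul this
  have hKle : ∀ᵐ p, ‖K p‖ ≤ κ * weightedRiesz ζ.re W₁ W₂ p := by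
    filter_upwards [ae_fst_ne_snd hN] with p hp
    have e1 := norm_cpowMod_le (W₁ p.1) ζ
    have e2 := norm_cpowMod_le (W₂ p.2) ζ
    have e3 := norm_resolventKernel_le h1 h2 hw hp
    calc ‖K p‖ = ‖cpowMod (W₁ p.1) ζ‖ * ‖cpowMod (W₂ p.2) ζ‖ *
          ‖resolventKernel N ζ w ‖p.1 - p.2‖‖ := by rw [norm_mul, norm_mul]; rfl
      _ ≤ ‖W₁ p.1‖ ^ ζ.re * ‖W₂ p.2‖ ^ ζ.re *
          (κ * ‖p.1 - p.2‖ ^ (ζ.re - ((N : ℝ) + 1) / 2)) := by gcongr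
      _ = _ := by rw [weightedRiesz]; ring
  have hρint := (memLp_two_iff_integrable_sq hρ.1).1 hρ
  have hK : MemLp K 2 := by
    refine (hρ.const_mul κ).mono hKm.aestronglyMeasurable ?_
    filter_upwards [hKle] with p hp
    exact hp.trans (le_abs_self _)
  have hform : ∀ j, Complex.Gamma ζ * formFamily w W₁ W₂ (f j) (e j) ζ =
      ∫ p : EuclideanSpace ℝ (Fin N) × EuclideanSpace ℝ (Fin N),
        conj (f j p.1) * e j p.2 * K p := by
    intro j
    -- The conjugated power is used because the first slot of the form conjugates it back. Both `g`
    -- and `h` are in `L¹ ∩ L²`, so their Fourier transforms are given by integrals.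
    let g : EuclideanSpace ℝ (Fin N) → ℂ := fun x => V₁' x * f j x
    let h : EuclideanSpace ℝ (Fin N) → ℂ := fun x => V₂ x * e j x
    have hg1 : Integrable g := MemLp.integrable_mul
      (memLp_two_map hQ hW₁ (by simp [cpowMod_zero_left])) (Lp.memLp (f j))
    have hh1 : Integrable h := MemLp.integrable_mul
      (memLp_two_map hQ hW₂ (by simp [cpowMod_zero_left])) (Lp.memLp (e j))
    have hg2 : MemLp g 2 := (memLp_congr_ae (coeFn_simpleOp V₁' (f j))).1 (Lp.memLp _)
    have hh2 : MemLp h 2 := (memLp_congr_ae (coeFn_simpleOp V₂ (e j))).1 (Lp.memLp _)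
    have eg : simpleOp V₁' (f j) = hg2.toLp g :=
      Lp.ext ((coeFn_simpleOp V₁' (f j)).trans hg2.coeFn_toLp.symm)
    have eh : simpleOp V₂ (e j) = hh2.toLp h :=
      Lp.ext ((coeFn_simpleOp V₂ (e j)).trans hh2.coeFn_toLp.symm)
    have hFg := coeFn_fourier_toLp hg1 hg2
    have hFh := coeFn_fourier_toLp hh1 hh2
    have hu : Integrable fun ξ => conj (𝓕 g ξ) * 𝓕 h ξ := by
      refine (integrable_conj_fourier_mul (hg2.toLp g) (hh2.toLp h)).congr ?_
      filter_upwards [hFg, hFh] with ξ e1 e2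
      rw [e1, e2]
    -- The integrand is dominated by a product of two `L²` functions on the product space: the
    -- tensor of `f j` and `e j`, and `weightedRiesz`.
    have hv : Integrable fun p : EuclideanSpace ℝ (Fin N) × EuclideanSpace ℝ (Fin N) =>
        ‖conj (g p.1) * h p.2‖ * ‖p.1 - p.2‖ ^ (ζ.re - ((N : ℝ) + 1) / 2) := by
      have hm : AEStronglyMeasurable
          fun p : EuclideanSpace ℝ (Fin N) × EuclideanSpace ℝ (Fin N) =>
            conj (g p.1) * h p.2 := by
        rw [Measure.volume_eq_prod]
        exact (Complex.continuous_conj.comp_aestronglyMeasurable hg1.1.comp_fst).mul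
          hh1.1.comp_snd
      have hm' : Measurable fun p : EuclideanSpace ℝ (Fin N) × EuclideanSpace ℝ (Fin N) =>
          ‖p.1 - p.2‖ ^ (ζ.re - ((N : ℝ) + 1) / 2) := by fun_prop
      refine Integrable.mono' ((memLp_tensor (f j) (e j)).norm.integrable_mul hρ)
        (hm.norm.mul hm'.aestronglyMeasurable) (.of_forall fun p => ?_)
      have e1 := norm_cpowMod_le (W₁ p.1) ζ
      have e2 := norm_cpowMod_le (W₂ p.2) ζ
      rw [Real.norm_of_nonneg (by positivity)]
      calc _ = ‖cpowMod (W₁ p.1) ζ‖ * ‖f j p.1‖ * (‖cpowMod (W₂ p.2) ζ‖ * ‖e j p.2‖) *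
            ‖p.1 - p.2‖ ^ (ζ.re - ((N : ℝ) + 1) / 2) := by
            simp [g, h, hV₁', hV₂]
        _ ≤ ‖W₁ p.1‖ ^ ζ.re * ‖f j p.1‖ * (‖W₂ p.2‖ ^ ζ.re * ‖e j p.2‖) *
            ‖p.1 - p.2‖ ^ (ζ.re - ((N : ℝ) + 1) / 2) := by gcongr
        _ = _ := by
            simp only [weightedRiesz, Pi.mul_apply, norm_mul, RCLike.norm_conj]
            ring
    have hmain := gamma_mul_integral_shiftedSymbol hN hg1 hh1 hu hζ h1 h2 hv hw
    rw [formFamily_eq hw hζ.le, eg, eh, powerForm]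
    have e0 : ∫ ξ, conj ((𝓕 (hg2.toLp g) : L2 N) ξ) * (𝓕 (hh2.toLp h) : L2 N) ξ *
        shiftedSymbol w ξ ^ (-ζ) = ∫ ξ, conj (𝓕 g ξ) * 𝓕 h ξ * shiftedSymbol w ξ ^ (-ζ) := by
      refine integral_congr_ae ?_
      filter_upwards [hFg, hFh] with ξ e1 e2
      rw [e1, e2]
    rw [e0, hmain]
    refine integral_congr_ae (.of_forall fun p => ?_)
    simp only [g, h, K, hV₁', hV₁, hV₂, SimpleFunc.map_apply, map_mul, Complex.conj_conj]
    ring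
  simp only [hform]
  refine (sum_norm_sq_integral_tensor_le he hf hK).trans ?_
  rw [← integral_const_mul]
  refine integral_mono_ae ((memLp_two_iff_integrable_sq_norm hK.1).1 hK)
    (hρint.const_mul _) ?_
  filter_upwards [hKle] with p hp
  rw [← mul_pow]
  gcongr

/-! ### The uniform bound for simple functions -/

/-- By Plancherel's theorem: with `w² = -z` the resolvent symbol is the power `-1` of `shiftedSymbol
w`, and `W₁` moves to the other slot as its conjugate. -/
lemma inner_simpleOp_freeResolvent {w z : ℂ} (hz : z ∈ offHalfAxis) (hw : 0 < w.re)
    (hwz : w ^ 2 = -z) (W₁ W₂ : SimpleFunc (EuclideanSpace ℝ (Fin N)) ℂ) (u v : L2 N) :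
    inner ℂ u (simpleOp W₁ (freeResolvent N z hz (simpleOp W₂ v))) =
      formFamily w W₁ W₂ u v 1 := by
  set h : L2 N := simpleOp W₂ v with hh
  set g : L2 N := simpleOp (W₁.map fun c => conj c) u with hg
  have e1 : inner ℂ u (simpleOp W₁ (freeResolvent N z hz h)) =
      inner ℂ g (freeResolvent N z hz h) := by
    rw [L2.inner_def, L2.inner_def]
    refine integral_congr_ae ?_
    filter_upwards [coeFn_simpleOp W₁ (freeResolvent N z hz h),
      coeFn_simpleOp (W₁.map fun c => conj c) u] with x h1 h2
    rw [h1, hg, h2]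
    simp only [RCLike.inner_apply, map_mul, SimpleFunc.map_apply, Complex.conj_conj]
    ring
  rw [e1, ← (Lp.fourierTransformₗᵢ (EuclideanSpace ℝ (Fin N)) ℂ).inner_map_map g,
    formFamily_eq hw (by simp), L2.inner_def, powerForm]
  simp only [cpowMod_one, ← hg]
  rw [show W₂.map (fun c => c) = W₂ by ext x; rfl, ← hh]
  refine integral_congr_ae ?_
  filter_upwards [coeFn_fourier_freeResolvent hz h] with ξ hξ
  change inner ℂ ((𝓕 g : L2 N) ξ) ((𝓕 (freeResolvent N z hz h) : L2 N) ξ) = _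
  rw [hξ, RCLike.inner_apply, resolventSymbol, Complex.cpow_neg_one, shiftedSymbol, hwz,
    sub_eq_add_neg]
  ring

/-- The factor decays like `exp (-(Im ζ)²)`; completing the square absorbs any `exp (k |Im ζ|)`. -/
lemma norm_exp_sq_sub_one_mul_exp_le (ζ : ℂ) {k : ℝ} :
    ‖Complex.exp (ζ ^ 2 - 1)‖ * Real.exp (k * |ζ.im|) ≤ Real.exp (ζ.re ^ 2 + k ^ 2) := by
  rw [norm_exp_sq_sub_one, ← Real.exp_add, Real.exp_le_exp]
  nlinarith [sq_abs ζ.im, sq_nonneg (|ζ.im| - k / 2), sq_nonneg k]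

lemma rpow_le_max_one_rpow {x r a : ℝ} (hx : 0 ≤ x) (hr : 0 ≤ r) (hra : r ≤ a) :
    x ^ r ≤ max x 1 ^ a :=
  (Real.rpow_le_rpow hx (le_max_left _ _) hr).trans
    (Real.rpow_le_rpow_of_exponent_le (le_max_right _ _) hra)

lemma norm_le_mul_exp_abs_im (ζ : ℂ) : ‖ζ‖ ≤ (|ζ.re| + 1) * Real.exp |ζ.im| := by
  have h1 := Complex.norm_le_abs_re_add_abs_im ζ
  have h2 := Real.add_one_le_exp |ζ.im|
  have h3 := abs_nonneg ζ.im
  nlinarith [abs_nonneg ζ.re]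

/-- The factor `‖ζ‖` arises from `Γ(1 + ζ) = ζ Γ(ζ)`, the other one from the kernel bound. Each
grows at most like `exp |Im ζ|`. -/
lemma norm_kernel_factor_le (ζ : ℂ) (N : ℕ) :
    ‖ζ‖ * (4 * (14 + 2 * ‖2 * ζ - N - 1‖)) ≤
      4 * (|ζ.re| + 1) * (18 + 2 * |2 * ζ.re - N - 1|) * Real.exp (2 * |ζ.im|) := by
  have h1 := norm_le_mul_exp_abs_im ζ
  have h2 : ‖2 * ζ - N - 1‖ ≤ |2 * ζ.re - N - 1| + 2 * |ζ.im| := by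
    refine (Complex.norm_le_abs_re_add_abs_im _).trans (le_of_eq ?_)
    simp [abs_mul]
  have h3 := Real.add_one_le_exp |ζ.im|
  have h4 := abs_nonneg ζ.im
  have h5 : 14 + 2 * ‖2 * ζ - N - 1‖ ≤ (18 + 2 * |2 * ζ.re - N - 1|) * Real.exp |ζ.im| := by
    nlinarith [abs_nonneg (2 * ζ.re - N - 1)]
  rw [two_mul |ζ.im|, Real.exp_add]
  calc _ ≤ (|ζ.re| + 1) * Real.exp |ζ.im| *
        (4 * ((18 + 2 * |2 * ζ.re - N - 1|) * Real.exp |ζ.im|)) := by gcongr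
    _ = _ := by ring

/-- The uniform resolvent bound for simple functions. -/
theorem exists_schattenBound_simple (hN : 1 ≤ N) {a : ℝ} (ha : 1 ≤ a)
    (h1 : ((N : ℝ) - 1) / 2 ≤ a) (h2 : a ≤ ((N : ℝ) + 1) / 2) {Q : ℝ}
    (hQ : Q = 4 * N * a / (N - 1 + 2 * a)) :
    ∃ C : ℝ, 0 ≤ C ∧ ∀ (z : ℂ) (hz : z ∈ offHalfAxis) (w : ℂ), 0 < w.re → w ^ 2 = -z →
      ∀ W₁ W₂ : SimpleFunc (EuclideanSpace ℝ (Fin N)) ℂ,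
      MemLp W₁ (ENNReal.ofReal Q) → MemLp W₂ (ENNReal.ofReal Q) →
      SchattenBound (2 * a) (C * ‖w‖ ^ ((((N : ℝ) - 1) / 2 - a) / a) *
        (eLpNorm W₁ (ENNReal.ofReal Q)).toReal * (eLpNorm W₂ (ENNReal.ofReal Q)).toReal)
        (simpleOp W₁ ∘L freeResolvent N z hz ∘L simpleOp W₂) := by
  have hN' : (1 : ℝ) ≤ N := by exact_mod_cast hN
  have ha0 : 0 < a := by linarith
  have hQ0 : 0 < Q := by rw [hQ]; exact div_pos (by positivity) (by linarith)
  obtain ⟨D, hD, hriesz⟩ := exists_memLp_weightedRiesz hN (by linarith) h2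
  rw [← hQ] at hriesz
  obtain ⟨G, hG, hGamma⟩ := exists_norm_Gamma_le a
  set M₀ : ℝ := G * Real.exp (Real.pi ^ 2) with hM₀
  -- The polynomial factors at `Re ζ = a` times the Gaussian bound with `k = π + 2`, where `π` comes
  -- from the arguments of complex powers in the kernel and `2` from the polynomial factors.
  set c : ℝ := 4 * (a + 1) * (18 + 2 * |2 * a - N - 1|) * Real.exp (a ^ 2 + (Real.pi + 2) ^ 2)
    with hc
  have hM₀0 : 0 ≤ M₀ := by positivity
  have hc0 : 0 ≤ c := by positivity
  refine ⟨M₀ ^ (1 - 1 / a) * (c * √D) ^ (1 / a), by positivity,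
    fun z hz w hw hwz W₁ W₂ hW₁ hW₂ n e f he hf => ?_⟩
  set A : ℝ≥0 := (eLpNorm W₁ (ENNReal.ofReal Q)).toNNReal with hA
  set B : ℝ≥0 := (eLpNorm W₂ (ENNReal.ofReal Q)).toNNReal with hB
  have hAe : (eLpNorm W₁ (ENNReal.ofReal Q)) = A := (ENNReal.coe_toNNReal hW₁.2.ne).symm
  have hBe : (eLpNorm W₂ (ENNReal.ofReal Q)) = B := (ENNReal.coe_toNNReal hW₂.2.ne).symm
  obtain ⟨hρ, hρle⟩ := hriesz W₁ W₂ W₁.measurable W₂.measurable A B hAe.le hBe.le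
  rw [hAe, hBe, ENNReal.coe_toReal, ENNReal.coe_toReal]
  set M₁ : ℝ := c * ‖w‖ ^ (((N : ℝ) - 1) / 2 - a) * √D * (A : ℝ) ^ a * (B : ℝ) ^ a with hM₁
  have hM₁0 : 0 ≤ M₁ := by positivity
  obtain ⟨B₁, hB₁⟩ := W₁.exists_forall_norm_le
  obtain ⟨B₂, hB₂⟩ := W₂.exists_forall_norm_le
  have hB₁0 : 0 ≤ B₁ := (norm_nonneg _).trans (hB₁ 0)
  have hB₂0 : 0 ≤ B₂ := (norm_nonneg _).trans (hB₂ 0)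
  -- Both prefactors equal `1` at `ζ = 1`. `Γ(1 + ζ)` has no pole in the strip and is `ζ` times the
  -- normalisation of the kernel formula.
  let F : Fin n → ℂ → ℂ := fun j ζ =>
    Complex.exp (ζ ^ 2 - 1) * Complex.Gamma (1 + ζ) * formFamily w W₁ W₂ (f j) (e j) ζ
  have hFle : ∀ j ζ, 0 ≤ ζ.re → ζ.re ≤ a → ‖F j ζ‖ ≤ G * Real.exp (ζ.re ^ 2 + Real.pi ^ 2) *
      ((w.re ^ 2)⁻¹ ^ ζ.re * B₁ ^ ζ.re * B₂ ^ ζ.re) := by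
    intro j ζ h0 h1
    have e1 := norm_formFamily_le hw h0 hB₁ hB₂ (f j) (e j)
    rw [hf.1, he.1, mul_one, mul_one] at e1
    have e2 := norm_exp_sq_sub_one_mul_exp_le ζ (k := Real.pi)
    calc ‖F j ζ‖ = ‖Complex.exp (ζ ^ 2 - 1)‖ * ‖Complex.Gamma (1 + ζ)‖ *
          ‖formFamily w W₁ W₂ (f j) (e j) ζ‖ := by simp only [F, norm_mul]
      _ ≤ ‖Complex.exp (ζ ^ 2 - 1)‖ * G * (Real.exp (Real.pi * |ζ.im|) *
          ((w.re ^ 2)⁻¹ ^ ζ.re * B₁ ^ ζ.re * B₂ ^ ζ.re)) := by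
          gcongr
          exact hGamma ζ h0 h1
      _ = G * (‖Complex.exp (ζ ^ 2 - 1)‖ * Real.exp (Real.pi * |ζ.im|)) *
          ((w.re ^ 2)⁻¹ ^ ζ.re * B₁ ^ ζ.re * B₂ ^ ζ.re) := by ring
      _ ≤ _ := by gcongr
  have hdiff : ∀ j, DiffContOnCl ℂ (F j) (Complex.HadamardThreeLines.verticalStrip 0 a) := by
    intro j
    refine DiffContOnCl.smul (𝕜' := ℂ)
      (c := fun ζ => Complex.exp (ζ ^ 2 - 1) * Complex.Gamma (1 + ζ)) ?_
      (diffContOnCl_formFamily hw W₁ W₂ (f j) (e j))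
    refine DifferentiableOn.diffContOnCl fun ζ hζ => ?_
    have hζ0 : 0 ≤ ζ.re := closure_minimal (t := {ζ : ℂ | 0 ≤ ζ.re})
      (fun ζ hζ => (hζ.1 : 0 < ζ.re).le) (isClosed_le continuous_const Complex.continuous_re) hζ
    have hΓ : DifferentiableAt ℂ (fun ζ => Complex.Gamma (1 + ζ)) ζ := by
      refine DifferentiableAt.comp ζ (Complex.differentiableAt_Gamma _ fun m hm => ?_)
        (by fun_prop)
      have := congrArg Complex.re hm
      simp at this
      have : (0 : ℝ) ≤ m := m.cast_nonneg
      linarith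
    exact (DifferentiableAt.mul (by fun_prop) hΓ).differentiableWithinAt
  -- The constant `K` depends on `w`, `W₁` and `W₂`; it serves only the boundedness hypothesis and
  -- is absent from the conclusion.
  have hbound := sum_rpow_le_of_interpolation (q := F)
    (K := G * Real.exp (a ^ 2 + Real.pi ^ 2) *
      (max (w.re ^ 2)⁻¹ 1 ^ a * max B₁ 1 ^ a * max B₂ 1 ^ a)) ha hM₀0 hM₁0 hdiff ?_ ?_ ?_
  · have e1 : ∀ j, inner ℂ (f j) ((simpleOp W₁ ∘L freeResolvent N z hz ∘L simpleOp W₂) (e j)) =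
        F j 1 := fun j => by
      refine (inner_simpleOp_freeResolvent hz hw hwz W₁ W₂ (f j) (e j)).trans ?_
      have : Complex.Gamma (1 + 1) = 1 := by
        rw [Complex.Gamma_add_one _ one_ne_zero, Complex.Gamma_one, one_mul]
      simp [F, this]
    simp only [e1]
    refine hbound.trans (le_of_eq ?_)
    congr 1
    have e2 : M₁ = (c * √D) * ‖w‖ ^ (((N : ℝ) - 1) / 2 - a) * (A : ℝ) ^ a * (B : ℝ) ^ a := by
      rw [hM₁]; ring
    have e3 : ∀ x : ℝ≥0, ((x : ℝ) ^ a) ^ (1 / a) = x := fun x => by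
      rw [← Real.rpow_mul x.coe_nonneg, mul_one_div_cancel ha0.ne', Real.rpow_one]
    have e4 : M₁ ^ (1 / a) =
        (c * √D) ^ (1 / a) * ‖w‖ ^ ((((N : ℝ) - 1) / 2 - a) / a) * A * B := by
      rw [e2, Real.mul_rpow (by positivity) (by positivity),
        Real.mul_rpow (by positivity) (by positivity),
        Real.mul_rpow (by positivity) (by positivity),
        e3, e3, ← Real.rpow_mul (norm_nonneg _), mul_one_div]
    rw [e4]
    ring
  · intro j ζ hζ
    have hζ' : 0 ≤ ζ.re ∧ ζ.re ≤ a := hζ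
    refine (hFle j ζ hζ'.1 hζ'.2).trans ?_
    have e1 := rpow_le_max_one_rpow (x := (w.re ^ 2)⁻¹) (by positivity) hζ'.1 hζ'.2
    have e2 := rpow_le_max_one_rpow hB₁0 hζ'.1 hζ'.2
    have e3 := rpow_le_max_one_rpow hB₂0 hζ'.1 hζ'.2
    gcongr
    · exact hζ'.1
    · exact hζ'.2
  · intro j ζ hζ
    refine (hFle j ζ hζ.ge (hζ.trans_le ha0.le)).trans (le_of_eq ?_)
    rw [hζ, hM₀]
    simp
  · intro ζ hζ
    have hζ0 : ζ ≠ 0 := by rintro rfl; simp at hζ; linarith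
    have hζre : 0 < ζ.re := by linarith
    have hsum := sum_norm_sq_formFamily_le hN hw (hζ ▸ h1) (hζ ▸ h2) hζre hQ0 hW₁ hW₂
      (by rw [hζ]; exact hρ) he hf
    have e1 : ∀ j, ‖F j ζ‖ ^ 2 = (‖Complex.exp (ζ ^ 2 - 1)‖ * ‖ζ‖) ^ 2 *
        ‖Complex.Gamma ζ * formFamily w W₁ W₂ (f j) (e j) ζ‖ ^ 2 := fun j => by
      simp only [F]
      rw [add_comm 1 ζ, Complex.Gamma_add_one ζ hζ0, ← mul_pow, ← norm_mul, ← norm_mul]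
      congr 2
      ring
    simp only [e1]
    rw [← Finset.mul_sum]
    have e2 : ‖Complex.exp (ζ ^ 2 - 1)‖ * ‖ζ‖ * (4 * (14 + 2 * ‖2 * ζ - N - 1‖) *
        Real.exp (Real.pi * |ζ.im|) * ‖w‖ ^ (((N : ℝ) - 1) / 2 - a)) ≤
        c * ‖w‖ ^ (((N : ℝ) - 1) / 2 - a) := by
      have e3 := norm_kernel_factor_le ζ N
      have e4 := norm_exp_sq_sub_one_mul_exp_le ζ (k := Real.pi + 2)
      rw [add_mul, Real.exp_add] at e4
      rw [hζ, abs_of_pos ha0] at e3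
      rw [hζ] at e4
      calc _ = ‖Complex.exp (ζ ^ 2 - 1)‖ * (‖ζ‖ * (4 * (14 + 2 * ‖2 * ζ - N - 1‖))) *
          Real.exp (Real.pi * |ζ.im|) * ‖w‖ ^ (((N : ℝ) - 1) / 2 - a) := by ring
        _ ≤ ‖Complex.exp (ζ ^ 2 - 1)‖ * (4 * (a + 1) * (18 + 2 * |2 * a - N - 1|) *
          Real.exp (2 * |ζ.im|)) *
          Real.exp (Real.pi * |ζ.im|) * ‖w‖ ^ (((N : ℝ) - 1) / 2 - a) := by gcongr
        _ = 4 * (a + 1) * (18 + 2 * |2 * a - N - 1|) * (‖Complex.exp (ζ ^ 2 - 1)‖ *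
          (Real.exp (Real.pi * |ζ.im|) * Real.exp (2 * |ζ.im|))) *
          ‖w‖ ^ (((N : ℝ) - 1) / 2 - a) := by ring
        _ ≤ _ := by rw [hc]; gcongr
    rw [hζ] at hsum
    calc _ ≤ (‖Complex.exp (ζ ^ 2 - 1)‖ * ‖ζ‖) ^ 2 * ((4 * (14 + 2 * ‖2 * ζ - N - 1‖) *
        Real.exp (Real.pi * |ζ.im|) * ‖w‖ ^ (((N : ℝ) - 1) / 2 - a)) ^ 2 *
          (D * (A : ℝ) ^ (2 * a) * (B : ℝ) ^ (2 * a))) :=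
          mul_le_mul_of_nonneg_left (hsum.trans (mul_le_mul_of_nonneg_left hρle (by positivity)))
            (by positivity)
      _ = (‖Complex.exp (ζ ^ 2 - 1)‖ * ‖ζ‖ * (4 * (14 + 2 * ‖2 * ζ - N - 1‖) *
        Real.exp (Real.pi * |ζ.im|) * ‖w‖ ^ (((N : ℝ) - 1) / 2 - a))) ^ 2 *
          (D * (A : ℝ) ^ (2 * a) * (B : ℝ) ^ (2 * a)) := by ring
      _ ≤ (c * ‖w‖ ^ (((N : ℝ) - 1) / 2 - a)) ^ 2 *
          (D * (A : ℝ) ^ (2 * a) * (B : ℝ) ^ (2 * a)) := by gcongr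
      _ = M₁ ^ 2 := by
          have e3 : ∀ x : ℝ≥0, (x : ℝ) ^ (2 * a) = ((x : ℝ) ^ a) ^ 2 := fun x => by
            rw [← Real.rpow_natCast, ← Real.rpow_mul x.coe_nonneg]; congr 1; push_cast; ring
          rw [hM₁, e3, e3]
          simp only [mul_pow, Real.sq_sqrt hD]
          ring

/-! ### Passage to general potentials -/

/-- Besides convergence in `L^p`, the limit on the domain of the sandwiched operator needs
convergence almost everywhere and a dominating function. -/
lemma exists_simpleFunc_tendsto {p : ℝ≥0∞} (hp : p ≠ ∞) {W : EuclideanSpace ℝ (Fin N) → ℂ}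
    (hW : MemLp W p) :
    ∃ S : ℕ → SimpleFunc (EuclideanSpace ℝ (Fin N)) ℂ, (∀ n, MemLp (S n) p) ∧
      Tendsto (fun n => eLpNorm (⇑(S n) - W) p) atTop (𝓝 0) ∧
      (∀ᵐ x, Tendsto (fun n => S n x) atTop (𝓝 (W x))) ∧
      ∀ᵐ x, ∀ n, ‖S n x - W x‖ ≤ ‖W x‖ := by
  have hm : Measurable (hW.1.mk W) := hW.1.stronglyMeasurable_mk.measurable
  have hae := hW.1.ae_eq_mk
  have hW' : MemLp (hW.1.mk W) p := (memLp_congr_ae hae).1 hW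
  refine ⟨SimpleFunc.approxOn (hW.1.mk W) hm univ 0 (mem_univ _),
    fun n => SimpleFunc.memLp_approxOn hm hW' (mem_univ (0 : ℂ)) MemLp.zero n, ?_, ?_, ?_⟩
  · refine (SimpleFunc.tendsto_approxOn_Lp_eLpNorm hm (mem_univ (0 : ℂ)) hp (by simp)
      (by simpa using hW'.2)).congr fun n => eLpNorm_congr_ae ?_
    filter_upwards [hae] with x hx
    simp [hx]
  · filter_upwards [hae] with x hx
    rw [hx]
    exact SimpleFunc.tendsto_approxOn hm (mem_univ _) (by simp)
  · filter_upwards [hae] with x hx n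
    rw [hx]
    have := SimpleFunc.nnnorm_approxOn_le hm (mem_univ (0 : ℂ)) x n
    rw [sub_zero] at this
    exact this

/-- Dominated convergence with majorant `|W f|²`; this is where `W f ∈ L²` enters. -/
lemma tendsto_simpleOp {S : ℕ → SimpleFunc (EuclideanSpace ℝ (Fin N)) ℂ}
    {W : EuclideanSpace ℝ (Fin N) → ℂ} (hS : ∀ᵐ x, Tendsto (fun n => S n x) atTop (𝓝 (W x)))
    (hle : ∀ᵐ x, ∀ n, ‖S n x - W x‖ ≤ ‖W x‖) (f : L2 N) (h : MemLp (fun x => W x * f x) 2) :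
    Tendsto (fun n => simpleOp (S n) f) atTop (𝓝 (h.toLp _)) := by
  rw [Lp.tendsto_Lp_iff_tendsto_eLpNorm']
  simp only [eLpNorm_eq_lintegral_rpow_enorm_toReal two_ne_zero ENNReal.ofNat_ne_top]
  have hae : ∀ᵐ x, ∀ n, (simpleOp (S n) f) x = S n x * f x :=
    ae_all_iff.2 fun n => coeFn_simpleOp (S n) f
  have key : Tendsto (fun n => ∫⁻ x, ‖(⇑(simpleOp (S n) f) - ⇑(h.toLp _)) x‖ₑ ^ (2 : ℝ≥0∞).toReal)
      atTop (𝓝 (∫⁻ _ : EuclideanSpace ℝ (Fin N), 0)) := by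
    refine tendsto_lintegral_of_dominated_convergence'
      (fun x => ‖W x * f x‖ₑ ^ (2 : ℝ≥0∞).toReal)
      (fun n => (((Lp.aestronglyMeasurable _).sub
        (Lp.aestronglyMeasurable _)).enorm).pow_const _) ?_ ?_ ?_
    · intro n
      filter_upwards [hae, hle, h.coeFn_toLp] with x h1 h2 h3
      refine ENNReal.rpow_le_rpow ?_ ENNReal.toReal_nonneg
      rw [Pi.sub_apply, h1 n, h3, ← sub_mul, enorm_mul, enorm_mul]
      gcongr
      exact enorm_le_iff_norm_le.2 (h2 n)
    · exact (lintegral_rpow_enorm_lt_top_of_eLpNorm_lt_top two_ne_zero ENNReal.ofNat_ne_top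
        h.2).ne
    · filter_upwards [hae, hS, h.coeFn_toLp] with x h1 h2 h3
      have e : Tendsto (fun n => (⇑(simpleOp (S n) f) - ⇑(h.toLp _)) x) atTop (𝓝 0) := by
        simp only [Pi.sub_apply, h1, h3]
        simpa using (h2.mul_const (f x)).sub_const (W x * f x)
      have := (ENNReal.continuous_rpow_const (y := (2 : ℝ≥0∞).toReal)).tendsto _ |>.comp e.enorm
      simpa [Function.comp_def] using this
  have := (ENNReal.continuous_rpow_const (y := 1 / (2 : ℝ≥0∞).toReal)).tendsto _ |>.comp key
  simpa [Function.comp_def] using this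

lemma simpleOp_sub (V W : SimpleFunc (EuclideanSpace ℝ (Fin N)) ℂ) :
    simpleOp (V - W) = simpleOp V - simpleOp W := by
  ext1 f
  refine Lp.ext ?_
  filter_upwards [coeFn_simpleOp (V - W) f, coeFn_simpleOp V f, coeFn_simpleOp W f,
    Lp.coeFn_sub (simpleOp V f) (simpleOp W f)] with x h1 h2 h3 h4
  rw [h1, show (simpleOp V - simpleOp W) f = simpleOp V f - simpleOp W f from rfl, h4,
    Pi.sub_apply, h2, h3, SimpleFunc.coe_sub, Pi.sub_apply, sub_mul]

/-- An operator limit of sandwiched operators is a sandwiched operator. -/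
lemma isSandwich_of_tendsto {S₁ S₂ : ℕ → SimpleFunc (EuclideanSpace ℝ (Fin N)) ℂ}
    {W₁ W₂ : EuclideanSpace ℝ (Fin N) → ℂ}
    (h₁ : ∀ᵐ x, Tendsto (fun n => S₁ n x) atTop (𝓝 (W₁ x)))
    (h₂ : ∀ᵐ x, Tendsto (fun n => S₂ n x) atTop (𝓝 (W₂ x)))
    (hle : ∀ᵐ x, ∀ n, ‖S₂ n x - W₂ x‖ ≤ ‖W₂ x‖) {R T : L2 N →L[ℂ] L2 N}
    (hT : Tendsto (fun n => simpleOp (S₁ n) ∘L R ∘L simpleOp (S₂ n)) atTop (𝓝 T)) :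
    IsSandwich W₁ R W₂ T := by
  intro f h
  have hv : Tendsto (fun n => R (simpleOp (S₂ n) f)) atTop (𝓝 (R (h.toLp _))) :=
    (R.continuous.tendsto _).comp (tendsto_simpleOp h₂ hle f h)
  have hTf : Tendsto (fun n => simpleOp (S₁ n) (R (simpleOp (S₂ n) f))) atTop (𝓝 (T f)) :=
    ((ContinuousLinearMap.apply ℂ (L2 N) f).continuous.tendsto T).comp hT
  -- Multiplication by `W₁` need not be bounded on `L²`, so the limit is identified pointwise, after
  -- passing to subsequences that converge almost everywhere.
  obtain ⟨ns, hns, hv'⟩ := (tendstoInMeasure_of_tendsto_Lp hv).exists_seq_tendsto_ae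
  obtain ⟨ms, hms, hT'⟩ := (tendstoInMeasure_of_tendsto_Lp
    (hTf.comp hns.tendsto_atTop)).exists_seq_tendsto_ae
  have hae : ∀ᵐ x, ∀ n, (simpleOp (S₁ n) (R (simpleOp (S₂ n) f))) x =
      S₁ n x * R (simpleOp (S₂ n) f) x := ae_all_iff.2 fun n => coeFn_simpleOp (S₁ n) _
  filter_upwards [h₁, hv', hT', hae] with x e1 e2 e3 e4
  have e5 := (e1.comp (hns.tendsto_atTop.comp hms.tendsto_atTop)).mul (e2.comp hms.tendsto_atTop)
  refine tendsto_nhds_unique e3 (e5.congr fun n => ?_)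
  simp only [Function.comp_apply, e4]

/-- A bound of the sandwiched operators for simple functions extends to general potentials. -/
theorem exists_isSandwich_of_simple {Q α c : ℝ} (hQ : 1 ≤ Q) (hα : 0 < α) (hc : 0 ≤ c)
    {R : L2 N →L[ℂ] L2 N}
    (hR : ∀ W₁ W₂ : SimpleFunc (EuclideanSpace ℝ (Fin N)) ℂ,
      MemLp W₁ (ENNReal.ofReal Q) → MemLp W₂ (ENNReal.ofReal Q) →
      SchattenBound α (c * (eLpNorm W₁ (ENNReal.ofReal Q)).toReal *
        (eLpNorm W₂ (ENNReal.ofReal Q)).toReal) (simpleOp W₁ ∘L R ∘L simpleOp W₂))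
    {W₁ W₂ : EuclideanSpace ℝ (Fin N) → ℂ} (hW₁ : MemLp W₁ (ENNReal.ofReal Q))
    (hW₂ : MemLp W₂ (ENNReal.ofReal Q)) :
    ∃ T : L2 N →L[ℂ] L2 N, IsSandwich W₁ R W₂ T ∧
      SchattenBound α (c * (eLpNorm W₁ (ENNReal.ofReal Q)).toReal *
        (eLpNorm W₂ (ENNReal.ofReal Q)).toReal) T := by
  have hfact : Fact (1 ≤ ENNReal.ofReal Q) := ⟨by simpa using hQ⟩
  obtain ⟨S₁, hS₁, hlim₁, hae₁, -⟩ := exists_simpleFunc_tendsto ENNReal.ofReal_ne_top hW₁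
  obtain ⟨S₂, hS₂, hlim₂, hae₂, hle₂⟩ := exists_simpleFunc_tendsto ENNReal.ofReal_ne_top hW₂
  have hX : Tendsto (fun n => (hS₁ n).toLp (S₁ n)) atTop (𝓝 (hW₁.toLp W₁)) :=
    (Lp.tendsto_Lp_iff_tendsto_eLpNorm'' _ hS₁ _ hW₁).2 hlim₁
  have hY : Tendsto (fun n => (hS₂ n).toLp (S₂ n)) atTop (𝓝 (hW₂.toLp W₂)) :=
    (Lp.tendsto_Lp_iff_tendsto_eLpNorm'' _ hS₂ _ hW₂).2 hlim₂
  -- The operator norm is bounded bilinearly in the `L^Q` norms, so telescoping in the two factors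
  -- makes the approximating operators a Cauchy sequence.
  have hop : ∀ V₁ V₂ : SimpleFunc (EuclideanSpace ℝ (Fin N)) ℂ,
      ∀ h₁ : MemLp V₁ (ENNReal.ofReal Q), ∀ h₂ : MemLp V₂ (ENNReal.ofReal Q),
      ‖simpleOp V₁ ∘L R ∘L simpleOp V₂‖ ≤ c * ‖h₁.toLp V₁‖ * ‖h₂.toLp V₂‖ := by
    intro V₁ V₂ h₁ h₂
    rw [Lp.norm_toLp, Lp.norm_toLp]
    exact (hR V₁ V₂ h₁ h₂).opNorm_le hα (by positivity)
  have hcauchy : CauchySeq fun n => simpleOp (S₁ n) ∘L R ∘L simpleOp (S₂ n) := by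
    rw [cauchySeq_iff_tendsto_dist_atTop_0]
    have h1 : Tendsto (fun n : ℕ × ℕ => n.1) atTop atTop := by
      rw [← prod_atTop_atTop_eq]; exact tendsto_fst
    have h2 : Tendsto (fun n : ℕ × ℕ => n.2) atTop atTop := by
      rw [← prod_atTop_atTop_eq]; exact tendsto_snd
    have hbd := (((((hX.comp h1).sub (hX.comp h2)).norm).const_mul c).mul (hY.comp h1).norm).add
      (((hX.comp h2).norm.const_mul c).mul ((hY.comp h1).sub (hY.comp h2)).norm)
    rw [sub_self, sub_self, norm_zero, mul_zero, zero_mul, mul_zero, add_zero] at hbd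
    refine squeeze_zero (fun _ => dist_nonneg) (fun n => ?_) hbd
    have e : simpleOp (S₁ n.1) ∘L R ∘L simpleOp (S₂ n.1) -
        simpleOp (S₁ n.2) ∘L R ∘L simpleOp (S₂ n.2) =
        simpleOp (S₁ n.1 - S₁ n.2) ∘L R ∘L simpleOp (S₂ n.1) +
          simpleOp (S₁ n.2) ∘L R ∘L simpleOp (S₂ n.1 - S₂ n.2) := by
      rw [simpleOp_sub, simpleOp_sub]
      ext1 f
      simp
    rw [dist_eq_norm, e]
    refine (norm_add_le _ _).trans (add_le_add ?_ ?_)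
    · exact hop (S₁ n.1 - S₁ n.2) (S₂ n.1) ((hS₁ n.1).sub (hS₁ n.2)) (hS₂ n.1)
    · exact hop (S₁ n.2) (S₂ n.1 - S₂ n.2) (hS₁ n.2) ((hS₂ n.1).sub (hS₂ n.2))
  obtain ⟨T, hT⟩ := cauchySeq_tendsto_of_complete hcauchy
  refine ⟨T, isSandwich_of_tendsto hae₁ hae₂ hle₂ hT, ?_⟩
  have hB := (hX.norm.const_mul c).mul hY.norm
  simp only [Lp.norm_toLp] at hB
  exact SchattenBound.of_tendsto hα hT hB fun n => hR _ _ (hS₁ n) (hS₂ n)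

/-- The principal square root of `-z`: off the half-axis `arg (-z) ≠ π`, so its half lies strictly
between `-π/2` and `π/2`. -/
lemma exists_sq_eq_neg {z : ℂ} (hz : z ∈ offHalfAxis) :
    ∃ w : ℂ, 0 < w.re ∧ w ^ 2 = -z ∧ ‖w‖ = ‖z‖ ^ (1 / 2 : ℝ) := by
  have hz0 : -z ≠ 0 := by
    intro h
    exact hz ⟨0, by simp, by simpa [eq_comm] using h⟩
  have harg : Complex.arg (-z) ≠ Real.pi := by
    intro h
    rw [Complex.arg_eq_pi_iff] at h
    refine hz ⟨z.re, ?_, ?_⟩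
    · have := h.1
      simp only [Complex.neg_re] at this
      simp only [mem_Ici]
      linarith
    · have := h.2
      apply Complex.ext
      · simp
      · simpa [eq_comm] using this
  have hw : Complex.exp (Complex.log (-z) / 2) ^ 2 = -z := by
    rw [← Complex.exp_nat_mul, Nat.cast_ofNat, mul_div_cancel₀ _ two_ne_zero, Complex.exp_log hz0]
  refine ⟨Complex.exp (Complex.log (-z) / 2), ?_, hw, ?_⟩
  · rw [Complex.exp_re]
    refine mul_pos (Real.exp_pos _) (Real.cos_pos_of_mem_Ioo ?_)
    have h1 := Complex.neg_pi_lt_arg (-z)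
    have h2 := lt_of_le_of_ne (Complex.arg_le_pi (-z)) harg
    have : (Complex.log (-z) / 2).im = Complex.arg (-z) / 2 := by
      rw [Complex.div_ofNat_im, Complex.log_im]
    rw [this]
    constructor <;> linarith
  · have h := congrArg norm hw
    rw [norm_pow, norm_neg] at h
    rw [← h, ← Real.rpow_natCast, ← Real.rpow_mul (norm_nonneg _)]
    norm_num

end UniformResolvent

end

/-! ### Exponents and conclusion. -/

theorem mainTheorem3 (N : ℕ) (hN : 2 ≤ N) (q : ℝ)
    (hq₂ : N = 2 → 4 / 3 ≤ q ∧ q ≤ 3 / 2)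
    (hq₃ : 3 ≤ N → (N : ℝ) / 2 ≤ q ∧ q ≤ ((N : ℝ) + 1) / 2) :
    ∃ C : ℝ, 0 < C ∧
      ∀ (z : ℂ) (hz : z ∈ offHalfAxis) (W₁ W₂ : EuclideanSpace ℝ (Fin N) → ℂ),
        MemLp W₁ (ENNReal.ofReal (2 * q)) → MemLp W₂ (ENNReal.ofReal (2 * q)) →
        ∃ T : L2 N →L[ℂ] L2 N,
          IsSandwich W₁ (freeResolvent N z hz) W₂ T ∧
          MemSchatten (((N : ℝ) - 1) * q / ((N : ℝ) - q)) T ∧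
          schattenNorm (((N : ℝ) - 1) * q / ((N : ℝ) - q)) T ≤
            C * ‖z‖ ^ (-1 + (N : ℝ) / (2 * q)) *
              (eLpNorm W₁ (ENNReal.ofReal (2 * q))).toReal *
              (eLpNorm W₂ (ENNReal.ofReal (2 * q))).toReal := by
  have hN' : (2 : ℝ) ≤ N := by exact_mod_cast hN
  -- In terms of `a = α / 2` the three inequalities say `(N-1)/2 ≤ a`, `a ≤ (N+1)/2` and `1 ≤ a`.
  -- The last follows from the first for `N ≥ 3`; for `N = 2` it is the condition `4/3 ≤ q`.
  have hq : (N : ℝ) / 2 ≤ q ∧ q ≤ ((N : ℝ) + 1) / 2 ∧ 2 * (N : ℝ) ≤ (N + 1) * q := by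
    rcases hN.eq_or_lt with rfl | h3
    · obtain ⟨h1, h2⟩ := hq₂ rfl
      push_cast
      exact ⟨by linarith, by linarith, by linarith⟩
    · obtain ⟨h1, h2⟩ := hq₃ h3
      have h3' : (3 : ℝ) ≤ N := by exact_mod_cast h3
      exact ⟨h1, h2, by nlinarith⟩
  obtain ⟨hq1, hq2, hq3⟩ := hq
  have hq0 : 0 < q := by linarith
  have hNq : 0 < (N : ℝ) - q := by linarith
  have hN1 : 0 < (N : ℝ) - 1 := by linarith
  obtain ⟨a, ha⟩ : ∃ a : ℝ, ((N : ℝ) - 1) * q / (N - q) = 2 * a := 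
    ⟨((N : ℝ) - 1) * q / (N - q) / 2, by ring⟩
  have ha' : ((N : ℝ) - 1) * q = 2 * a * (N - q) := by rw [← ha]; field_simp
  have ha1 : 1 ≤ a := by
    by_contra! h
    nlinarith
  have h1 : ((N : ℝ) - 1) / 2 ≤ a := by
    by_contra! h
    nlinarith
  have h2 : a ≤ ((N : ℝ) + 1) / 2 := by
    by_contra! h
    nlinarith
  have ha0 : 0 < a := by linarith
  have hQ : 2 * q = 4 * N * a / (N - 1 + 2 * a) := by
    rw [eq_div_iff (by linarith)]
    linear_combination 2 * ha'
  -- The factor `1 / 2` comes from `‖w‖ = ‖z‖^(1/2)`.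
  have hexp : (1 / 2 : ℝ) * ((((N : ℝ) - 1) / 2 - a) / a) = -1 + (N : ℝ) / (2 * q) := by
    field_simp
    linear_combination ha'
  obtain ⟨C, hC, hsimple⟩ := exists_schattenBound_simple (by omega) ha1 h1 h2 hQ
  -- The constant from the simple case is only nonnegative; adding `1` makes it positive.
  refine ⟨C + 1, by linarith, fun z hz W₁ W₂ hW₁ hW₂ => ?_⟩
  obtain ⟨w, hw, hwz, hwn⟩ := exists_sq_eq_neg hz
  obtain ⟨T, hT, hST⟩ := exists_isSandwich_of_simple (by linarith) (by linarith)
    (by positivity) (hsimple z hz w hw hwz) hW₁ hW₂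
  rw [hwn, ← Real.rpow_mul (norm_nonneg _), hexp] at hST
  obtain ⟨hmem, hle⟩ := hST.memSchatten (by linarith) (by positivity)
  rw [ha]
  refine ⟨T, hT, hmem, hle.trans ?_⟩
  gcongr
  linarith
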